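/- Let $G$ be a locally compact second countable topological group acting in a Borel way on a standard Borel space $X$ with uniformly discrete stabilizers: there is a neighbourhood $V$ of the identity $e$ of $G$ such that $g\in V$, $x\in X$ and $gx=x$ imply $g=e$. Let $d$ be a right-invariant metric on $G$ inducing its topology, $\lambda$ a Borel probability measure on $X$, $\alpha_X:X\to X$ a Borel automorphism and $\alpha_G:G\to G$ a group automorphism such that $\alpha_X(gx)=\alpha_G(g)\alpha_X(x)$ for all $g\in G$, $x\in X$; such that $\lambda$ is $\alpha_X$-invariant and $\alpha_X$-ergodic; and such that $d(\alpha_G g,\alpha_G h)=\alpha\, d(g,h)$ for all $g,h\in G$, for some constant $\alpha\in(0,1)$. Let $H$ be a closed normal subgroup of $G$ with $\alpha_G(H)=H$, endowed with the restriction of $d$, let $\pi:G\to G/H$ be the quotient map, and endow $G/H$ with the metric $d(gH,g'H)=\inf\{d(gh,g'h')\,;\,h,h'\in H\}$. Assume that $G/H$ has the Besicovitch covering property: there is an integer $N$ such that, for every bounded set $A\subset G/H$ and every choice of a closed ball of positive radius centred at each point of $A$, some subfamily of these balls covers $A$ and is such that every point of $G/H$ belongs to at most $N$ balls of the subfamily.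 For $L=G$ or $L=H$, a *complete lacunary section* of the action of $L$ is a Borel set $\Sigma\subset X$ such that, for some compact symmetric neighbourhood $U$ of $e$ in $L$, one has $U^2\Sigma=X$, and $gx'=x'$ whenever $x'\in\Sigma$, $g\in U$ and $gx'\in\Sigma$. Let $a_\Sigma^*\lambda$ be the measure $\int d\lambda(x)\,\mathrm{Card}_{\{(g,x')\,;\,gx'=x\}}$ on $L\times\Sigma$, where $\mathrm{Card}$ denotes counting measure; let $\lambda_\Sigma$ be the projection to $\Sigma$ of some finite measure equivalent to $a_\Sigma^*\lambda$, and write $a_\Sigma^*\lambda=\int d\lambda_\Sigma(x')\,\sigma_\Sigma(x')\otimes\delta_{x'}$. A *disintegration of $\lambda$ along $L$* is a Borel map $\sigma_L$ from $X$ to the nonzero Radon measures on $L$ such that, for every complete lacunary section $\Sigma$ (and every choice of $\lambda_\Sigma$ and $\sigma_\Sigma$), there is a conegligible set $X'\subset X$ such that for $\lambda_\Sigma$-almost every $x'$ and every $g\in L$ with $gx'\in X'$, the measure $\sigma_L(gx')$ is a positive multiple of the image of $\sigma_\Sigma(x')$ under $h\mapsto hg^{-1}$. Such a map exists and is unique up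 to scalar factors and negligible sets. Then there are real numbers $\dim(\lambda,G)$, $\dim(\lambda,H)$ and $\underline{\dim}^{\mathrm T}(\lambda,G/H)$ such that: 1. for $L=G$ and $L=H$, for $\lambda$-almost every $x\in X$ and $\sigma_L(x)$-almost every $g\in L$, $$\lim_{\rho\to0}\frac{\log\sigma_L(x)(B(g,\rho))}{\log\rho}=\dim(\lambda,L);$$ 2. for every compact neighbourhood $B$ of $e$ in $G$, writing $\theta^B(x)=\pi_*\left(\frac{\sigma_G(x)|_B}{\sigma_G(x)(B)}\right)$, for $\lambda$-almost every $x\in X$ and $\theta^B(x)$-almost every $q\in G/H$, $$\liminf_{\rho\to0}\frac{\log\theta^B(x)(B(q,\rho))}{\log\rho}=\underline{\dim}^{\mathrm T}(\lambda,G/H);$$ and $$\dim(\lambda,G)=\dim(\lambda,H)+\underline{\dim}^{\mathrm T}(\lambda,G/H).$$ -/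

import Mathlib

open MeasureTheory ProbabilityTheory Filter Topology
open scoped ENNReal Pointwise

noncomputable section

namespace GroupDisintegration

/-! ## Sections and disintegration of a measure along a group action -/

section Disintegration

variable (G : Type*) {X : Type*} [Group G] [TopologicalSpace G] [MeasurableSpace G]
  [MeasurableSpace X] [MulAction G X]

/-- The action of `G` on `X` has uniformly discrete stabilizers: some neighbourhood of the identity
meets every stabilizer in the identity only. -/
def HasUniformlyDiscreteStabilizers (G X : Type*) [Group G] [TopologicalSpace G]
    [MulAction G X] : Prop :=
  ∃ V ∈ 𝓝 (1 : G), ∀ x : X, ∀ g ∈ V, g • x = x → g = 1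

/-- `S` is a complete lacunary section: a Borel set which, for some compact symmetric neighbourhood
`U` of the identity, is `U`-lacunary and `U²`-complete. -/
def IsCompleteLacunarySection (S : Set X) : Prop :=
  MeasurableSet S ∧ ∃ U : Set G, IsCompact U ∧ U ∈ 𝓝 1 ∧ U⁻¹ = U ∧
    (∀ x ∈ S, ∀ g ∈ U, g • x ∈ S → g • x = x) ∧
    (∀ y : X, ∃ g ∈ U * U, ∃ x ∈ S, g • x = y)

/-- The lift to `G × S` of a measure `lam` on `X`: the integral, with respect to `lam`, of the
counting measures of the fibers `{(g, x') | x' ∈ S, g x' = x}` of the map `(g, x') ↦ g x'`.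
It is seen as a measure on `G × X` that gives no mass to the complement of `G × S`. -/
def sectionLift (lam : Measure X) (S : Set X) : Measure (G × X) :=
  lam.bind fun x => Measure.count.restrict {p : G × X | p.2 ∈ S ∧ p.1 • p.2 = x}

/-- `nu` is a pseudo-image of `lam` on the section `S`: the projection of a finite
measure equivalent to the lift of `lam`. -/
def IsPseudoImage (lam : Measure X) (S : Set X) (nu : Measure X) : Prop :=
  ∃ m : Measure (G × X), IsFiniteMeasure m ∧ m ≪ sectionLift G lam S ∧ sectionLift G lam S ≪ m ∧
    nu = m.map Prod.snd

variable {G}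

/-- `kappa` disintegrates the lift of `lam` over the pseudo-image `nu`, that is, the lift is
`∫ kappa(x') ⊗ δ_{x'} d nu(x')`. -/
def IsSectionDisintegration (lam : Measure X) (S : Set X) (nu : Measure X)
    (kappa : Kernel X G) : Prop :=
  IsPseudoImage G lam S nu ∧ IsSFiniteKernel kappa ∧
    sectionLift G lam S = (nu ⊗ₘ kappa).map Prod.swap

/-- Two measures have the same projective class. -/
def SameClass (μ ν : Measure G) : Prop := ∃ c : ℝ≥0∞, c ≠ 0 ∧ c ≠ ∞ ∧ μ = c • ν

/-- `σ` is a (Borel choice of representatives of the) disintegration of `lam` along `G`: a map to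
the nonzero Radon measures on `G` such that, for every complete lacunary section `S` and all
conditional measures `kappa` of the lift of `lam` to `G × S`, the projective class of `σ (g x')` is
that of the image of `kappa x'` under the right translation `h ↦ h g⁻¹`, for almost every `x'` and
every `g` such that `g x'` lies in some fixed conegligible set. -/
structure IsDisintegration (lam : Measure X) (σ : X → Measure G) : Prop where
  measurable : Measurable σ
  locallyFinite : ∀ x, IsLocallyFiniteMeasure (σ x)
  ne_zero : ∀ x, σ x ≠ 0
  compat : ∀ S : Set X, IsCompleteLacunarySection G S →
    ∀ (nu : Measure X) (kappa : Kernel X G), IsSectionDisintegration lam S nu kappa →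
      ∃ X' : Set X, (∀ᵐ x ∂lam, x ∈ X') ∧ ∀ᵐ x' ∂nu, ∀ g : G, g • x' ∈ X' →
        SameClass (σ (g • x')) ((kappa x').map fun h => h * g⁻¹)

end Disintegration

/-! ## Metric notions -/

section Metric

/-- `log μ(B(y, ρ)) / log ρ`, as an extended real number. -/
def dimRatio {Y : Type*} [PseudoMetricSpace Y] [MeasurableSpace Y] (μ : Measure Y) (y : Y)
    (ρ : ℝ) : EReal :=
  ENNReal.log (μ (Metric.ball y ρ)) / (Real.log ρ : EReal)

/-- The lower pointwise dimension of `μ` at `y`. -/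
def lowerPointwiseDim {Y : Type*} [PseudoMetricSpace Y] [MeasurableSpace Y] (μ : Measure Y)
    (y : Y) : EReal :=
  liminf (dimRatio μ y) (𝓝[>] 0)

/-- The Besicovitch covering property: there is a constant `N` such that, for every bounded set `A`
and every choice of closed balls of positive radii centred at the points of `A`, some of these balls
cover `A`, every point of the space belonging to at most `N` of them. -/
def BesicovitchCoveringProperty (Y : Type*) [PseudoMetricSpace Y] : Prop :=
  ∃ N : ℕ, ∀ (A : Set Y) (r : Y → ℝ), Bornology.IsBounded A → (∀ y ∈ A, 0 < r y) →
    ∃ S ⊆ A, (A ⊆ ⋃ y ∈ S, Metric.closedBall y (r y)) ∧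
      ∀ z, {y ∈ S | z ∈ Metric.closedBall y (r y)}.encard ≤ N

end Metric

section Quotient

variable {G : Type*} [Group G] [MetricSpace G] (H : Subgroup G)

/-- The quotient metric: the infimum of the distances between elements of two cosets. -/
def quotDist (a b : G ⧸ H) : ℝ :=
  sInf ((fun p : G × G => dist p.1 p.2) '' {p | (p.1 : G ⧸ H) = a ∧ (p.2 : G ⧸ H) = b})

theorem quotDist_le (g k : G) : quotDist H (g : G ⧸ H) (k : G ⧸ H) ≤ dist g k :=
  csInf_le ⟨0, by rintro _ ⟨p, -, rfl⟩; exact dist_nonneg⟩ ⟨(g, k), ⟨rfl, rfl⟩, rfl⟩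

theorem quotDist_nonneg (a b : G ⧸ H) : 0 ≤ quotDist H a b :=
  Real.sInf_nonneg (by rintro _ ⟨p, -, rfl⟩; exact dist_nonneg)

theorem exists_of_quotDist_lt [IsIsometricSMul Gᵐᵒᵖ G] (g : G) (b : G ⧸ H) {ε : ℝ}
    (h : quotDist H (g : G ⧸ H) b < ε) : ∃ k : G, (k : G ⧸ H) = b ∧ dist g k < ε := by
  obtain ⟨b', rfl⟩ := QuotientGroup.mk_surjective b
  obtain ⟨_, ⟨⟨p, q⟩, ⟨hp, hq⟩, rfl⟩, hlt⟩ :=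
    exists_lt_of_csInf_lt (s := (fun p : G × G => dist p.1 p.2) ''
      {p | (p.1 : G ⧸ H) = g ∧ (p.2 : G ⧸ H) = b'}) ⟨_, (g, b'), ⟨rfl, rfl⟩, rfl⟩ h
  simp only at hp hq hlt
  have hmem : p⁻¹ * g ∈ H := QuotientGroup.eq.1 hp
  refine ⟨q * (p⁻¹ * g), by rw [QuotientGroup.mk_mul_of_mem q hmem, hq], ?_⟩
  have : dist (p * (p⁻¹ * g)) (q * (p⁻¹ * g)) = dist p q := dist_mul_right p q _
  rw [mul_inv_cancel_left] at this
  rwa [this]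

/-- The quotient of a group with a right-invariant metric, with the quotient metric. Its topology is
the quotient topology. -/
instance quotientPseudoMetric [IsIsometricSMul Gᵐᵒᵖ G] : PseudoMetricSpace (G ⧸ H) :=
  PseudoMetricSpace.ofDistTopology (quotDist H)
    (by
      intro a
      obtain ⟨g, rfl⟩ := QuotientGroup.mk_surjective a
      exact le_antisymm ((quotDist_le H g g).trans_eq (dist_self g)) (quotDist_nonneg H _ _))
    (by
      intro a b
      unfold quotDist
      congr 1
      ext t
      constructor
      · rintro ⟨⟨p, q⟩, ⟨hp, hq⟩, rfl⟩
        exact ⟨(q, p), ⟨hq, hp⟩, dist_comm _ _⟩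
      · rintro ⟨⟨p, q⟩, ⟨hp, hq⟩, rfl⟩
        exact ⟨(q, p), ⟨hq, hp⟩, dist_comm _ _⟩)
    (by
      intro a b c
      refine le_of_forall_pos_lt_add fun ε hε => ?_
      obtain ⟨g, rfl⟩ := QuotientGroup.mk_surjective a
      obtain ⟨k, rfl, hk⟩ := exists_of_quotDist_lt H g b
        (lt_add_of_pos_right (quotDist H g b) (half_pos hε))
      obtain ⟨l, rfl, hl⟩ := exists_of_quotDist_lt H k c
        (lt_add_of_pos_right (quotDist H k c) (half_pos hε))
      have h1 := quotDist_le H g l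
      have h2 := dist_triangle g k l
      linarith)
    (by
      intro s
      rw [← (QuotientGroup.isQuotientMap_mk H).isOpen_preimage]
      constructor
      · intro hs x hx
        obtain ⟨g, rfl⟩ := QuotientGroup.mk_surjective x
        obtain ⟨ε, hε, hball⟩ := Metric.isOpen_iff.1 hs g hx
        refine ⟨ε, hε, fun y hy => ?_⟩
        obtain ⟨k, rfl, hk⟩ := exists_of_quotDist_lt H g y hy
        exact hball (Metric.mem_ball'.2 hk)
      · intro hs
        refine Metric.isOpen_iff.2 fun g hg => ?_
        obtain ⟨ε, hε, h⟩ := hs g hg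
        exact ⟨ε, hε, fun k hk => h k ((quotDist_le H g k).trans_lt (Metric.mem_ball'.1 hk))⟩)

end Quotient

/-! ## Dimensions along a group -/

section Dimension

variable {X : Type*} [MeasurableSpace X]

/-- The dimension of `lam` along `G` is the real number `d`: `lam` admits a disintegration along
`G`, and the conditional measures are, almost surely, exact-dimensional of dimension `d`. -/
def HasDimAlong (G : Type*) [Group G] [MetricSpace G] [MeasurableSpace G] [MulAction G X]
    (lam : Measure X) (d : ℝ) : Prop :=
  (∃ σ : X → Measure G, IsDisintegration lam σ) ∧
    ∀ σ : X → Measure G, IsDisintegration lam σ →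
      ∀ᵐ x ∂lam, ∀ᵐ g ∂(σ x), Tendsto (dimRatio (σ x) g) (𝓝[>] 0) (𝓝 (d : EReal))

/-- The measure `θ^B`: condition `μ` on `B` and push it forward to `G ⧸ H`. -/
def transverseMeasure {G : Type*} [Group G] [MeasurableSpace G] (H : Subgroup G) (B : Set G)
    (μ : Measure G) : Measure (G ⧸ H) :=
  (cond μ B).map (QuotientGroup.mk : G → G ⧸ H)

/-- The transverse to `H` (lower) dimension of `lam` along `G` is the real number `d`: `lam` admits
a disintegration `σ` along `G`, and for every compact neighbourhood `B` of the identity the measure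
`θ^B` of `σ x` has, almost surely, lower pointwise dimension `d` almost everywhere. -/
def HasTransverseDim {G : Type*} [Group G] [MetricSpace G] [IsIsometricSMul Gᵐᵒᵖ G]
    [MeasurableSpace G] [MulAction G X] (H : Subgroup G) (lam : Measure X) (d : ℝ) : Prop :=
  (∃ σ : X → Measure G, IsDisintegration lam σ) ∧
    ∀ σ : X → Measure G, IsDisintegration lam σ → ∀ B : Set G, IsCompact B → B ∈ 𝓝 1 →
      ∀ᵐ x ∂lam, ∀ᵐ q ∂(transverseMeasure H B (σ x)),
        lowerPointwiseDim (transverseMeasure H B (σ x)) q = (d : EReal)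

end Dimension

end GroupDisintegration

end

/-!
The measures `σ_G` and `σ_H` are determined by the action up to positive scalars, so the
automorphism carries the disintegration at `x` to a multiple of the one at the image point, while it
contracts distances by the factor `α`. Hence the mass of a small ball need only be read at the radii
`α ^ n`, and the logarithm of the mass at radius `α ^ n` is a Birkhoff sum, along the orbit of `x`
under the inverse automorphism, of the function `logRatio`: the logarithm of the ratio of the
integrals of a fixed bump function at the scales `1` and `α`. Birkhoff's ergodic theorem gives the
exact dimension for `G` and for `H`, as the integral of the corresponding `logRatio` divided by
`log α`. Its integrability comes from the maximal inequality `measure_badSet_le`.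

The transverse measure of a small ball in `G ⧸ H` is the mass of a thin tube around a coset of `H`.
Comparing the integral of a bump function over the tube of radius `α ^ n` with the integral over the
ball of radius `α ^ n` gives again a telescoping sum, but now the `k`-th term depends on the tube of
radius `α ^ (n - k)` at the `k`-th point of the orbit. As the radius tends to zero these terms
converge almost everywhere to the `logRatio` of `H` (`MassTransport.ae_tendsto_tube`): the
differentiation theorem in `G ⧸ H`, which holds by the Besicovitch covering property, identifies the
limit of averages over tubes with an average over a coset of `H`, and
`MassTransport.lintegral_coset_swap` relates such averages to the disintegration along `H`. The terms
are dominated by an integrable function (`MassTransport.exists_integrable_bound`), once more by a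
maximal inequality, this time for tubes. Maker's form of the ergodic theorem, `tendsto_sum_maker`,
then replaces the terms by their limit, and yields the growth rate of the tubes in
`MassTransport.ae_hasRate_tubeIntegral`. The rates of the ball in `G`, the ball in `H` and the tube
are linked by the same telescoping identity, and this is the additivity of the dimensions.

Passing between a statement about `x` and one about `σ_L(x)`-almost every translate of `x` uses a
mass transport formula, `IsDisintegration.nonempty_massTransport`, whose cocycle also enters the
maximal inequalities. It is proved from a complete lacunary section. One exists,
`exists_isCompleteLacunarySection`, as the greedy union of countably many lacunary sets, each made of
lexicographic minima of functions that are continuous along the orbits and separate points;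
`exists_isDisintegration` then gives the disintegrations themselves.
-/

set_option linter.unusedSectionVars false

namespace GroupDisintegration

/-! ### Pointwise ergodic theorems -/

section Ergodic

variable {Ω : Type*} {T : Ω → Ω}

/-- `maxBirkhoff T f n x` is the maximum of the Birkhoff sums of `f` at `x` of length at most `n`,
computed by the recursion on which the maximal ergodic argument relies. -/
noncomputable def maxBirkhoff (T : Ω → Ω) (f : Ω → ℝ) : ℕ → Ω → ℝ
  | 0, _ => 0
  | n + 1, x => max 0 (f x + maxBirkhoff T f n (T x))

theorem maxBirkhoff_nonneg (f : Ω → ℝ) (n : ℕ) (x : Ω) : 0 ≤ maxBirkhoff T f n x := by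
  cases n with
  | zero => exact le_rfl
  | succ n => exact le_max_left _ _

theorem maxBirkhoff_le_succ (f : Ω → ℝ) (n : ℕ) (x : Ω) :
    maxBirkhoff T f n x ≤ maxBirkhoff T f (n + 1) x := by
  induction n generalizing x with
  | zero => exact maxBirkhoff_nonneg f 1 x
  | succ n ih => exact max_le_max le_rfl (add_le_add le_rfl (ih (T x)))

theorem birkhoffSum_le_maxBirkhoff (f : Ω → ℝ) (n : ℕ) (x : Ω) :
    birkhoffSum T f n x ≤ maxBirkhoff T f n x := by
  induction n generalizing x with
  | zero => simp [maxBirkhoff]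
  | succ n ih =>
    rw [birkhoffSum_succ']
    exact (add_le_add le_rfl (ih (T x))).trans (le_max_right _ _)

variable [MeasurableSpace Ω] {μ : Measure Ω}

theorem measurable_maxBirkhoff (hT : Measurable T) {f : Ω → ℝ} (hf : Measurable f) (n : ℕ) :
    Measurable (maxBirkhoff T f n) := by
  induction n with
  | zero => exact measurable_const
  | succ n ih => exact measurable_const.max (hf.add (ih.comp hT))

theorem integrable_maxBirkhoff [IsFiniteMeasure μ] (hT : MeasurePreserving T μ μ) {f : Ω → ℝ}
    (hf : Integrable f μ) (n : ℕ) : Integrable (maxBirkhoff T f n) μ := by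
  induction n with
  | zero => exact integrable_zero _ _ _
  | succ n ih =>
    have : Integrable (fun x => f x + maxBirkhoff T f n (T x)) μ :=
      hf.add (hT.integrable_comp_of_integrable ih)
    exact (integrable_zero Ω ℝ μ).sup this

/-- If `f` has negative integral, then its Birkhoff sums are bounded above almost everywhere:
otherwise, by ergodicity, `maxBirkhoff T f (n + 1) - maxBirkhoff T f n ∘ T`, whose integral is
nonnegative by invariance, would decrease to `f` almost everywhere. -/
theorem ae_bddAbove_birkhoffSum [IsProbabilityMeasure μ] (hT : Ergodic T μ) {f : Ω → ℝ}
    (hfm : Measurable f) (hf : Integrable f μ) (hneg : ∫ x, f x ∂μ < 0) :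
    ∀ᵐ x ∂μ, ∃ C : ℝ, ∀ n, birkhoffSum T f n x ≤ C := by
  set M := maxBirkhoff T f with hM
  have hTm := hT.toMeasurePreserving.measurable
  have hMm : ∀ n, Measurable (M n) := measurable_maxBirkhoff hTm hfm
  have hMi : ∀ n, Integrable (M n) μ := integrable_maxBirkhoff hT.toMeasurePreserving hf
  have hmono : ∀ x, Monotone fun n => M n x := fun x =>
    monotone_nat_of_le_succ fun n => maxBirkhoff_le_succ f n x
  -- the invariant set on which the maxima are unbounded
  let A : Set Ω := {x | ∀ C : ℕ, ∃ n, (C : ℝ) < M n x}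
  have hA : MeasurableSet A := by
    have : A = ⋂ C : ℕ, ⋃ n, {x | (C : ℝ) < M n x} := by ext; simp [A]
    rw [this]
    exact .iInter fun C => .iUnion fun n => measurableSet_lt measurable_const (hMm n)
  have hinv : T ⁻¹' A = A := by
    ext x
    constructor
    · intro h C
      obtain ⟨D, hD⟩ := exists_nat_gt (C - f x)
      obtain ⟨n, hn⟩ := h D
      exact ⟨n + 1, lt_of_lt_of_le (by linarith) (le_max_right _ _)⟩
    · intro h C
      obtain ⟨D, hD⟩ := exists_nat_gt (max 0 (C + f x))
      obtain ⟨n, hn⟩ := h D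
      have hn' := lt_of_lt_of_le hn (maxBirkhoff_le_succ f n x)
      refine ⟨n, ?_⟩
      have h1 : (0 : ℝ) < M (n + 1) x := lt_of_le_of_lt (Nat.cast_nonneg D) hn'
      have h2 : M (n + 1) x = max 0 (f x + M n (T x)) := rfl
      rcases max_choice 0 (f x + M n (T x)) with h3 | h3
      · rw [h2, h3] at h1; exact absurd h1 (lt_irrefl _)
      · have := le_max_right 0 (C + f x)
        change (D : ℝ) < M (n + 1) x at hn'
        rw [h2, h3] at hn'
        linarith
  have hdich := hT.toPreErgodic.ae_mem_or_ae_notMem hA hinv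
  rcases hdich with h | h
  -- if the maxima tend to infinity, then `M (n + 1) - M n ∘ T = f` for large `n`, at almost every
  -- point
  · exfalso
    have hlim : Tendsto (fun n => ∫ x, (M (n + 1) x - M n (T x)) ∂μ) atTop (𝓝 (∫ x, f x ∂μ)) := by
      refine tendsto_integral_of_dominated_convergence (fun x => |f x|)
        (fun n => ((hMm _).sub ((hMm n).comp hTm)).aestronglyMeasurable) hf.abs ?_ ?_
      · intro n
        refine Eventually.of_forall fun x => ?_
        have h2 : M (n + 1) x = max 0 (f x + M n (T x)) := rfl
        have h3 := maxBirkhoff_nonneg (T := T) f n (T x)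
        rw [h2, Real.norm_eq_abs, abs_le]
        constructor
        · have := le_max_right 0 (f x + M n (T x))
          have := neg_abs_le (f x)
          linarith
        · rw [sub_le_iff_le_add]
          exact max_le (add_nonneg (abs_nonneg _) h3) (add_le_add (le_abs_self _) le_rfl)
      · filter_upwards [h, hT.toMeasurePreserving.quasiMeasurePreserving.ae h] with x _ hx
        obtain ⟨C, hC⟩ := exists_nat_gt (-f x)
        obtain ⟨n, hn⟩ := hx C
        refine tendsto_const_nhds.congr' ?_
        filter_upwards [eventually_ge_atTop n] with m hm
        have h2 : M (m + 1) x = max 0 (f x + M m (T x)) := rfl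
        have h3 : M n (T x) ≤ M m (T x) := hmono _ hm
        rw [h2, max_eq_right (by linarith)]
        ring
    have hnn : ∀ n, 0 ≤ ∫ x, (M (n + 1) x - M n (T x)) ∂μ := by
      intro n
      have e : ∫ x, M n (T x) ∂μ = ∫ x, M n x ∂μ := by
          conv_rhs => rw [← hT.toMeasurePreserving.map_eq]
          exact (integral_map hTm.aemeasurable (hMm n).aestronglyMeasurable).symm
      have hi : Integrable (fun x => M n (T x)) μ :=
        hT.toMeasurePreserving.integrable_comp_of_integrable (hMi n)
      rw [integral_sub (hMi _) hi, e, sub_nonneg]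
      exact integral_mono (hMi _) (hMi _) fun x => maxBirkhoff_le_succ f n x
    exact absurd (ge_of_tendsto' hlim hnn) (not_le.2 hneg)
  · filter_upwards [h] with x hx
    simp only [A, Set.mem_ofPred_eq, not_forall, not_exists, not_lt] at hx
    obtain ⟨C, hC⟩ := hx
    exact ⟨C, fun n => (birkhoffSum_le_maxBirkhoff f n x).trans (hC n)⟩

/-- The upper half of the pointwise ergodic theorem: subtracting from `f` slightly more than its mean
makes the Birkhoff sums bounded above. -/
theorem ae_eventually_birkhoffSum_le [IsProbabilityMeasure μ] (hT : Ergodic T μ) {f : Ω → ℝ}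
    (hfm : Measurable f) (hf : Integrable f μ) :
    ∀ᵐ x ∂μ, ∀ ε > 0, ∀ᶠ n : ℕ in atTop, birkhoffSum T f n x / n ≤ ∫ x, f x ∂μ + ε := by
  have key : ∀ k : ℕ, ∀ᵐ x ∂μ, ∃ C : ℝ, ∀ n : ℕ,
      birkhoffSum T f n x ≤ C + n * (∫ x, f x ∂μ + 1 / (k + 1)) := by
    intro k
    set c := ∫ x, f x ∂μ + 1 / (k + 1) with hc
    have hk : (0 : ℝ) < 1 / (k + 1) := by positivity
    have h := ae_bddAbove_birkhoffSum hT (f := fun x => f x - c) (hfm.sub_const _)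
      (hf.sub (integrable_const _)) (by
        rw [integral_sub hf (integrable_const _)]
        simp [hc]
        positivity)
    filter_upwards [h] with x hx
    obtain ⟨C, hC⟩ := hx
    refine ⟨C, fun n => ?_⟩
    have := hC n
    simp only [birkhoffSum, Finset.sum_sub_distrib, Finset.sum_const, Finset.card_range,
      nsmul_eq_mul] at this
    simp only [birkhoffSum]
    linarith
  filter_upwards [ae_all_iff.2 key] with x hx ε hε
  obtain ⟨k, hk⟩ := exists_nat_one_div_lt (half_pos hε)
  obtain ⟨C, hC⟩ := hx k
  obtain ⟨N, hN⟩ := exists_nat_gt (C / (ε / 2))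
  filter_upwards [eventually_ge_atTop (max N 1)] with n hn
  have hn1 : (1 : ℝ) ≤ n := by exact_mod_cast (le_max_right _ _).trans hn
  have hn2 : (N : ℝ) ≤ n := by exact_mod_cast (le_max_left _ _).trans hn
  rw [div_le_iff₀ (by linarith)]
  have h1 := hC n
  have h2 : C < N * (ε / 2) := (div_lt_iff₀ (half_pos hε)).1 hN
  nlinarith

/-- Birkhoff's pointwise ergodic theorem, for an ergodic transformation. -/
theorem tendsto_birkhoffSum_div [IsProbabilityMeasure μ] (hT : Ergodic T μ) {f : Ω → ℝ}
    (hfm : Measurable f) (hf : Integrable f μ) :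
    ∀ᵐ x ∂μ, Tendsto (fun n : ℕ => birkhoffSum T f n x / n) atTop (𝓝 (∫ x, f x ∂μ)) := by
  filter_upwards [ae_eventually_birkhoffSum_le hT hfm hf,
    ae_eventually_birkhoffSum_le hT hfm.neg hf.neg] with x h1 h2
  rw [Metric.tendsto_atTop']
  intro ε hε
  have := (h1 _ (half_pos hε)).and (h2 _ (half_pos hε))
  obtain ⟨N, hN⟩ := eventually_atTop.1 this
  refine ⟨N, fun n hn => ?_⟩
  obtain ⟨h3, h4⟩ := hN n hn.le
  simp only [Pi.neg_apply, integral_neg] at h4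
  have h5 : birkhoffSum T (-f) n x = - birkhoffSum T f n x := by simp [birkhoffSum]
  rw [h5, neg_div] at h4
  rw [Real.dist_eq, abs_lt]
  constructor <;> linarith

/-- Maker's ergodic theorem: in the Birkhoff averages of `g`, the `k`-th term may be replaced by
`g_{n-k}`, if `g_m` converges to `g` almost everywhere and is dominated. -/
theorem tendsto_sum_maker [IsProbabilityMeasure μ] (hT : Ergodic T μ) {g : ℕ → Ω → ℝ}
    {g' G : Ω → ℝ} (hgm : ∀ m, Measurable (g m)) (hg'm : Measurable g')
    (hG : Integrable G μ) (hbound : ∀ᵐ x ∂μ, ∀ m, |g m x| ≤ G x)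
    (hlim : ∀ᵐ x ∂μ, Tendsto (fun m => g m x) atTop (𝓝 (g' x))) :
    Integrable g' μ ∧ ∀ᵐ x ∂μ, Tendsto
      (fun n : ℕ => (∑ k ∈ Finset.range n, g (n - k) (T^[k] x)) / n) atTop
      (𝓝 (∫ x, g' x ∂μ)) := by
  have hbound' : ∀ᵐ x ∂μ, |g' x| ≤ G x := by
    filter_upwards [hbound, hlim] with x h1 h2
    exact le_of_tendsto' h2.abs h1
  have hg'i : Integrable g' μ := hG.mono' hg'm.aestronglyMeasurable hbound'
  refine ⟨hg'i, ?_⟩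
  -- `h M` bounds `|g m - g'|` for all `m ≥ M`; its integral tends to `0` by dominated convergence
  let h : ℕ → Ω → ℝ := fun M x => ⨆ m, |g (M + m) x - g' x|
  have hhm : ∀ M, Measurable (h M) := fun M =>
    Measurable.iSup fun m =>
      ((hgm _).sub hg'm).norm
  have hle : ∀ᵐ x ∂μ, ∀ m, |g m x - g' x| ≤ 2 * G x := by
    filter_upwards [hbound, hbound'] with x h1 h2 m
    exact (abs_sub _ _).trans (by linarith [h1 m])
  have hbdd : ∀ᵐ x ∂μ, ∀ M, BddAbove (Set.range fun m => |g (M + m) x - g' x|) := by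
    filter_upwards [hle] with x hx M
    exact ⟨2 * G x, by rintro _ ⟨m, rfl⟩; exact hx _⟩
  have hhb : ∀ M, ∀ᵐ x ∂μ, ‖h M x‖ ≤ 2 * G x := by
    intro M
    filter_upwards [hle] with x hx
    rw [Real.norm_eq_abs, abs_of_nonneg (Real.iSup_nonneg fun m => abs_nonneg _)]
    exact ciSup_le fun m => hx _
  have hhi : ∀ M, Integrable (h M) μ := fun M =>
    (hG.const_mul 2).mono' (hhm M).aestronglyMeasurable (hhb M)
  have hh0 : Tendsto (fun M => ∫ x, h M x ∂μ) atTop (𝓝 0) := by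
    have := tendsto_integral_of_dominated_convergence (F := h) (f := fun _ => (0 : ℝ))
      (μ := μ) (fun x => 2 * G x) (fun M => (hhm M).aestronglyMeasurable) (hG.const_mul 2) hhb ?_
    · simpa using this
    · filter_upwards [hlim] with x hx
      rw [Metric.tendsto_atTop] at hx ⊢
      intro ε hε
      obtain ⟨N, hN⟩ := hx _ (half_pos hε)
      refine ⟨N, fun M hM => ?_⟩
      rw [Real.dist_eq, sub_zero, abs_of_nonneg (Real.iSup_nonneg fun m => abs_nonneg _)]
      refine lt_of_le_of_lt (ciSup_le fun m => ?_) (half_lt_self hε)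
      have := hN (M + m) (by omega)
      rw [Real.dist_eq] at this
      exact this.le
  have hiter : ∀ k, ∀ᵐ x ∂μ, ∀ M, BddAbove (Set.range fun m => |g (M + m) (T^[k] x) - g' (T^[k] x)|) :=
    fun k => (hT.toMeasurePreserving.iterate k).quasiMeasurePreserving.ae hbdd
  filter_upwards [ae_all_iff.2 hiter, tendsto_birkhoffSum_div hT hg'm hg'i,
    ae_all_iff.2 fun M => tendsto_birkhoffSum_div hT (hhm M) (hhi M)] with x hx1 hx2 hx3
  have hdiff : Tendsto (fun n : ℕ => (∑ k ∈ Finset.range n,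
      (g (n - k) (T^[k] x) - g' (T^[k] x))) / n) atTop (𝓝 0) := by
    rw [Metric.tendsto_atTop']
    intro ε hε
    obtain ⟨M, hM⟩ : ∃ M, ∫ x, h M x ∂μ < ε / 2 :=
      (hh0.eventually (gt_mem_nhds (half_pos hε))).exists
    -- the last `M` terms contribute a difference of two Birkhoff sums of `h 0`, which is `o(n)`
    have hshift : Tendsto (fun n : ℕ => birkhoffSum T (h 0) (n - M) x / n) atTop
        (𝓝 (∫ x, h 0 x ∂μ)) := by
      have h1 := (hx3 0).comp (tendsto_sub_atTop_nat M)
      have h2 : Tendsto (fun n : ℕ => ((n - M : ℕ) : ℝ) / n) atTop (𝓝 1) := by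
        have : Tendsto (fun n : ℕ => 1 - (M : ℝ) / n) atTop (𝓝 (1 - 0)) :=
          tendsto_const_nhds.sub (tendsto_const_div_atTop_nhds_zero_nat _)
        rw [sub_zero] at this
        refine this.congr' ?_
        filter_upwards [eventually_ge_atTop (max M 1)] with n hn
        have hn1 : (1 : ℝ) ≤ n := by exact_mod_cast (le_max_right _ _).trans hn
        rw [Nat.cast_sub ((le_max_left _ _).trans hn), sub_div, div_self (by linarith)]
      have h3 := h1.mul h2
      rw [mul_one] at h3
      refine h3.congr' ?_
      filter_upwards [eventually_gt_atTop M] with n hn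
      have : ((n - M : ℕ) : ℝ) ≠ 0 := by
        have : 0 < n - M := by omega
        positivity
      simp only [Function.comp]
      field_simp
    have hsum : Tendsto (fun n : ℕ => birkhoffSum T (h M) n x / n +
        (birkhoffSum T (h 0) n x / n - birkhoffSum T (h 0) (n - M) x / n)) atTop
        (𝓝 (∫ x, h M x ∂μ + (∫ x, h 0 x ∂μ - ∫ x, h 0 x ∂μ))) :=
      (hx3 M).add ((hx3 0).sub hshift)
    rw [sub_self, add_zero] at hsum
    obtain ⟨N, hN⟩ := eventually_atTop.1 (hsum.eventually (gt_mem_nhds hM))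
    refine ⟨N, fun n hn => ?_⟩
    have h4 := hN n hn.le
    have hn0 : (0 : ℝ) < n := by exact_mod_cast (Nat.zero_le N).trans_lt hn
    have hnn : ∀ k, 0 ≤ h M (T^[k] x) := fun k => Real.iSup_nonneg fun m => abs_nonneg _
    -- the terms with `n - k ≥ M` are bounded by `h M`, the remaining ones by `h 0`
    have hsplit : |∑ k ∈ Finset.range n, (g (n - k) (T^[k] x) - g' (T^[k] x))| ≤
        birkhoffSum T (h M) n x + (birkhoffSum T (h 0) n x - birkhoffSum T (h 0) (n - M) x) := by
      have e1 : birkhoffSum T (h 0) n x - birkhoffSum T (h 0) (n - M) x =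
          ∑ k ∈ Finset.range n, if n - M ≤ k then h 0 (T^[k] x) else 0 := by
        have := Finset.sum_range_add_sum_Ico (fun k => h 0 (T^[k] x)) (Nat.sub_le n M)
        simp only [birkhoffSum]
        rw [← this, add_sub_cancel_left, ← Finset.sum_filter]
        congr 1
        ext k
        simp only [Finset.mem_Ico, Finset.mem_filter, Finset.mem_range]
        omega
      rw [e1, birkhoffSum, ← Finset.sum_add_distrib]
      refine (Finset.abs_sum_le_sum_abs _ _).trans (Finset.sum_le_sum fun k hk => ?_)
      have hk' := Finset.mem_range.1 hk
      split_ifs with hc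
      · have := le_ciSup (hx1 k 0) (n - k)
        rw [zero_add] at this
        exact this.trans (le_add_of_nonneg_left (hnn k))
      · rw [add_zero]
        have := le_ciSup (hx1 k M) (n - k - M)
        rwa [show M + (n - k - M) = n - k by omega] at this
    rw [Real.dist_eq, sub_zero, abs_div, abs_of_pos hn0]
    calc _ ≤ (birkhoffSum T (h M) n x + (birkhoffSum T (h 0) n x -
          birkhoffSum T (h 0) (n - M) x)) / n := by gcongr
      _ = _ := by ring
      _ < ε / 2 := h4
      _ < ε := half_lt_self hε
  have := hdiff.add hx2
  rw [zero_add] at this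
  refine this.congr fun n => ?_
  rw [← add_div, birkhoffSum, ← Finset.sum_add_distrib]
  simp

end Ergodic

/-! ### Differentiation of measures under the Besicovitch covering property -/

section Besicovitch

open Metric

variable {Y : Type*} [PseudoMetricSpace Y]

/-- `HasBesicovitchBound Y N` states the Besicovitch covering property with the constant `N`. -/
def HasBesicovitchBound (Y : Type*) [PseudoMetricSpace Y] (N : ℕ) : Prop :=
  ∀ (A : Set Y) (r : Y → ℝ), Bornology.IsBounded A → (∀ y ∈ A, 0 < r y) →
    ∃ S ⊆ A, (A ⊆ ⋃ y ∈ S, closedBall y (r y)) ∧ ∀ z, {y ∈ S | z ∈ closedBall y (r y)}.encard ≤ N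

variable [MeasurableSpace Y]

theorem ae_measure_closedBall_pos [SecondCountableTopology Y] (θ : Measure Y) :
    ∀ᵐ y ∂θ, ∀ r : ℝ, 0 < r → 0 < θ (closedBall y r) := by
  rw [ae_iff]
  refine measure_null_of_locally_null _ fun y hy => ?_
  simp only [not_forall, not_lt, nonpos_iff_eq_zero] at hy
  obtain ⟨r, hr, h0⟩ := hy
  exact ⟨closedBall y r, mem_nhdsWithin_of_mem_nhds (closedBall_mem_nhds y hr), h0⟩

variable [BorelSpace Y]

/-- The maximal inequality: the set of the points `y` of `A` for which some closed ball centred at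
`y` satisfies `θ₁ < C θ₂` has small outer measure for `θ₁`. -/
theorem HasBesicovitchBound.measure_le {N : ℕ} (hN : HasBesicovitchBound Y N) (θ₁ θ₂ : Measure Y)
    [IsFiniteMeasure θ₂] {A : Set Y} (hA : Bornology.IsBounded A) (C : ℝ≥0∞)
    (h : ∀ y ∈ A, ∃ r : ℝ, 0 < r ∧ θ₁ (closedBall y r) < C * θ₂ (closedBall y r)) :
    θ₁ A ≤ C * N * θ₂ Set.univ := by
  classical
  have h' : ∀ y, ∃ r : ℝ, y ∈ A → 0 < r ∧ θ₁ (closedBall y r) < C * θ₂ (closedBall y r) := by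
    intro y
    by_cases hy : y ∈ A
    · obtain ⟨r, hr⟩ := h y hy
      exact ⟨r, fun _ => hr⟩
    · exact ⟨1, fun h => absurd h hy⟩
  choose r hr using h'
  obtain ⟨S, hSA, hcov, hmult⟩ := hN A r hA fun y hy => (hr y hy).1
  -- no point lies in more than `N` of the balls, so their `θ₂`-measures have a finite sum
  have hfin : ∀ t : Finset S, ∑ y ∈ t, θ₂ (closedBall (y : Y) (r y)) ≤ N * θ₂ Set.univ := by
    intro t
    calc ∑ y ∈ t, θ₂ (closedBall (y : Y) (r y))
        = ∑ y ∈ t, ∫⁻ z, (closedBall (y : Y) (r y)).indicator 1 z ∂θ₂ := by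
          refine Finset.sum_congr rfl fun y _ => ?_
          rw [lintegral_indicator_one isClosed_closedBall.measurableSet]
      _ = ∫⁻ z, ∑ y ∈ t, (closedBall (y : Y) (r y)).indicator 1 z ∂θ₂ :=
          (lintegral_finsetSum _ fun y _ =>
            measurable_one.indicator isClosed_closedBall.measurableSet).symm
      _ ≤ ∫⁻ _, N ∂θ₂ := by
          refine lintegral_mono fun z => ?_
          have e : ∑ y ∈ t, (closedBall (y : Y) (r y)).indicator (1 : Y → ℝ≥0∞) z =
              ((t.filter fun y : S => z ∈ closedBall (y : Y) (r y)).card : ℝ≥0∞) := by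
            rw [Finset.card_filter, Nat.cast_sum]
            refine Finset.sum_congr rfl fun y _ => ?_
            by_cases hz : z ∈ closedBall (y : Y) (r y) <;> simp [Set.indicator, hz]
          rw [e]
          have : ((t.filter fun y : S => z ∈ closedBall (y : Y) (r y)).card : ℕ∞) ≤ N := by
            refine le_trans ?_ (hmult z)
            have hinj := (Set.encard_coe_eq_coe_finsetCard
              ((t.filter fun y : S => z ∈ closedBall (y : Y) (r y)).image Subtype.val))
            rw [Finset.card_image_of_injective _ Subtype.val_injective] at hinj
            rw [← hinj]
            refine Set.encard_le_encard ?_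
            intro y hy
            simp only [Finset.coe_image, Set.mem_image, Finset.mem_coe, Finset.mem_filter] at hy
            obtain ⟨y', ⟨_, h2⟩, rfl⟩ := hy
            exact ⟨y'.2, h2⟩
          exact Nat.cast_le.2 (Nat.cast_le.1 this)
      _ = N * θ₂ Set.univ := by rw [lintegral_const]
  have htsum : ∑' y : S, θ₂ (closedBall (y : Y) (r y)) ≤ N * θ₂ Set.univ := by
    rw [ENNReal.tsum_eq_iSup_sum]
    exact iSup_le hfin
  have hne : ∑' y : S, θ₂ (closedBall (y : Y) (r y)) ≠ ∞ :=
    ne_top_of_le_ne_top (ENNReal.mul_ne_top (ENNReal.natCast_ne_top N) (measure_ne_top _ _)) htsum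
  -- the family is countable: its balls have positive `θ₂`-measure, with finite sum
  have hcount : S.Countable := by
    have h1 := Summable.countable_support_ennreal hne
    have h2 : Function.support (fun y : S => θ₂ (closedBall (y : Y) (r y))) = Set.univ := by
      ext y
      simp only [Function.mem_support, Set.mem_univ, iff_true]
      intro h0
      have := (hr y (hSA y.2)).2
      rw [h0, mul_zero] at this
      exact not_lt_bot this
    rw [h2] at h1
    exact Set.countable_coe_iff.1 (Set.countable_univ_iff.1 h1)
  calc θ₁ A ≤ θ₁ (⋃ y ∈ S, closedBall y (r y)) := measure_mono hcov
    _ ≤ ∑' y : S, θ₁ (closedBall (y : Y) (r y)) := measure_biUnion_le _ hcount _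
    _ ≤ ∑' y : S, C * θ₂ (closedBall (y : Y) (r y)) :=
        ENNReal.tsum_le_tsum fun y => (hr y (hSA y.2)).2.le
    _ = C * ∑' y : S, θ₂ (closedBall (y : Y) (r y)) := ENNReal.tsum_mul_left
    _ ≤ C * (N * θ₂ Set.univ) := by gcongr
    _ = _ := by ring

/-- Almost everywhere for `θ₁`, the ratio of `θ₁` to `θ₂` on small balls is bounded below. -/
theorem HasBesicovitchBound.ae_exists_le {N : ℕ} (hN : HasBesicovitchBound Y N)
    (θ₁ θ₂ : Measure Y) [IsFiniteMeasure θ₂] :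
    ∀ᵐ y ∂θ₁, ∃ c : ℝ≥0∞, c ≠ 0 ∧ c ≠ ∞ ∧
      ∀ r : ℝ, 0 < r → c * θ₂ (closedBall y r) ≤ θ₁ (closedBall y r) := by
  rcases isEmpty_or_nonempty Y with hY | ⟨⟨y₀⟩⟩
  · exact Eventually.of_forall fun y => (hY.false y).elim
  let P : ℕ → Y → Prop := fun n y => ∃ r : ℝ, 0 < r ∧
    θ₁ (closedBall y r) < ((n : ℝ≥0∞) + 1)⁻¹ * θ₂ (closedBall y r)
  -- the maximal inequality with `C = 1 / (n + 1)`, for every `n`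
  have h0 : ∀ k : ℕ, θ₁ {y ∈ closedBall y₀ (k : ℝ) | ∀ n, P n y} = 0 := by
    intro k
    have h1 : ∀ n : ℕ, θ₁ {y ∈ closedBall y₀ (k : ℝ) | ∀ n, P n y} ≤
        ((n : ℝ≥0∞) + 1)⁻¹ * (N * θ₂ Set.univ) := by
      intro n
      rw [← mul_assoc]
      refine hN.measure_le θ₁ θ₂ (isBounded_closedBall.subset fun y hy => hy.1) _ ?_
      intro y hy
      exact hy.2 n
    have h2 : Tendsto (fun n : ℕ => ((n : ℝ≥0∞) + 1)⁻¹ * (N * θ₂ Set.univ)) atTop (𝓝 0) := by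
      have h3 : Tendsto (fun n : ℕ => ((n : ℝ≥0∞) + 1)⁻¹) atTop (𝓝 0) := by
        have := ENNReal.tendsto_inv_nat_nhds_zero.comp (tendsto_add_atTop_nat 1)
        refine this.congr fun n => ?_
        simp
      have := ENNReal.Tendsto.mul_const (b := N * θ₂ Set.univ) h3
        (Or.inr (ENNReal.mul_ne_top (ENNReal.natCast_ne_top N) (measure_ne_top _ _)))
      rwa [zero_mul] at this
    exact le_antisymm (ge_of_tendsto' h2 h1) zero_le
  have h3 : ∀ᵐ y ∂θ₁, ¬ ∀ n, P n y := by
    rw [ae_iff]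
    refine measure_mono_null (t := ⋃ k : ℕ, {y ∈ closedBall y₀ (k : ℝ) | ∀ n, P n y}) ?_
      (measure_iUnion_null h0)
    intro y hy
    simp only [not_not, Set.mem_ofPred_eq] at hy
    obtain ⟨k, hk⟩ := exists_nat_ge (dist y y₀)
    exact Set.mem_iUnion.2 ⟨k, hk, hy⟩
  filter_upwards [h3] with y hy
  push Not at hy
  obtain ⟨n, hn⟩ := hy
  simp only [P, not_exists, not_and, not_lt] at hn
  exact ⟨_, ENNReal.inv_ne_zero.2 (by simp), by simp, hn⟩

/-- The Lebesgue differentiation theorem under the Besicovitch covering property. -/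
theorem HasBesicovitchBound.ae_differentiation {N : ℕ}
    (hN : HasBesicovitchBound Y N) (θ : Measure Y) [IsFiniteMeasure θ] {F : Y → ℝ}
    (hF : Integrable F θ) :
    ∀ᵐ y ∂θ, ∀ ε : ℝ, 0 < ε → ∀ᶠ r in 𝓝[>] (0 : ℝ),
      |∫ z in closedBall y r, F z ∂θ - F y * θ.real (closedBall y r)| ≤
        ε * θ.real (closedBall y r) := by
  rcases isEmpty_or_nonempty Y with hY | ⟨⟨y₀⟩⟩
  · exact Eventually.of_forall fun y => (hY.false y).elim
  let Q : ℝ → Y → Prop := fun ε y => ∀ᶠ r in 𝓝[>] (0 : ℝ),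
      |∫ z in closedBall y r, F z ∂θ - F y * θ.real (closedBall y r)| ≤
        ε * θ.real (closedBall y r)
  have key : ∀ (k : ℕ) (ε : ℝ), 0 < ε → θ {y ∈ closedBall y₀ (k : ℝ) | ¬ Q ε y} = 0 := by
    intro k ε hε
    set e : ℝ≥0∞ := ENNReal.ofReal (ε / 3) with he
    have he0 : e ≠ 0 := by simp [he, hε]
    have het : e ≠ ∞ := ENNReal.ofReal_ne_top
    -- Approximate `F` in `L¹` by a continuous function `g`. At a bad point, either the average of
    -- `|F - g|` over some ball or `|F - g|` itself is large: the maximal inequality bounds the first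
    -- set, the inequality of Markov the second.
    have hbd : ∀ δ : ℝ≥0∞, δ ≠ 0 →
        θ {y ∈ closedBall y₀ (k : ℝ) | ¬ Q ε y} ≤ (e⁻¹ * N + e⁻¹) * δ := by
      intro δ hδ
      obtain ⟨g, hg, hgi⟩ := hF.exists_boundedContinuous_lintegral_sub_le hδ
      set D : Y → ℝ≥0∞ := fun z => ‖F z - g z‖ₑ with hD
      have hDm : AEMeasurable D θ := (hF.sub hgi).aestronglyMeasurable.enorm
      have hsub : {y ∈ closedBall y₀ (k : ℝ) | ¬ Q ε y} ⊆
          {y ∈ closedBall y₀ (k : ℝ) | ∃ r : ℝ, 0 < r ∧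
            θ (closedBall y r) < e⁻¹ * (θ.withDensity D) (closedBall y r)} ∪ {y | e ≤ D y} := by
        rintro y ⟨hyk, hy⟩
        by_contra hcon
        simp only [Set.mem_union, Set.mem_ofPred_eq, not_or, not_and, not_exists, not_lt,
          not_le] at hcon
        obtain ⟨h1, h2⟩ := hcon
        refine hy ?_
        have hcont := Metric.continuous_iff.1 g.continuous y (ε / 3) (by positivity)
        obtain ⟨ρ, hρ, hcont⟩ := hcont
        filter_upwards [Ioo_mem_nhdsGT hρ] with r hr
        have h3 := h1 hyk r hr.1
        set B := closedBall y r with hB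
        have hBm : MeasurableSet B := isClosed_closedBall.measurableSet
        have h4 : (∫⁻ z in B, D z ∂θ) ≤ e * θ B := by
          rw [← withDensity_apply _ hBm]
          calc _ = e * (e⁻¹ * (θ.withDensity D) B) := by
                rw [← mul_assoc, ENNReal.mul_inv_cancel he0 het, one_mul]
            _ ≤ _ := by gcongr
        have h5 : ∫ z in B, |F z - g z| ∂θ ≤ ε / 3 * θ.real B := by
          have := integral_norm_eq_lintegral_enorm (μ := θ.restrict B)
            (hF.sub hgi).aestronglyMeasurable.restrict
          simp only [Real.norm_eq_abs, Pi.sub_apply] at this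
          rw [this]
          have h6 : (e * θ B).toReal = ε / 3 * θ.real B := by
            rw [ENNReal.toReal_mul, he, ENNReal.toReal_ofReal (by positivity)]; rfl
          rw [← h6]
          exact ENNReal.toReal_mono (ENNReal.mul_ne_top het (measure_ne_top _ _)) h4
        have h7 : |g y - F y| ≤ ε / 3 := by
          have : ENNReal.ofReal |F y - g y| < ENNReal.ofReal (ε / 3) := by
            simpa only [hD, ← ofReal_norm, Real.norm_eq_abs] using h2
          rw [abs_sub_comm]
          exact ((ENNReal.ofReal_lt_ofReal_iff (by positivity)).1 this).le
        have hi1 : IntegrableOn (fun z => |F z - g z|) B θ := ((hF.sub hgi).abs).integrableOn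
        have hi2 : IntegrableOn F B θ := hF.integrableOn
        have e1 : ∫ z in B, F z ∂θ - F y * θ.real B = ∫ z in B, (F z - F y) ∂θ := by
          rw [integral_sub hi2 (integrable_const _), setIntegral_const, smul_eq_mul, mul_comm]
        rw [e1]
        calc |∫ z in B, (F z - F y) ∂θ| ≤ ∫ z in B, |F z - F y| ∂θ := abs_integral_le_integral_abs
          _ ≤ ∫ z in B, (|F z - g z| + (ε / 3 + ε / 3)) ∂θ := by
              refine setIntegral_mono_on ((hi2.sub (integrable_const _)).abs)
                (hi1.add (integrable_const _)) hBm fun z hz => ?_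
              have h8 : |g z - g y| ≤ ε / 3 := by
                have := hcont z (lt_of_le_of_lt hz hr.2)
                rw [Real.dist_eq] at this
                exact this.le
              have : F z - F y = (F z - g z) + ((g z - g y) + (g y - F y)) := by ring
              rw [this]
              refine (abs_add_le _ _).trans (add_le_add le_rfl ((abs_add_le _ _).trans ?_))
              exact add_le_add h8 h7
          _ = ∫ z in B, |F z - g z| ∂θ + (ε / 3 + ε / 3) * θ.real B := by
              rw [integral_add hi1 (integrable_const _), setIntegral_const, smul_eq_mul,
                mul_comm (θ.real B)]
          _ ≤ ε / 3 * θ.real B + (ε / 3 + ε / 3) * θ.real B := by gcongr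
          _ = ε * θ.real B := by ring
      have hfinD : IsFiniteMeasure (θ.withDensity D) :=
        isFiniteMeasure_withDensity (hF.sub hgi).2.ne
      have hD1 : (θ.withDensity D) Set.univ ≤ δ := by
        rw [withDensity_apply _ MeasurableSet.univ, Measure.restrict_univ]; exact hg
      calc _ ≤ _ := measure_mono hsub
        _ ≤ _ := measure_union_le _ _
        _ ≤ e⁻¹ * N * δ + e⁻¹ * δ := by
            refine add_le_add ?_ ?_
            · refine (hN.measure_le θ (θ.withDensity D)
                (isBounded_closedBall.subset fun y hy => hy.1) e⁻¹
                fun y hy => hy.2).trans ?_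
              gcongr
            · have h9 := meas_ge_le_lintegral_div hDm he0 het
              rw [mul_comm]
              exact h9.trans (by rw [div_eq_mul_inv]; gcongr)
        _ = _ := by ring
    have hlim : Tendsto (fun n : ℕ => (e⁻¹ * N + e⁻¹) * ((n : ℝ≥0∞))⁻¹) atTop (𝓝 0) := by
      have := ENNReal.Tendsto.const_mul (a := e⁻¹ * N + e⁻¹) ENNReal.tendsto_inv_nat_nhds_zero
        (Or.inr (ENNReal.add_ne_top.2 ⟨ENNReal.mul_ne_top (ENNReal.inv_ne_top.2 he0)
          (ENNReal.natCast_ne_top N), ENNReal.inv_ne_top.2 he0⟩))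
      rwa [mul_zero] at this
    exact le_antisymm (ge_of_tendsto' hlim fun n => hbd _ (by simp)) zero_le
  have hall : ∀ᵐ y ∂θ, ∀ n : ℕ, Q (1 / (n + 1)) y := by
    rw [ae_all_iff]
    intro n
    rw [ae_iff]
    refine measure_mono_null (t := ⋃ k : ℕ, {y ∈ closedBall y₀ (k : ℝ) | ¬ Q (1 / (n + 1)) y}) ?_
      (measure_iUnion_null fun k => key k _ (by positivity))
    intro y hy
    obtain ⟨k, hk⟩ := exists_nat_ge (dist y y₀)
    exact Set.mem_iUnion.2 ⟨k, hk, hy⟩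
  filter_upwards [hall] with y hy ε hε
  obtain ⟨n, hn⟩ := exists_nat_one_div_lt hε
  filter_upwards [hy n] with r hr
  exact hr.trans (by gcongr)

end Besicovitch

/-! ### Existence of complete lacunary sections -/

section Sections

variable {L X : Type*} [Group L] [TopologicalSpace L] [IsTopologicalGroup L]
  [LocallyCompactSpace L] [PolishSpace L] [MeasurableSpace L] [BorelSpace L]
  [MeasurableSpace X] [StandardBorelSpace X] [MulAction L X] [MeasurableSMul₂ L X]

/-- Averaging along orbits, against Haar measure, one bounded injective Borel function yields
countably many Borel functions which are continuous along the orbits and separate the points. -/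
theorem exists_orbit_continuous_separating (L X : Type*) [Group L] [TopologicalSpace L]
    [IsTopologicalGroup L] [LocallyCompactSpace L] [PolishSpace L] [MeasurableSpace L] [BorelSpace L]
    [MeasurableSpace X] [StandardBorelSpace X] [MulAction L X] [MeasurableSMul₂ L X] :
    ∃ F : ℕ → X → ℝ, (∀ j, Measurable (F j)) ∧
      (∀ j x, Continuous fun g : L => F j (g • x)) ∧
      ∀ x y, (∀ j, F j x = F j y) → x = y := by
  obtain ⟨e, he⟩ := exists_measurableEmbedding_real X
  -- an injective Borel function with values in a compact subset of `(0, ∞)`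
  let f : X → ℝ := fun x => Real.arctan (e x) + 2
  have hfm : Measurable f := (Real.measurable_arctan.comp he.measurable).add_const 2
  have hfinj : Function.Injective f := fun x y hxy =>
    he.injective (Real.arctan_injective (by simpa [f] using hxy))
  have hf0 : ∀ x, 0 < f x := fun x => by
    have := Real.neg_pi_div_two_lt_arctan (e x)
    have := Real.pi_lt_four
    simp only [f]; linarith
  have hf4 : ∀ x, f x ≤ 4 := fun x => by
    have := Real.arctan_lt_pi_div_two (e x)
    have := Real.pi_lt_four
    simp only [f]; linarith
  let μ : Measure L := Measure.haar
  obtain ⟨χ, hχ1, -, hχc, hχI⟩ := exists_continuous_one_zero_of_isCompact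
    (X := L) (isCompact_singleton (x := (1 : L))) isClosed_empty (Set.disjoint_empty _)
  have hχi : Integrable χ μ := χ.continuous.integrable_of_hasCompactSupport hχc
  -- the averaging weights are `χ φ j`, with `φ` dense in the continuous functions
  obtain ⟨φ, hφ⟩ := TopologicalSpace.exists_dense_seq C(L, ℝ)
  let ψ : ℕ → L → ℝ := fun j g => χ g * φ j g
  have hψc : ∀ j, Continuous (ψ j) := fun j => χ.continuous.mul (φ j).continuous
  have hψs : ∀ j, HasCompactSupport (ψ j) := fun j => hχc.mul_right
  have hfg : ∀ x, Measurable fun g : L => f (g⁻¹ • x) := fun x =>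
    hfm.comp (measurable_inv.smul_const x)
  refine ⟨fun j x => ∫ g, f (g⁻¹ • x) * ψ j g ∂μ, fun j => ?_, fun j x => ?_, fun x y hxy => ?_⟩
  · have : Measurable (Function.uncurry fun (x : X) (g : L) => f (g⁻¹ • x) * ψ j g) :=
      (hfm.comp (measurable_snd.inv.smul measurable_fst)).mul
        ((hψc j).measurable.comp measurable_snd)
    exact this.stronglyMeasurable.integral_prod_right.measurable
  -- by invariance of the Haar measure, `h` moves to the continuous factor
  · have e1 : (fun h : L => ∫ g, f (g⁻¹ • h • x) * ψ j g ∂μ) =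
        fun h => ∫ g, f (g⁻¹ • x) * ψ j (h * g) ∂μ := by
      funext h
      rw [← integral_mul_left_eq_self (fun g => f (g⁻¹ • h • x) * ψ j g) h]
      simp [mul_smul]
    rw [e1, continuous_iff_continuousAt]
    intro h₀
    obtain ⟨C, hC, hCn⟩ := exists_compact_mem_nhds h₀
    obtain ⟨M, hM⟩ := (hψs j).exists_bound_of_continuous (hψc j)
    have hKc : IsCompact (C⁻¹ * tsupport (ψ j)) := hC.inv.mul (hψs j)
    refine continuousAt_of_dominated
      (bound := (C⁻¹ * tsupport (ψ j)).indicator fun _ => 4 * M) ?_ ?_ ?_ ?_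
    · exact Eventually.of_forall fun h => ((hfg x).mul
        ((hψc j).measurable.comp (measurable_const_mul h))).aestronglyMeasurable
    · filter_upwards [hCn] with h hh
      refine Eventually.of_forall fun g => ?_
      have hM0 : 0 ≤ M := (norm_nonneg _).trans (hM 1)
      by_cases hg : h * g ∈ tsupport (ψ j)
      · have : g ∈ C⁻¹ * tsupport (ψ j) :=
          ⟨h⁻¹, Set.inv_mem_inv.2 hh, h * g, hg, by simp⟩
        rw [Set.indicator_of_mem this, norm_mul, Real.norm_eq_abs, abs_of_pos (hf0 _)]
        exact mul_le_mul (hf4 _) (hM _) (norm_nonneg _) (by norm_num)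
      · rw [image_eq_zero_of_notMem_tsupport hg, mul_zero, norm_zero]
        exact Set.indicator_nonneg (fun _ _ => by positivity) _
    · exact (integrable_indicator_iff hKc.measurableSet).2
        (integrableOn_const (hs := hKc.measure_lt_top.ne))
    · exact Eventually.of_forall fun g =>
        (continuous_const.mul ((hψc j).comp (continuous_mul_const g))).continuousAt
  -- the values of the averages determine the measure with density `g ↦ f (g⁻¹ • x) χ g`, hence
  -- `f (g⁻¹ • x)` for some `g`
  · let d : X → L → ℝ := fun x g => f (g⁻¹ • x) * χ g
    have hdm : ∀ x, Measurable (d x) := fun x => (hfg x).mul χ.continuous.measurable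
    have hd0 : ∀ x g, 0 ≤ d x g := fun x g => mul_nonneg (hf0 _).le (hχI g).1
    have hdi : ∀ x, Integrable (d x) μ := fun x => by
      refine (hχi.const_mul 4).mono' (hdm x).aestronglyMeasurable (Eventually.of_forall fun g => ?_)
      rw [Real.norm_eq_abs, abs_of_nonneg (hd0 x g)]
      exact mul_le_mul_of_nonneg_right (hf4 _) (hχI g).1
    let ρ : X → Measure L := fun x => μ.withDensity fun g => ENNReal.ofReal (d x g)
    have hρfin : ∀ x, IsFiniteMeasure (ρ x) := fun x =>
      isFiniteMeasure_withDensity_ofReal (hdi x).2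
    have hρint : ∀ x (η : L → ℝ), ∫ g, η g ∂(ρ x) = ∫ g, d x g * η g ∂μ := by
      intro x η
      rw [integral_withDensity_eq_integral_toReal_smul (hdm x).ennreal_ofReal
        (Eventually.of_forall fun g => ENNReal.ofReal_lt_top)]
      exact integral_congr_ae (Eventually.of_forall fun g => by
        simp [ENNReal.toReal_ofReal (hd0 x g)])
    have hρeq : ρ x = ρ y := by
      refine ext_of_forall_integral_eq_of_IsFiniteMeasure fun η => ?_
      by_contra hne
      set δ := |∫ g, η g ∂(ρ x) - ∫ g, η g ∂(ρ y)| with hδ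
      have hδ0 : 0 < δ := abs_pos.2 (sub_ne_zero.2 hne)
      set c := (ρ x).real Set.univ + (ρ y).real Set.univ + 1 with hc
      have hc0 : 0 < c := by positivity
      -- some `φ j` is uniformly close to `η` on the support of `χ`
      have hmem : {θ : C(L, ℝ) | ∀ g ∈ tsupport χ, dist (η.toContinuousMap g) (θ g) < δ / c} ∈
          𝓝 η.toContinuousMap := by
        have := ContinuousMap.tendsto_iff_forall_isCompact_tendstoUniformlyOn.1
          (tendsto_id (α := C(L, ℝ)) (x := 𝓝 η.toContinuousMap)) _ hχc
        exact Metric.tendstoUniformlyOn_iff.1 this _ (div_pos hδ0 hc0)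
      obtain ⟨_, ⟨j, rfl⟩, hθ⟩ := hφ.inter_nhds_nonempty hmem
      have hclose : ∀ z, |∫ g, η g ∂(ρ z) - ∫ g, d z g * φ j g ∂μ| ≤
          δ / c * (ρ z).real Set.univ := by
        intro z
        have hi1 : Integrable (fun g => d z g * η g) μ := (hdi z).mul_bdd (c := ‖η‖)
          η.continuous.aestronglyMeasurable (Eventually.of_forall fun g => η.norm_coe_le_norm g)
        have hi2 : Integrable (fun g => d z g * φ j g) μ := by
          have hb : Integrable (fun g => χ g * φ j g) μ :=
            (hψc j).integrable_of_hasCompactSupport (hψs j)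
          have := hb.bdd_mul (f := fun g => f (g⁻¹ • z)) (c := 4) (hfg z).aestronglyMeasurable
            (Eventually.of_forall fun g => by
              rw [Real.norm_eq_abs, abs_of_pos (hf0 _)]; exact hf4 _)
          exact this.congr (Eventually.of_forall fun g => by simp only [d]; ring)
        have e2 : (ρ z).real Set.univ = ∫ g, d z g ∂μ := by
          have := hρint z fun _ => 1
          simpa using this
        rw [hρint, ← integral_sub hi1 hi2, e2, ← integral_const_mul]
        refine abs_integral_le_integral_abs.trans (integral_mono ((hi1.sub hi2).abs)
          ((hdi z).const_mul _) fun g => ?_)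
        simp only [← mul_sub, abs_mul, abs_of_nonneg (hd0 z g)]
        rw [mul_comm]
        by_cases hg : g ∈ tsupport χ
        · refine mul_le_mul_of_nonneg_right ?_ (hd0 z g)
          have := (hθ g hg).le
          rwa [Real.dist_eq] at this
        · have : d z g = 0 := by simp only [d, image_eq_zero_of_notMem_tsupport hg, mul_zero]
          rw [this]; simp
      have hj : ∫ g, d x g * φ j g ∂μ = ∫ g, d y g * φ j g ∂μ := by
        have := hxy j
        simpa only [d, ψ, mul_assoc] using this
      have h1 := hclose x
      have h2 := hclose y
      rw [hj] at h1
      have h3 : δ ≤ δ / c * (ρ x).real Set.univ + δ / c * (ρ y).real Set.univ := by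
        refine le_trans ?_ (add_le_add h1 h2)
        rw [hδ, ← abs_neg (∫ g, η g ∂(ρ y) - _)]
        refine le_trans (le_of_eq ?_) (abs_add_le _ _)
        congr 1; ring
      have h4 : δ / c * (ρ x).real Set.univ + δ / c * (ρ y).real Set.univ = δ - δ / c := by
        have : (ρ x).real Set.univ + (ρ y).real Set.univ = c - 1 := by rw [hc]; ring
        rw [← mul_add, this]
        field_simp
      have := div_pos hδ0 hc0
      linarith
    have hae : (fun g => ENNReal.ofReal (d x g)) =ᵐ[μ] fun g => ENNReal.ofReal (d y g) :=
      (withDensity_eq_iff_of_sigmaFinite (hdm x).ennreal_ofReal.aemeasurable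
        (hdm y).ennreal_ofReal.aemeasurable).1 hρeq
    -- `χ` is positive on a nonempty open set, which has positive Haar measure
    have hopen : IsOpen {g : L | 0 < χ g} := isOpen_lt continuous_const χ.continuous
    have hpos : μ {g : L | 0 < χ g} ≠ 0 := by
      refine (hopen.measure_pos μ ⟨1, ?_⟩).ne'
      have : χ 1 = 1 := hχ1 rfl
      simp [this]
    obtain ⟨g, hg, hg'⟩ := (frequently_ae_mem_iff.2 hpos).and_eventually hae |>.exists
    have hg2 : d x g = d y g := by
      have := congrArg ENNReal.toReal hg'
      rwa [ENNReal.toReal_ofReal (hd0 x g), ENNReal.toReal_ofReal (hd0 y g)] at this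
    have := hfinj (mul_right_cancel₀ (ne_of_gt hg) hg2)
    exact MulAction.injective g⁻¹ this

end Sections

section Sections

/-- The points which agree up to `1 / (n + 1)` with finitely many prescribed values of the
functions `F j`. -/
def basicSet {X : Type*} (F : ℕ → X → ℝ) (l : List (ℕ × ℚ)) (n : ℕ) : Set X :=
  {x | ∀ p ∈ l, |F p.1 x - p.2| < 1 / ((n : ℝ) + 1)}

/-- The points of the closure of `A` along the orbits which are minimal for the lexicographic order
defined by the functions `F j`, among the points of that closure that `N` brings close to them. -/
def lexSet (L : Type*) {X : Type*} [Group L] [TopologicalSpace L] [MulAction L X]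
    (F : ℕ → X → ℝ) (A : Set X) (N : Set L) : Set X :=
  {z | (1 : L) ∈ closure {g : L | g • z ∈ A} ∧
    ∀ j, ∀ h ∈ closure ({g : L | g • z ∈ A} ∩ N), (∀ i < j, F i (h • z) = F i z) →
      F j z ≤ F j (h • z)}

/-- `S` meets the `W`-neighbourhood of each of its points in that point only. -/
def IsLacunary {L X : Type*} [SMul L X] (W : Set L) (S : Set X) : Prop :=
  ∀ x ∈ S, ∀ g ∈ W, g • x ∈ S → g • x = x

theorem measurableSet_basicSet {X : Type*} [MeasurableSpace X] {F : ℕ → X → ℝ}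
    (hF : ∀ j, Measurable (F j)) (l : List (ℕ × ℚ)) (n : ℕ) :
    MeasurableSet (basicSet F l n) := by
  have : basicSet F l n = ⋂ p ∈ {p | p ∈ l}, {x | |F p.1 x - p.2| < 1 / ((n : ℝ) + 1)} := by
    ext; simp [basicSet]
  rw [this]
  refine MeasurableSet.biInter (List.finite_toSet l).countable fun p _ => ?_
  exact measurableSet_lt ((hF p.1).sub_const _).norm measurable_const

variable {L X : Type*} [TopologicalSpace L]

/-- A continuous sequence of functions attains a lexicographic minimum on a compact set. -/
theorem exists_lexicographic_min [T2Space L] {c : ℕ → L → ℝ} (hc : ∀ j, Continuous (c j))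
    {Q : Set L} (hQ : IsCompact Q) (hne : Q.Nonempty) :
    ∃ g ∈ Q, ∀ j, ∀ h ∈ Q, (∀ i < j, c i h = c i g) → c j g ≤ c j h := by
  -- `R (j + 1)` is the set of the minimizers of `c j` in `R j`; these compact sets decrease
  let R : ℕ → Set L := fun n => Nat.rec Q (fun j S => {g ∈ S | ∀ h ∈ S, c j g ≤ c j h}) n
  have hsucc : ∀ j, R (j + 1) = {g ∈ R j | ∀ h ∈ R j, c j g ≤ c j h} := fun j => rfl
  have hR : ∀ n, IsCompact (R n) ∧ (R n).Nonempty := by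
    intro n
    induction n with
    | zero => exact ⟨hQ, hne⟩
    | succ j ih =>
      rw [hsucc]
      obtain ⟨g, hg, hmin⟩ := ih.1.exists_isMinOn ih.2 (hc j).continuousOn
      refine ⟨?_, g, hg, fun h hh => hmin hh⟩
      have : {g ∈ R j | ∀ h ∈ R j, c j g ≤ c j h} = R j ∩ ⋂ h ∈ R j, {g | c j g ≤ c j h} := by
        ext; simp
      rw [this]
      exact ih.1.inter_right (isClosed_biInter fun h _ => isClosed_le (hc j) continuous_const)
  obtain ⟨g, hg⟩ := IsCompact.nonempty_iInter_of_sequence_nonempty_isCompact_isClosed R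
    (fun j => by rw [hsucc]; exact fun g hg => hg.1) (fun n => (hR n).2) (hR 0).1
    (fun n => (hR n).1.isClosed)
  rw [Set.mem_iInter] at hg
  refine ⟨g, hg 0, fun j h hh heq => ?_⟩
  have key : ∀ i ≤ j, h ∈ R i := by
    intro i hi
    induction i with
    | zero => exact hh
    | succ i ih =>
      have h1 := hg (i + 1)
      rw [hsucc] at h1 ⊢
      exact ⟨ih (by omega), fun k hk => by rw [heq i (by omega)]; exact h1.2 k hk⟩
  have h1 := hg (j + 1)
  rw [hsucc] at h1
  exact h1.2 h (key j le_rfl)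

variable [Group L] [MulAction L X]

theorem isOpen_orbit_basicSet {F : ℕ → X → ℝ} (hFc : ∀ j x, Continuous fun g : L => F j (g • x))
    (l : List (ℕ × ℚ)) (n : ℕ) (z : X) : IsOpen {g : L | g • z ∈ basicSet F l n} := by
  have : {g : L | g • z ∈ basicSet F l n} =
      ⋂ p ∈ {p | p ∈ l}, {g : L | |F p.1 (g • z) - p.2| < 1 / ((n : ℝ) + 1)} := by
    ext; simp [basicSet]
  rw [this]
  exact (List.finite_toSet l).isOpen_biInter fun p _ =>
    isOpen_lt ((hFc p.1 z).sub continuous_const).abs continuous_const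

/-- A compact set of group elements which move `x` is avoided by the returns to some basic set
containing `x`. -/
theorem exists_basicSet_avoiding {F : ℕ → X → ℝ}
    (hFc : ∀ j x, Continuous fun g : L => F j (g • x))
    (hFs : ∀ x y, (∀ j, F j x = F j y) → x = y) (x : X) {K : Set L} (hK : IsCompact K)
    (hKx : ∀ g ∈ K, g • x ≠ x) :
    ∃ l n, x ∈ basicSet F l n ∧ ∀ g ∈ K, g • x ∉ basicSet F l n := by
  -- for each point of `K`, some `F j` separates `x` from its image; by compactness, finitely many
  -- `F j` and one precision suffice
  let O : ℕ × ℕ → Set L := fun p => {g | 2 / ((p.2 : ℝ) + 1) < |F p.1 (g • x) - F p.1 x|}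
  have hO : ∀ p, IsOpen (O p) := fun p =>
    isOpen_lt continuous_const ((hFc p.1 x).sub continuous_const).abs
  have hcov : K ⊆ ⋃ p, O p := by
    intro g hg
    have : ∃ j, F j (g • x) ≠ F j x := by
      by_contra hcon
      push Not at hcon
      exact hKx g hg (hFs _ _ hcon)
    obtain ⟨j, hj⟩ := this
    have hpos : 0 < |F j (g • x) - F j x| / 2 := by
      have := abs_pos.2 (sub_ne_zero.2 hj); positivity
    obtain ⟨n, hn⟩ := exists_nat_one_div_lt hpos
    refine Set.mem_iUnion.2 ⟨(j, n), ?_⟩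
    change 2 / ((n : ℝ) + 1) < _
    have : 2 / ((n : ℝ) + 1) = 2 * (1 / ((n : ℝ) + 1)) := by ring
    rw [this]; linarith
  obtain ⟨t, ht⟩ := hK.elim_finite_subcover O hO hcov
  set n := t.sup Prod.snd with hn
  have hn0 : (0 : ℝ) < 1 / ((n : ℝ) + 1) := by positivity
  have hr : ∀ j, ∃ r : ℚ, |F j x - r| < 1 / ((n : ℝ) + 1) := fun j => by
    obtain ⟨r, hr1, hr2⟩ := exists_rat_btwn (lt_add_of_pos_right (F j x) hn0)
    exact ⟨r, by rw [abs_sub_comm, abs_lt]; constructor <;> linarith⟩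
  choose r hr using hr
  refine ⟨t.toList.map fun p => (p.1, r p.1), n, ?_, ?_⟩
  · intro p hp
    obtain ⟨q, -, rfl⟩ := List.mem_map.1 hp
    exact hr q.1
  · intro g hg hgA
    obtain ⟨p, hp, hgp⟩ := Set.mem_iUnion₂.1 (ht hg)
    have h1 := hgA (p.1, r p.1) (List.mem_map.2 ⟨p, Finset.mem_toList.2 hp, rfl⟩)
    have h2 := hr p.1
    have h3 : (p.2 : ℝ) ≤ n := by exact_mod_cast Finset.le_sup (f := Prod.snd) hp
    have h4 : 2 / ((n : ℝ) + 1) ≤ 2 / ((p.2 : ℝ) + 1) := by gcongr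
    have h5 : 2 / ((p.2 : ℝ) + 1) < |F p.1 (g • x) - F p.1 x| := hgp
    have h6 : |F p.1 (g • x) - F p.1 x| ≤ |F p.1 (g • x) - r p.1| + |F p.1 x - r p.1| := by
      rw [abs_sub_comm (F p.1 x)]
      exact abs_sub_le _ _ _
    have h7 : 2 / ((n : ℝ) + 1) = 1 / ((n : ℝ) + 1) + 1 / ((n : ℝ) + 1) := by ring
    simp only at h1
    linarith

/-- The closures of the return sets of two points of one orbit are translates of one another. -/
theorem mem_closure_orbit_smul [ContinuousMul L] (A : Set X) (h : L) (z : X) {k : L}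
    (hk : k ∈ closure {g : L | g • h • z ∈ A}) : k * h ∈ closure {g : L | g • z ∈ A} := by
  refine map_mem_closure (f := fun k => k * h) (continuous_mul_const h) hk fun g hg => ?_
  simpa [mul_smul] using hg

/-- Two points of the lexicographic section that an element of `W` exchanges are both minimal in the
same closed return set, so that all functions `F j` agree on them. -/
theorem isLacunary_lexSet [ContinuousMul L] {F : ℕ → X → ℝ}
    (hFs : ∀ x y, (∀ j, F j x = F j y) → x = y) (A : Set X) {N W : Set L} (hN : IsOpen N)
    (hWN : W ⊆ N) (hW : W⁻¹ = W) : IsLacunary W (lexSet L F A N) := by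
  -- `h` lies in the closed return set on which `z` is minimal, and `h⁻¹` in that of `h • z`.
  have aux : ∀ z ∈ lexSet L F A N, ∀ h ∈ W, h • z ∈ lexSet L F A N →
      h ∈ closure ({g : L | g • z ∈ A} ∩ N) := by
    intro z _ h hh hhz
    have h1 := mem_closure_orbit_smul A h z hhz.1
    rw [one_mul] at h1
    rw [Set.inter_comm]
    exact hN.inter_closure ⟨hWN hh, h1⟩
  intro z hz h hh hhz
  have h1 := aux z hz h hh hhz
  have h2 := aux (h • z) hhz h⁻¹ (by rw [← hW]; exact Set.inv_mem_inv.2 hh) (by simpa using hz)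
  refine (hFs _ _ fun j => ?_)
  induction j using Nat.strong_induction_on with
  | _ j ih =>
    refine le_antisymm ?_ (hz.2 j h h1 ih)
    have := hhz.2 j h⁻¹ h2 (fun i hi => by rw [inv_smul_smul]; exact (ih i hi).symm)
    rwa [inv_smul_smul] at this

/-- The conditions defining the lexicographic section can be tested on a dense sequence of the
group: the return set is open, the functions are continuous along the orbits, and `N` is relatively
compact. -/
theorem measurableSet_lexSet [ContinuousMul L] [SecondCountableTopology L] [T2Space L]
    [MeasurableSpace L] [MeasurableSpace X] [MeasurableSMul L X]
    {F : ℕ → X → ℝ} (hFm : ∀ j, Measurable (F j))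
    (hFc : ∀ j x, Continuous fun g : L => F j (g • x)) {A : Set X} (hA : MeasurableSet A)
    (hAo : ∀ z, IsOpen {g : L | g • z ∈ A}) {N C : Set L} (hN : IsOpen N) (hC : IsCompact C)
    (hNC : N ⊆ C) : MeasurableSet (lexSet L F A N) := by
  obtain ⟨γ, hγ⟩ := TopologicalSpace.exists_dense_seq L
  have hex : ∀ U : Set L, IsOpen U → U.Nonempty → ∃ k, γ k ∈ U := fun U hU hne => by
    obtain ⟨k, hk⟩ := hγ.exists_mem_open hU hne
    exact ⟨k, hk⟩
  have hγA : ∀ k, MeasurableSet {z | γ k • z ∈ A} := fun k => measurable_const_smul (γ k) hA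
  let B := TopologicalSpace.countableBasis L
  have hB := TopologicalSpace.isBasis_countableBasis L
  have e1 : {z : X | (1 : L) ∈ closure {g : L | g • z ∈ A}} =
      ⋂ b ∈ {b ∈ B | (1 : L) ∈ b}, ⋃ k, ⋃ _ : γ k ∈ b, {z | γ k • z ∈ A} := by
    ext z
    simp only [Set.mem_ofPred_eq, Set.mem_iInter, Set.mem_iUnion, hB.mem_closure_iff]
    constructor
    · rintro h b ⟨hb, h1⟩
      obtain ⟨k, hk⟩ := hex _ ((hB.isOpen hb).inter (hAo z)) (h b hb h1)
      exact ⟨k, hk.1, hk.2⟩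
    · intro h b hb h1
      obtain ⟨k, hk1, hk2⟩ := h b ⟨hb, h1⟩
      exact ⟨γ k, hk1, hk2⟩
  -- `z` is not minimal for `F j`: the points `γ k` approximate a competitor `h`; conversely, by
  -- compactness, approximate competitors with a uniform gap have a limit point
  have e2 : ∀ j, {z : X | ∃ h ∈ closure ({g : L | g • z ∈ A} ∩ N),
      (∀ i < j, F i (h • z) = F i z) ∧ F j (h • z) < F j z} =
      ⋃ n : ℕ, ⋂ m : ℕ, ⋃ k, ⋃ _ : γ k ∈ N, {z | γ k • z ∈ A} ∩
        ((⋂ i, ⋂ _ : i < j, {z | |F i (γ k • z) - F i z| < 1 / ((m : ℝ) + 1)}) ∩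
        {z | F j (γ k • z) < F j z - 1 / ((n : ℝ) + 1)}) := by
    intro j
    ext z
    simp only [Set.mem_ofPred_eq, Set.mem_iInter, Set.mem_iUnion, Set.mem_inter_iff]
    constructor
    · rintro ⟨h, hh, heq, hlt⟩
      obtain ⟨n, hn⟩ := exists_nat_one_div_lt (sub_pos.2 hlt)
      refine ⟨n, fun m => ?_⟩
      let U : Set L := (⋂ i ∈ {i | i < j}, {g | |F i (g • z) - F i z| < 1 / ((m : ℝ) + 1)}) ∩
        {g | F j (g • z) < F j z - 1 / ((n : ℝ) + 1)}
      have hU : IsOpen U := ((Set.finite_lt_nat j).isOpen_biInter fun i _ =>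
        isOpen_lt ((hFc i z).sub continuous_const).abs continuous_const).inter
        (isOpen_lt (hFc j z) continuous_const)
      have hhU : h ∈ U := by
        refine ⟨Set.mem_iInter₂.2 fun i hi => ?_, ?_⟩
        · change |F i (h • z) - F i z| < _
          rw [heq i hi, sub_self, abs_zero]; positivity
        · change F j (h • z) < _
          linarith
      obtain ⟨k, hk⟩ := hex _ (hU.inter ((hAo z).inter hN)) (mem_closure_iff.1 hh U hU hhU)
      exact ⟨k, hk.2.2, hk.2.1, fun i hi => Set.mem_iInter₂.1 hk.1.1 i hi, hk.1.2⟩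
    · rintro ⟨n, h⟩
      choose k hkN hkA hk1 hk2 using h
      have hQ : IsCompact (closure ({g : L | g • z ∈ A} ∩ N)) :=
        hC.closure_of_subset (Set.inter_subset_right.trans hNC)
      obtain ⟨g, hg, φ, hφ, hlim⟩ := hQ.tendsto_subseq (x := fun m => γ (k m))
        fun m => subset_closure ⟨hkA m, hkN m⟩
      refine ⟨g, hg, fun i hi => ?_, ?_⟩
      · have h1 := (((hFc i z).sub (continuous_const (y := F i z))).abs.tendsto g).comp hlim
        have h2 : Tendsto (fun m => 1 / ((φ m : ℝ) + 1)) atTop (𝓝 0) :=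
          (tendsto_one_div_add_atTop_nhds_zero_nat (𝕜 := ℝ)).comp hφ.tendsto_atTop
        have h3 := le_of_tendsto_of_tendsto' h1 h2 fun m => (hk1 (φ m) i hi).le
        exact sub_eq_zero.1 (abs_nonpos_iff.1 h3)
      · have h1 := ((hFc j z).tendsto g).comp hlim
        have h3 := le_of_tendsto' h1 fun m => (hk2 (φ m)).le
        have : (0 : ℝ) < 1 / ((n : ℝ) + 1) := by positivity
        linarith
  have e3 : lexSet L F A N = {z : X | (1 : L) ∈ closure {g : L | g • z ∈ A}} ∩
      ⋂ j, {z : X | ∃ h ∈ closure ({g : L | g • z ∈ A} ∩ N),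
        (∀ i < j, F i (h • z) = F i z) ∧ F j (h • z) < F j z}ᶜ := by
    ext z
    simp only [lexSet, Set.mem_ofPred_eq, Set.mem_inter_iff, Set.mem_iInter, Set.mem_compl_iff,
      not_exists, not_and, not_lt]
  rw [e3, e1]
  refine MeasurableSet.inter ?_ (MeasurableSet.iInter fun j => MeasurableSet.compl ?_)
  · exact MeasurableSet.biInter
      ((TopologicalSpace.countable_countableBasis L).mono fun b hb => hb.1) fun b _ =>
      MeasurableSet.iUnion fun k => MeasurableSet.iUnion fun _ => hγA k
  · rw [e2]
    refine MeasurableSet.iUnion fun n => MeasurableSet.iInter fun m => MeasurableSet.iUnion fun k =>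
      MeasurableSet.iUnion fun _ => (hγA k).inter (MeasurableSet.inter ?_ ?_)
    · exact MeasurableSet.iInter fun i => MeasurableSet.iInter fun _ =>
        measurableSet_lt (((hFm i).comp (measurable_const_smul _)).sub (hFm i)).norm
          measurable_const
    · exact measurableSet_lt ((hFm j).comp (measurable_const_smul _)) ((hFm j).sub_const _)

/-- If the returns of `x` to `A` within `N` stay in `W`, then the lexicographically smallest
point of the closure of these returns belongs to the lexicographic section of `A`. -/
theorem exists_smul_mem_lexSet [ContinuousMul L] [T2Space L] {F : ℕ → X → ℝ}
    (hFc : ∀ j x, Continuous fun g : L => F j (g • x)) {A : Set X} {N N' W : Set L}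
    (hW : IsCompact W) (hN'W : N' * W ⊆ N) (h1N : (1 : L) ∈ N) {x : X} (hx : x ∈ A)
    (hret : ∀ g ∈ N, g • x ∈ A → g ∈ W) : ∃ g ∈ W, g • x ∈ lexSet L F A N' := by
  set Q := closure ({g : L | g • x ∈ A} ∩ N) with hQdef
  have hQW : Q ⊆ W := closure_minimal (fun g hg => hret g hg.2 hg.1) hW.isClosed
  have hQ : IsCompact Q := hW.of_isClosed_subset isClosed_closure hQW
  have hne : Q.Nonempty := ⟨1, subset_closure ⟨by simpa using hx, h1N⟩⟩
  obtain ⟨g, hg, hmin⟩ := exists_lexicographic_min (fun j => hFc j x) hQ hne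
  refine ⟨g, hQW hg, ?_, fun j h hh heq => ?_⟩
  · have h1 := closure_mono Set.inter_subset_left hg
    have h2 := map_mem_closure (continuous_mul_const g⁻¹) h1
      (t := {k : L | k • g • x ∈ A}) fun k hk => by simpa [← mul_smul] using hk
    rwa [mul_inv_cancel] at h2
  · have h2 : h * g ∈ Q := map_mem_closure (f := fun k => k * g) (continuous_mul_const g) hh fun k hk =>
      ⟨by simpa [mul_smul] using hk.1, hN'W ⟨k, hk.2, g, hQW hg, rfl⟩⟩
    have := hmin j (h * g) h2 (fun i hi => by rw [mul_smul]; exact heq i hi)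
    rwa [mul_smul] at this

end Sections

section Sections

variable {L X : Type*} [Group L]

/-- The map `(g, x) ↦ g • x` is injective on `E × S` if the left differences of `E` are small. -/
theorem IsLacunary.eq_of_smul_eq [MulAction L X] {V W : Set L} {S : Set X} (hS : IsLacunary W S)
    (hV : ∀ x : X, ∀ g ∈ V, g • x = x → g = 1) {g h : L} {x y : X} (hx : x ∈ S) (hy : y ∈ S)
    (hgh : h⁻¹ * g ∈ V ∩ W) (heq : g • x = h • y) : g = h ∧ x = y := by
  have h1 : (h⁻¹ * g) • x = y := by rw [mul_smul, heq, inv_smul_smul]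
  have h2 := hS x hx _ hgh.2 (by rwa [h1])
  have h3 := hV x _ hgh.1 h2
  exact ⟨(inv_mul_eq_one.1 h3).symm, by rw [← h1, h2]⟩

variable [TopologicalSpace L] [IsTopologicalGroup L]

/-- A second countable group is a countable disjoint union of Borel sets all of whose left
differences lie in a given neighbourhood of the identity. -/
theorem exists_small_pieces [SecondCountableTopology L] [MeasurableSpace L] [BorelSpace L]
    {V : Set L} (hV : V ∈ 𝓝 1) :
    ∃ P : ℕ → Set L, (∀ i, MeasurableSet (P i)) ∧ Pairwise (Function.onFun Disjoint P) ∧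
      (⋃ i, P i) = Set.univ ∧ ∀ i, ∀ g ∈ P i, ∀ h ∈ P i, h⁻¹ * g ∈ V := by
  obtain ⟨U, hU, -, hUi, hUV⟩ := exists_closed_nhds_one_inv_eq_mul_subset hV
  have h1 : (1 : L) ∈ interior U := mem_interior_iff_mem_nhds.2 hU
  have hO : ∀ k : L, IsOpen ((fun g => k⁻¹ * g) ⁻¹' interior U) := fun k =>
    isOpen_interior.preimage (continuous_const_mul _)
  obtain ⟨s, hs, hcov⟩ := TopologicalSpace.countable_cover_nhds
    (f := fun k : L => (fun g => k⁻¹ * g) ⁻¹' interior U)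
    fun k => (hO k).mem_nhds (by simpa using h1)
  have hne : s.Nonempty := by
    by_contra h
    rw [Set.not_nonempty_iff_eq_empty] at h
    simp only [h, Set.mem_empty_iff_false, Set.iUnion_of_empty, Set.iUnion_empty] at hcov
    exact Set.empty_ne_univ hcov
  obtain ⟨k, rfl⟩ := hs.exists_eq_range hne
  refine ⟨disjointed fun i => (fun g => (k i)⁻¹ * g) ⁻¹' interior U,
    fun i => MeasurableSet.disjointed (fun i => (hO (k i)).measurableSet) i,
    disjoint_disjointed _, ?_, ?_⟩
  · rw [iUnion_disjointed, ← hcov, Set.biUnion_range]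
  · intro i g hg h hh
    have hg' := interior_subset (disjointed_subset _ i hg)
    have hh' := interior_subset (disjointed_subset _ i hh)
    refine hUV ⟨((k i)⁻¹ * h)⁻¹, by rw [← hUi]; exact Set.inv_mem_inv.2 hh', (k i)⁻¹ * g, hg', ?_⟩
    simp [mul_assoc]

variable [MulAction L X]

variable [PolishSpace L] [MeasurableSpace L] [BorelSpace L]
  [MeasurableSpace X] [StandardBorelSpace X] [MeasurableSMul₂ L X]

/-- The map `(g, x) ↦ g • x` on `L × S` is countable-to-one, so that it preserves Borel sets. -/
theorem IsLacunary.measurableSet_image {V W : Set L} {S : Set X} (hS : IsLacunary W S)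
    (hV : ∀ x : X, ∀ g ∈ V, g • x = x → g = 1) (hVn : V ∈ 𝓝 1) (hWn : W ∈ 𝓝 1)
    {E : Set (L × X)} (hE : MeasurableSet E) (hES : ∀ p ∈ E, p.2 ∈ S) :
    MeasurableSet ((fun p : L × X => p.1 • p.2) '' E) := by
  obtain ⟨P, hPm, -, hPu, hP⟩ := exists_small_pieces (Filter.inter_mem hVn hWn)
  have : E = ⋃ i, E ∩ Prod.fst ⁻¹' P i := by
    rw [← Set.inter_iUnion, ← Set.preimage_iUnion, hPu, Set.preimage_univ, Set.inter_univ]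
  rw [this, Set.image_iUnion]
  refine MeasurableSet.iUnion fun i => ?_
  refine (hE.inter (measurable_fst (hPm i))).image_of_measurable_injOn
    (measurable_fst.smul measurable_snd) ?_
  rintro p ⟨hp, hpi⟩ q ⟨hq, hqi⟩ heq
  have := hS.eq_of_smul_eq hV (hES p hp) (hES q hq) (hP i _ hpi _ hqi) heq
  exact Prod.ext this.1 this.2

/-- The greedy union of a sequence of sections: the points of each section that are not in the
`W`-neighbourhood of the previous ones are added in turn. -/
def greedyUnion (W : Set L) (S : ℕ → Set X) : ℕ → Set X
  | 0 => S 0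
  | n + 1 => greedyUnion W S n ∪
      (S (n + 1) \ (fun p : L × X => p.1 • p.2) '' (W ×ˢ greedyUnion W S n))

theorem greedyUnion_spec {V W : Set L} {S : ℕ → Set X} (hS : ∀ n, IsLacunary W (S n))
    (hSm : ∀ n, MeasurableSet (S n)) (hV : ∀ x : X, ∀ g ∈ V, g • x = x → g = 1) (hVn : V ∈ 𝓝 1)
    (hWn : W ∈ 𝓝 1) (hWm : MeasurableSet W) (hWi : W⁻¹ = W) (n : ℕ) :
    IsLacunary W (greedyUnion W S n) ∧ MeasurableSet (greedyUnion W S n) := by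
  induction n with
  | zero => exact ⟨hS 0, hSm 0⟩
  | succ n ih =>
    obtain ⟨ihl, ihm⟩ := ih
    have him := ihl.measurableSet_image hV hVn hWn (hWm.prod ihm) fun p hp => hp.2
    refine ⟨?_, ihm.union ((hSm _).diff him)⟩
    rintro x (hx | hx) g hg (hgx | hgx)
    · exact ihl x hx g hg hgx
    · exact absurd ⟨(g, x), ⟨hg, hx⟩, rfl⟩ hgx.2
    · refine absurd ⟨(g⁻¹, g • x), ⟨?_, hgx⟩, inv_smul_smul g x⟩ hx.2
      rw [← hWi]
      exact Set.inv_mem_inv.2 hg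
    · exact hS _ x hx.1 g hg hgx.1

/-- Borel actions with uniformly discrete stabilizers admit complete lacunary sections. -/
theorem exists_isCompleteLacunarySection [LocallyCompactSpace L]
    (hdisc : HasUniformlyDiscreteStabilizers L X) : ∃ S : Set X, IsCompleteLacunarySection L S := by
  obtain ⟨V, hVn, hV'⟩ := hdisc
  have hV : ∀ x : X, ∀ g ∈ V, g • x = x → g = 1 := hV'
  obtain ⟨U₁, hU₁n, -, -, hU₁V⟩ := exists_closed_nhds_one_inv_eq_mul_subset hVn
  obtain ⟨U₂, hU₂n, hU₂c, hU₂i, hU₂U⟩ := exists_closed_nhds_one_inv_eq_mul_subset hU₁n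
  obtain ⟨K, hK, hKn⟩ := exists_compact_mem_nhds (1 : L)
  set W : Set L := U₂ ∩ (K ∩ K⁻¹) with hWdef
  have hWc : IsCompact W := (hK.inter hK.inv).inter_left hU₂c
  have hWn : W ∈ 𝓝 (1 : L) :=
    Filter.inter_mem hU₂n (Filter.inter_mem hKn (inv_mem_nhds_one L hKn))
  have hWi : W⁻¹ = W := by
    rw [hWdef, Set.inter_inv, Set.inter_inv, hU₂i, inv_inv, Set.inter_comm K⁻¹]
  have h1W : (1 : L) ∈ interior W := mem_interior_iff_mem_nhds.2 hWn
  have hWV : W * W * W ⊆ V := by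
    refine subset_trans ?_ hU₁V
    have h2 : W ⊆ U₂ := Set.inter_subset_left
    have h3 : U₂ ⊆ U₁ := fun g hg => hU₂U ⟨g, hg, 1, mem_of_mem_nhds hU₂n, mul_one g⟩
    exact Set.mul_subset_mul ((Set.mul_subset_mul h2 h2).trans hU₂U) (h2.trans h3)
  -- returns are compared within `interior W * W`, an open set that contains `W`
  set N' : Set L := interior W * W with hN'
  have hN'o : IsOpen N' := isOpen_interior.mul_right
  have hWN' : W ⊆ N' := fun g hg => ⟨1, h1W, g, hg, one_mul g⟩
  obtain ⟨F, hFm, hFc, hFs⟩ := exists_orbit_continuous_separating L X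
  have hne : Nonempty (List (ℕ × ℚ) × ℕ) := ⟨([], 0)⟩
  obtain ⟨e, he⟩ := exists_surjective_nat (List (ℕ × ℚ) × ℕ)
  let S : ℕ → Set X := fun n => lexSet L F (basicSet F (e n).1 (e n).2) N'
  have hSl : ∀ n, IsLacunary W (S n) := fun n => isLacunary_lexSet hFs _ hN'o hWN' hWi
  have hSm : ∀ n, MeasurableSet (S n) := fun n =>
    measurableSet_lexSet hFm hFc (measurableSet_basicSet hFm _ _)
      (isOpen_orbit_basicSet hFc _ _) hN'o (hWc.mul hWc)
      (Set.mul_subset_mul interior_subset subset_rfl)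
  -- Around each point there is a basic set with no return in `W³` outside `interior W`: this compact
  -- set of group elements fixes no point. The corresponding lexicographic section is at distance at
  -- most `W`.
  have hScov : ∀ x : X, ∃ n, ∃ g ∈ W, g • x ∈ S n := by
    intro x
    obtain ⟨l, m, hx, hav⟩ := exists_basicSet_avoiding hFc hFs x
      (K := (W * W * W) \ interior W) (((hWc.mul hWc).mul hWc).diff isOpen_interior) (by
        rintro g ⟨hg, hg'⟩ hgx
        rw [hV x g (hWV hg) hgx] at hg'
        exact hg' h1W)
    obtain ⟨n, hn⟩ := he (l, m)
    refine ⟨n, ?_⟩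
    simp only [S, hn]
    refine exists_smul_mem_lexSet hFc hWc (N := N' * W) subset_rfl
      ⟨1, hWN' (interior_subset h1W), 1, interior_subset h1W, mul_one 1⟩ hx ?_
    intro g hg hgA
    by_contra hgW
    exact hav g ⟨Set.mul_subset_mul (Set.mul_subset_mul interior_subset subset_rfl) subset_rfl hg,
      fun h => hgW (interior_subset h)⟩ hgA
  have hspec := greedyUnion_spec hSl hSm hV hVn hWn hWc.measurableSet hWi
  have hmono : Monotone (greedyUnion W S) :=
    monotone_nat_of_le_succ fun n => Set.subset_union_left
  refine ⟨⋃ n, greedyUnion W S n, MeasurableSet.iUnion fun n => (hspec n).2, W, hWc, hWn, hWi,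
    ?_, ?_⟩
  · intro x hx g hg hgx
    obtain ⟨n, hn⟩ := Set.mem_iUnion.1 hx
    obtain ⟨m, hm⟩ := Set.mem_iUnion.1 hgx
    exact (hspec (max n m)).1 x (hmono (le_max_left n m) hn) g hg (hmono (le_max_right n m) hm)
  · intro y
    obtain ⟨n, g, hg, hgy⟩ := hScov y
    have hgi : g⁻¹ ∈ W := by rw [← hWi]; exact Set.inv_mem_inv.2 hg
    -- a point of the `n`-th section lies in the `W`-neighbourhood of the greedy union
    have key : ∃ h ∈ W, ∃ x ∈ ⋃ n, greedyUnion W S n, h • x = g • y := by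
      cases n with
      | zero =>
        exact ⟨1, interior_subset h1W, g • y, Set.mem_iUnion.2 ⟨0, hgy⟩, one_smul _ _⟩
      | succ n =>
        by_cases hc : g • y ∈ (fun p : L × X => p.1 • p.2) '' (W ×ˢ greedyUnion W S n)
        · obtain ⟨⟨h, x⟩, ⟨hh, hx⟩, heq⟩ := hc
          exact ⟨h, hh, x, Set.mem_iUnion.2 ⟨n, hx⟩, heq⟩
        · exact ⟨1, interior_subset h1W, g • y,
            Set.mem_iUnion.2 ⟨n + 1, Or.inr ⟨hgy, hc⟩⟩, one_smul _ _⟩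
    obtain ⟨h, hh, x, hx, heq⟩ := key
    exact ⟨g⁻¹ * h, ⟨g⁻¹, hgi, h, hh, rfl⟩, x, hx, by rw [mul_smul, heq, inv_smul_smul]⟩

end Sections

/-! ### The lift of a measure to a section and its disintegration -/

section Fiber

/-- The counting measure of the fiber over `x` of the map `(g, x') ↦ g x'` on `L × S`. -/
noncomputable def fiberMeasure (L : Type*) {X : Type*} [Group L] [MeasurableSpace L]
    [MeasurableSpace X] [MulAction L X] (S : Set X) (x : X) : Measure (L × X) :=
  Measure.count.restrict {p : L × X | p.2 ∈ S ∧ p.1 • p.2 = x}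

variable {L X : Type*} [Group L] [TopologicalSpace L] [IsTopologicalGroup L] [PolishSpace L]
  [MeasurableSpace L] [BorelSpace L]
  [MeasurableSpace X] [StandardBorelSpace X] [MulAction L X] [MeasurableSMul₂ L X]

theorem measurableSet_fiber {S : Set X} (hS : MeasurableSet S) (x : X) :
    MeasurableSet {p : L × X | p.2 ∈ S ∧ p.1 • p.2 = x} :=
  (measurable_snd hS).inter ((measurable_fst.smul measurable_snd) (measurableSet_singleton x))

theorem ae_fiberMeasure_iff {S : Set X} (hS : MeasurableSet S) (x : X) {P : L × X → Prop} :
    (∀ᵐ p ∂(fiberMeasure L S x), P p) ↔ ∀ p : L × X, p.2 ∈ S → p.1 • p.2 = x → P p := by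
  rw [fiberMeasure, ae_restrict_iff' (measurableSet_fiber hS x), Measure.ae_count_iff]
  simp

/-- The fiber over `l • x` is the translate by `l` of the fiber over `x`. -/
theorem fiberMeasure_smul (S : Set X) (l : L) (x : X) :
    fiberMeasure L S (l • x) = (fiberMeasure L S x).map fun p => (l * p.1, p.2) := by
  let e : L × X ≃ᵐ L × X :=
    MeasurableEquiv.prodCongr (MeasurableEquiv.mulLeft l) (MeasurableEquiv.refl X)
  have he : (fun p : L × X => (l * p.1, p.2)) = e := rfl
  rw [he, fiberMeasure, fiberMeasure]
  have h1 : (Measure.count : Measure (L × X)).map e = Measure.count := by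
    ext s hs
    rw [e.map_apply, Measure.count_apply hs, Measure.count_apply (e.measurable hs)]
    congr 1
    exact Set.encard_preimage_of_bijective e.bijective s
  have h2 : {p : L × X | p.2 ∈ S ∧ p.1 • p.2 = x} = e ⁻¹' {p | p.2 ∈ S ∧ p.1 • p.2 = l • x} := by
    ext p
    have : e p = (l * p.1, p.2) := rfl
    simp [this, mul_smul]
  rw [h2]
  conv_lhs => rw [← h1]
  exact e.restrict_map _ _

/-- What is used of a complete lacunary section: its fibers are countable, with a partition of the
group into Borel pieces `P i` that each of them meets at most once, they have boundedly many points
above each compact subset of the group, and none of them is empty. -/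
structure FiberSystem (L : Type*) {X : Type*} [Group L] [TopologicalSpace L] [MeasurableSpace L]
    [MeasurableSpace X] [MulAction L X] (S : Set X) where
  measurableSet : MeasurableSet S
  P : ℕ → Set L
  measurable_P : ∀ i, MeasurableSet (P i)
  disjoint_P : Pairwise (Function.onFun Disjoint P)
  iUnion_P : (⋃ i, P i) = Set.univ
  injOn : ∀ i, ∀ p q : L × X, p.1 ∈ P i → q.1 ∈ P i → p.2 ∈ S → q.2 ∈ S →
    p.1 • p.2 = q.1 • q.2 → p = q
  compact_bound : ∀ C : Set L, IsCompact C → ∃ n : ℕ, ∀ x : X,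
    fiberMeasure L S x (C ×ˢ Set.univ) ≤ n
  complete : ∀ x : X, ∃ p : L × X, p.2 ∈ S ∧ p.1 • p.2 = x

theorem fiberMeasure_le_one {S : Set X} (hS : MeasurableSet S) (x : X) {E : Set (L × X)}
    (hE : MeasurableSet E) (h : ∀ p ∈ E, ∀ q ∈ E, p.2 ∈ S → q.2 ∈ S → p.1 • p.2 = x →
      q.1 • q.2 = x → p = q) : fiberMeasure L S x E ≤ 1 := by
  rw [fiberMeasure, Measure.restrict_apply hE]
  have : (E ∩ {p : L × X | p.2 ∈ S ∧ p.1 • p.2 = x}).Subsingleton := fun p hp q hq =>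
    h p hp.1 q hq.1 hp.2.1 hq.2.1 hp.2.2 hq.2.2
  rw [Measure.count_apply (hE.inter (measurableSet_fiber hS x))]
  have := Set.encard_le_one_iff_subsingleton.2 this
  exact_mod_cast this

theorem exists_fiberSystem {S : Set X} (hdisc : HasUniformlyDiscreteStabilizers L X)
    (hS : IsCompleteLacunarySection L S) : Nonempty (FiberSystem L S) := by
  obtain ⟨V, hVn, hV'⟩ := hdisc
  have hV : ∀ x : X, ∀ g ∈ V, g • x = x → g = 1 := hV'
  obtain ⟨hSm, U, hUc, hUn, hUi, hlac, hcomp⟩ := hS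
  have hlac' : IsLacunary U S := hlac
  obtain ⟨P, hPm, hPd, hPu, hP⟩ := exists_small_pieces (Filter.inter_mem hVn hUn)
  refine ⟨⟨hSm, P, hPm, hPd, hPu, ?_, ?_, ?_⟩⟩
  · intro i p q hp hq hpS hqS heq
    have := hlac'.eq_of_smul_eq hV hpS hqS (hP i _ hp _ hq) heq
    exact Prod.ext this.1 this.2
  -- cover `C` by finitely many translates of a small set, each of which meets a fiber at most once
  · intro C hC
    obtain ⟨W, hW, -, hWi, hWV⟩ := exists_closed_nhds_one_inv_eq_mul_subset
      (Filter.inter_mem hVn hUn)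
    have h1 : (1 : L) ∈ interior W := mem_interior_iff_mem_nhds.2 hW
    have hO : ∀ k : L, IsOpen ((fun g => k⁻¹ * g) ⁻¹' interior W) := fun k =>
      isOpen_interior.preimage (continuous_const_mul _)
    obtain ⟨t, ht⟩ := hC.elim_finite_subcover (fun k : L => (fun g => k⁻¹ * g) ⁻¹' interior W) hO
      fun g _ => Set.mem_iUnion.2 ⟨g, by simpa using h1⟩
    refine ⟨t.card, fun x => ?_⟩
    calc fiberMeasure L S x (C ×ˢ Set.univ)
        ≤ fiberMeasure L S x (⋃ k ∈ t, ((fun g => k⁻¹ * g) ⁻¹' interior W) ×ˢ Set.univ) := by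
          refine measure_mono ?_
          rintro p ⟨hp, -⟩
          obtain ⟨k, hk, hpk⟩ := Set.mem_iUnion₂.1 (ht hp)
          exact Set.mem_iUnion₂.2 ⟨k, hk, hpk, Set.mem_univ _⟩
      _ ≤ ∑ k ∈ t, fiberMeasure L S x (((fun g => k⁻¹ * g) ⁻¹' interior W) ×ˢ Set.univ) :=
          measure_biUnion_finset_le _ _
      _ ≤ ∑ k ∈ t, 1 := by
          refine Finset.sum_le_sum fun k _ => ?_
          refine fiberMeasure_le_one hSm x ((hO k).measurableSet.prod MeasurableSet.univ) ?_
          rintro p ⟨hp, -⟩ q ⟨hq, -⟩ hpS hqS hpx hqx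
          have hmem : q.1⁻¹ * p.1 ∈ V ∩ U := by
            refine hWV ⟨(k⁻¹ * q.1)⁻¹, ?_, k⁻¹ * p.1, interior_subset hp, by simp [mul_assoc]⟩
            rw [← hWi]
            exact Set.inv_mem_inv.2 (interior_subset hq)
          have := hlac'.eq_of_smul_eq hV hpS hqS hmem (hpx.trans hqx.symm)
          exact Prod.ext this.1 this.2
      _ = t.card := by simp
  · intro x
    obtain ⟨g, -, y, hy, heq⟩ := hcomp x
    exact ⟨(g, y), hy, heq⟩

namespace FiberSystem

variable {S : Set X} (Φ : FiberSystem L S)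

theorem fiberMeasure_eq_tsum (Φ : FiberSystem L S) (x : X) {E : Set (L × X)}
    (hE : MeasurableSet E) :
    fiberMeasure L S x E = ∑' i, fiberMeasure L S x (E ∩ Prod.fst ⁻¹' Φ.P i) := by
  rw [← measure_iUnion]
  · rw [← Set.inter_iUnion, ← Set.preimage_iUnion, Φ.iUnion_P, Set.preimage_univ, Set.inter_univ]
  · intro i j hij
    exact ((Φ.disjoint_P hij).preimage _).mono Set.inter_subset_right Set.inter_subset_right
  · exact fun i => hE.inter (measurable_fst (Φ.measurable_P i))

theorem fiberMeasure_piece_le_one (Φ : FiberSystem L S) (x : X) (i : ℕ) {E : Set (L × X)}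
    (hE : MeasurableSet E) : fiberMeasure L S x (E ∩ Prod.fst ⁻¹' Φ.P i) ≤ 1 :=
  fiberMeasure_le_one Φ.measurableSet x (hE.inter (measurable_fst (Φ.measurable_P i)))
    fun p hp q hq hpS hqS hpx hqx => Φ.injOn i p q hp.2 hq.2 hpS hqS (hpx.trans hqx.symm)

theorem measurable_fiberMeasure (Φ : FiberSystem L S) : Measurable (fiberMeasure L S) := by
  refine Measure.measurable_of_measurable_coe _ fun E hE => ?_
  simp_rw [fun x => Φ.fiberMeasure_eq_tsum x hE]
  refine Measurable.tsum fun i => ?_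
  set E' : Set (L × X) := (E ∩ Prod.fst ⁻¹' Φ.P i) ∩ Prod.snd ⁻¹' S with hE'
  have hE'm : MeasurableSet E' :=
    (hE.inter (measurable_fst (Φ.measurable_P i))).inter (measurable_snd Φ.measurableSet)
  have him : MeasurableSet ((fun p : L × X => p.1 • p.2) '' E') :=
    hE'm.image_of_measurable_injOn (measurable_fst.smul measurable_snd)
      fun p hp q hq heq => Φ.injOn i p q hp.1.2 hq.1.2 hp.2 hq.2 heq
  have : (fun x => fiberMeasure L S x (E ∩ Prod.fst ⁻¹' Φ.P i)) =
      ((fun p : L × X => p.1 • p.2) '' E').indicator 1 := by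
    funext x
    by_cases hx : x ∈ (fun p : L × X => p.1 • p.2) '' E'
    · rw [Set.indicator_of_mem hx, Pi.one_apply]
      refine le_antisymm (Φ.fiberMeasure_piece_le_one x i hE) ?_
      obtain ⟨p, hp, hpx⟩ := hx
      rw [fiberMeasure, Measure.restrict_apply (hE.inter (measurable_fst (Φ.measurable_P i)))]
      rw [← Measure.count_singleton p]
      exact measure_mono (Set.singleton_subset_iff.2 ⟨hp.1, hp.2, hpx⟩)
    · rw [Set.indicator_of_notMem hx, fiberMeasure,
        Measure.restrict_apply (hE.inter (measurable_fst (Φ.measurable_P i)))]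
      have hem : E ∩ Prod.fst ⁻¹' Φ.P i ∩ {p : L × X | p.2 ∈ S ∧ p.1 • p.2 = x} = ∅ :=
        Set.eq_empty_iff_forall_notMem.2 fun p hp => hx ⟨p, ⟨hp.1, hp.2.1⟩, hp.2.2⟩
      rw [hem, measure_empty]
  rw [this]
  exact measurable_one.indicator him

/-- The kernel of the counting measures of the fibers of `(g, x') ↦ g x'`. -/
noncomputable def fiber (Φ : FiberSystem L S) : Kernel X (L × X) :=
  ⟨fiberMeasure L S, Φ.measurable_fiberMeasure⟩

theorem fiber_apply (x : X) : Φ.fiber x = fiberMeasure L S x := rfl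

instance : IsSFiniteKernel Φ.fiber := by
  let κ : ℕ → Kernel X (L × X) := fun i => Φ.fiber.restrict (measurable_fst (Φ.measurable_P i))
  have h1 : ∀ i, IsFiniteKernel (κ i) := fun i => ⟨1, ENNReal.one_lt_top, fun x => by
    rw [Kernel.restrict_apply' _ _ _ MeasurableSet.univ]
    exact Φ.fiberMeasure_piece_le_one x i MeasurableSet.univ⟩
  refine ⟨κ, h1, ?_⟩
  ext x E hE
  rw [Kernel.sum_apply' _ _ hE, fiber_apply, Φ.fiberMeasure_eq_tsum x hE]
  refine tsum_congr fun i => ?_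
  rw [Kernel.restrict_apply' _ _ _ hE]
  rfl

/-- A positive weight on the group with bounded sums over the fibers. -/
noncomputable def weight (Φ : FiberSystem L S) (g : L) : ℝ≥0∞ :=
  ∑' i, (Φ.P i).indicator (fun _ => 2⁻¹ ^ i) g

theorem measurable_weight : Measurable Φ.weight :=
  Measurable.tsum fun i => measurable_const.indicator (Φ.measurable_P i)

theorem weight_eq {i : ℕ} {g : L} (hg : g ∈ Φ.P i) : Φ.weight g = 2⁻¹ ^ i := by
  rw [weight, tsum_eq_single i, Set.indicator_of_mem hg]
  intro j hj
  exact Set.indicator_of_notMem (fun h => Set.disjoint_left.1 (Φ.disjoint_P hj) h hg) _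

theorem weight_pos (g : L) : Φ.weight g ≠ 0 ∧ Φ.weight g ≠ ∞ := by
  have : g ∈ ⋃ i, Φ.P i := by rw [Φ.iUnion_P]; trivial
  obtain ⟨i, hi⟩ := Set.mem_iUnion.1 this
  rw [Φ.weight_eq hi]
  exact ⟨pow_ne_zero _ (by simp), ENNReal.pow_ne_top (by simp)⟩

theorem lintegral_weight_le (x : X) : ∫⁻ p, Φ.weight p.1 ∂(Φ.fiber x) ≤ 2 := by
  simp only [weight]
  rw [lintegral_tsum]
  · calc ∑' i, ∫⁻ p : L × X, (Φ.P i).indicator (fun _ => (2⁻¹ : ℝ≥0∞) ^ i) p.1 ∂(Φ.fiber x)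
        ≤ ∑' i : ℕ, (2⁻¹ : ℝ≥0∞) ^ i := by
          refine ENNReal.tsum_le_tsum fun i => ?_
          have e : (fun p : L × X => (Φ.P i).indicator (fun _ => (2⁻¹ : ℝ≥0∞) ^ i) p.1) =
            (Prod.fst ⁻¹' Φ.P i).indicator fun _ => (2⁻¹ : ℝ≥0∞) ^ i := rfl
          rw [e, lintegral_indicator (measurable_fst (Φ.measurable_P i)), setLIntegral_const]
          have := Φ.fiberMeasure_piece_le_one x i MeasurableSet.univ
          rw [Set.univ_inter] at this
          calc _ ≤ (2⁻¹ : ℝ≥0∞) ^ i * 1 := mul_le_mul_right this _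
            _ = _ := mul_one _
      _ = 2 := by rw [ENNReal.tsum_geometric]; simp
  · exact fun i => ((measurable_const.indicator (Φ.measurable_P i)).comp measurable_fst).aemeasurable

theorem lintegral_weight_ne_zero (x : X) : ∫⁻ p, Φ.weight p.1 ∂(Φ.fiber x) ≠ 0 := by
  intro h
  rw [lintegral_eq_zero_iff (by exact Φ.measurable_weight.comp measurable_fst)] at h
  obtain ⟨p, hpS, hpx⟩ := Φ.complete x
  exact (Φ.weight_pos p.1).1 ((ae_fiberMeasure_iff Φ.measurableSet x).1 h p hpS hpx)

theorem sectionLift_eq (lam : Measure X) : sectionLift L lam S = lam.bind Φ.fiber := rfl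

theorem lintegral_sectionLift (lam : Measure X) {f : L × X → ℝ≥0∞} (hf : Measurable f) :
    ∫⁻ p, f p ∂(sectionLift L lam S) = ∫⁻ x, ∫⁻ p, f p ∂(Φ.fiber x) ∂lam := by
  rw [Φ.sectionLift_eq, Measure.lintegral_bind Φ.fiber.aemeasurable hf.aemeasurable]

theorem ae_fiber_iff (x : X) {P : L × X → Prop} :
    (∀ᵐ p ∂(Φ.fiber x), P p) ↔ ∀ p : L × X, p.2 ∈ S → p.1 • p.2 = x → P p :=
  ae_fiberMeasure_iff Φ.measurableSet x

theorem lintegral_fiber_smul (l : L) (x : X) {f : L × X → ℝ≥0∞} (hf : Measurable f) :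
    ∫⁻ p, f p ∂(Φ.fiber (l • x)) = ∫⁻ p, f (l * p.1, p.2) ∂(Φ.fiber x) := by
  rw [fiber_apply, fiber_apply, fiberMeasure_smul S, lintegral_map hf (by fun_prop)]

theorem ae_of_ae_sectionLift (Φ : FiberSystem L S) {lam : Measure X} {P : L × X → Prop}
    (h : ∀ᵐ p ∂(sectionLift L lam S), P p) :
    ∀ᵐ x ∂lam, ∀ p : L × X, p.2 ∈ S → p.1 • p.2 = x → P p := by
  rw [Φ.sectionLift_eq] at h
  filter_upwards [Measure.ae_ae_of_ae_bind Φ.fiber.aemeasurable h] with x hx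
  exact (Φ.ae_fiber_iff x).1 hx

theorem ae_sectionLift_of_ae (Φ : FiberSystem L S) {lam : Measure X} {P : X → Prop} (h : ∀ᵐ x ∂lam, P x) :
    ∀ᵐ p ∂(sectionLift L lam S), P (p.1 • p.2) := by
  obtain ⟨N, hN, hNm, hN0⟩ := exists_measurable_superset_of_null (ae_iff.1 h)
  have hpre : MeasurableSet ((fun p : L × X => p.1 • p.2) ⁻¹' N) :=
    (measurable_fst.smul measurable_snd) hNm
  rw [ae_iff]
  refine measure_mono_null (t := (fun p : L × X => p.1 • p.2) ⁻¹' N) (fun p hp => hN hp) ?_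
  rw [Φ.sectionLift_eq, Measure.bind_apply hpre Φ.fiber.aemeasurable,
    lintegral_eq_zero_iff (Φ.fiber.measurable_coe hpre)]
  have : ∀ᵐ x ∂lam, x ∉ N := measure_eq_zero_iff_ae_notMem.1 hN0
  filter_upwards [this] with x hx
  refine measure_eq_zero_iff_ae_notMem.2 ((Φ.ae_fiber_iff x).2 fun p _ hpx => ?_)
  simpa [hpx] using hx

end FiberSystem

end Fiber

section MeasureFamilies

/-- In a countably generated space, equality of measures may be tested on countably many sets. -/
theorem ae_measure_eq {Z Y : Type*} [MeasurableSpace Z] [MeasurableSpace Y]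
    [MeasurableSpace.CountablyGenerated Y] {β : Measure Z} {μ ν : Z → Measure Y}
    (hfin : ∀ᵐ z ∂β, μ z Set.univ ≠ ∞)
    (h : ∀ E, MeasurableSet E → ∀ᵐ z ∂β, μ z E = ν z E) : ∀ᵐ z ∂β, μ z = ν z := by
  let b := MeasurableSpace.natGeneratingSequence Y
  have hb : ∀ i, MeasurableSet (b i) := MeasurableSpace.measurableSet_natGeneratingSequence
  let D : Finset ℕ → Set Y := fun t => ⋂ i ∈ t, b i
  have hD : ∀ t, MeasurableSet (D t) := fun t => Finset.measurableSet_biInter t fun i _ => hb i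
  have hall : ∀ᵐ z ∂β, ∀ t, μ z (D t) = ν z (D t) := ae_all_iff.2 fun t => h _ (hD t)
  filter_upwards [hfin, hall] with z hz hz'
  have : IsFiniteMeasure (μ z) := ⟨lt_top_iff_ne_top.2 hz⟩
  refine ext_of_generate_finite (Set.range D) ?_ ?_ ?_ ?_
  · refine le_antisymm ?_ (MeasurableSpace.generateFrom_le ?_)
    · rw [← MeasurableSpace.generateFrom_natGeneratingSequence Y]
      refine MeasurableSpace.generateFrom_le ?_
      rintro _ ⟨i, rfl⟩
      exact MeasurableSpace.measurableSet_generateFrom ⟨{i}, by simp [D, b]⟩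
    · rintro _ ⟨t, rfl⟩
      exact hD t
  · rintro _ ⟨s, rfl⟩ _ ⟨t, rfl⟩ -
    classical
    refine ⟨s ∪ t, ?_⟩
    simp only [D]
    exact Finset.iInf_union
  · rintro _ ⟨t, rfl⟩
    exact hz' t
  · simpa [D] using hz' ∅

namespace SameClass

variable {L : Type*} [MeasurableSpace L] {μ ν ρ : Measure L}

theorem symm (h : SameClass μ ν) : SameClass ν μ := by
  obtain ⟨c, h0, ht, rfl⟩ := h
  exact ⟨c⁻¹, ENNReal.inv_ne_zero.2 ht, ENNReal.inv_ne_top.2 h0,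
    by rw [smul_smul, ENNReal.inv_mul_cancel h0 ht, one_smul]⟩

theorem trans (h₁ : SameClass μ ν) (h₂ : SameClass ν ρ) : SameClass μ ρ := by
  obtain ⟨c, h0, ht, rfl⟩ := h₁
  obtain ⟨d, h0', ht', rfl⟩ := h₂
  exact ⟨c * d, mul_ne_zero h0 h0', ENNReal.mul_ne_top ht ht', by rw [smul_smul]⟩

theorem map {L' : Type*} [MeasurableSpace L'] (h : SameClass μ ν) (f : L → L') :
    SameClass (μ.map f) (ν.map f) := by
  obtain ⟨c, h0, ht, rfl⟩ := h
  exact ⟨c, h0, ht, by rw [Measure.map_smul]⟩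

end SameClass

/-- Two disintegrations of the same measure have almost everywhere proportional components.
The hypothesis says that `β₁ ⊗ K₁ = β₂ ⊗ K₂`. -/
theorem ae_sameClass_of_lintegral_eq {Z L : Type*} [MeasurableSpace Z] [MeasurableSpace L]
    [MeasurableSpace.CountablyGenerated L] {β₁ β₂ : Measure Z} [SigmaFinite β₁] {K₁ K₂ : Kernel Z L}
    {C : ℕ → Set L} (hCm : ∀ i, MeasurableSet (C i)) (hCmono : Monotone C)
    (hCu : ⋃ i, C i = Set.univ)
    (hF : ∀ F : Z × L → ℝ≥0∞, Measurable F →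
      ∫⁻ z, ∫⁻ g, F (z, g) ∂(K₁ z) ∂β₁ = ∫⁻ z, ∫⁻ g, F (z, g) ∂(K₂ z) ∂β₂)
    (h₁ : ∀ᵐ z ∂β₁, K₁ z ≠ 0 ∧ ∀ i, K₁ z (C i) ≠ ∞)
    (h₂ : ∀ᵐ z ∂β₂, K₂ z ≠ 0 ∧ ∀ i, K₂ z (C i) ≠ ∞) :
    ∀ᵐ z ∂β₁, SameClass (K₁ z) (K₂ z) := by
  have hFset : ∀ (A : Set Z) (E : Set L) (f : Z → ℝ≥0∞), MeasurableSet A → MeasurableSet E →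
      Measurable f → ∫⁻ z in A, K₁ z E * f z ∂β₁ = ∫⁻ z in A, K₂ z E * f z ∂β₂ := by
    intro A E f hA hE hf
    have := hF (fun p => A.indicator 1 p.1 * (E.indicator 1 p.2 * f p.1))
      (((measurable_one.indicator hA).comp measurable_fst).mul
        (((measurable_one.indicator hE).comp measurable_snd).mul (hf.comp measurable_fst)))
    have e : ∀ (K : Kernel Z L) z, ∫⁻ g, A.indicator (1 : Z → ℝ≥0∞) z *
        (E.indicator 1 g * f z) ∂(K z) = A.indicator (fun z => K z E * f z) z := by
      intro K z
      rw [lintegral_const_mul _ ((measurable_one.indicator hE).mul_const _),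
        lintegral_mul_const _ (measurable_one.indicator hE), lintegral_indicator_one hE]
      by_cases hz : z ∈ A <;> simp [hz]
    simp only [e] at this
    rwa [lintegral_indicator hA, lintegral_indicator hA] at this
  have hm₁ : ∀ E, MeasurableSet E → Measurable fun z => K₁ z E := fun E hE => K₁.measurable_coe hE
  have hm₂ : ∀ E, MeasurableSet E → Measurable fun z => K₂ z E := fun E hE => K₂.measurable_coe hE
  -- the same regularity of `K₂` holds almost everywhere for `β₁`
  have h₂' : ∀ᵐ z ∂β₁, K₂ z ≠ 0 ∧ ∀ i, K₂ z (C i) ≠ ∞ := by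
    set N : Set Z := {z | K₂ z ≠ 0 ∧ ∀ i, K₂ z (C i) ≠ ∞}ᶜ with hN
    have hNm : MeasurableSet N := by
      have : N = ({z | K₂ z Set.univ = 0}ᶜ ∩ ⋂ i, {z | K₂ z (C i) = ∞}ᶜ)ᶜ := by
        ext z; simp [hN, Measure.measure_univ_eq_zero]
      rw [this]
      exact ((((hm₂ _ MeasurableSet.univ) (measurableSet_singleton 0)).compl).inter
        (MeasurableSet.iInter fun i =>
          ((hm₂ _ (hCm i)) (measurableSet_singleton ∞)).compl)).compl
    have hN₂ : β₂ N = 0 := h₂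
    have h3 := hFset N Set.univ 1 hNm MeasurableSet.univ measurable_one
    simp only [Pi.one_apply, mul_one] at h3
    rw [setLIntegral_measure_zero _ _ hN₂, lintegral_eq_zero_iff (hm₁ _ MeasurableSet.univ),
      Filter.EventuallyEq, ae_restrict_iff' hNm] at h3
    filter_upwards [h3, h₁] with z hz hz1
    by_contra hcon
    exact hz1.1 (Measure.measure_univ_eq_zero.1 (hz hcon))
  -- proportionality in cross-multiplied form: testing it on the sets of `Z` uses the hypothesis
  -- twice, and avoids a derivative of `β₁` with respect to `β₂`
  have key : ∀ i j, ∀ᵐ z ∂β₁, (K₂ z (C j)) • (K₁ z).restrict (C i) =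
      (K₁ z (C j)) • (K₂ z).restrict (C i) := by
    intro i j
    refine ae_measure_eq ?_ ?_
    · filter_upwards [h₁, h₂'] with z hz hz'
      simp only [Measure.smul_apply, smul_eq_mul, Measure.restrict_apply MeasurableSet.univ,
        Set.univ_inter]
      exact ENNReal.mul_ne_top (hz'.2 j) (hz.2 i)
    · intro E hE
      have hEi := hE.inter (hCm i)
      simp only [Measure.smul_apply, smul_eq_mul, Measure.restrict_apply hE]
      refine ae_eq_of_forall_setLIntegral_eq_of_sigmaFinite ((hm₂ _ (hCm j)).mul (hm₁ _ hEi))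
        ((hm₁ _ (hCm j)).mul (hm₂ _ hEi)) fun A hA _ => ?_
      have e1 := hFset A (E ∩ C i) (fun z => K₂ z (C j)) hA hEi (hm₂ _ (hCm j))
      have e2 := hFset A (C j) (fun z => K₂ z (E ∩ C i)) hA (hCm j) (hm₂ _ hEi)
      rw [e2, lintegral_congr fun z => mul_comm (K₂ z (C j)) (K₁ z (E ∩ C i)), e1]
      exact lintegral_congr fun z => mul_comm _ _
  -- a nonzero measure charges `C j` for all large `j`
  have hex : ∀ μ : Measure L, μ ≠ 0 → ∃ i, ∀ j ≥ i, μ (C j) ≠ 0 := by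
    intro μ hμ
    have : ∃ i, μ (C i) ≠ 0 := by
      by_contra hcon
      push Not at hcon
      refine hμ (Measure.measure_univ_eq_zero.1 ?_)
      rw [← hCu]
      exact measure_iUnion_null hcon
    obtain ⟨i, hi⟩ := this
    exact ⟨i, fun j hj h0 => hi (measure_mono_null (hCmono hj) h0)⟩
  filter_upwards [h₁, h₂', ae_all_iff.2 fun i => ae_all_iff.2 (key i)] with z hz hz' hk
  obtain ⟨i₁, hi₁⟩ := hex _ hz.1
  obtain ⟨i₂, hi₂⟩ := hex _ hz'.1
  set j := max i₁ i₂
  have ha := hi₁ j (le_max_left _ _)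
  have hb := hi₂ j (le_max_right _ _)
  refine ⟨(K₂ z (C j))⁻¹ * K₁ z (C j), mul_ne_zero (ENNReal.inv_ne_zero.2 (hz'.2 j)) ha,
    ENNReal.mul_ne_top (ENNReal.inv_ne_top.2 hb) (hz.2 j), ?_⟩
  have hres : ∀ i, (K₁ z).restrict (C i) =
      ((K₂ z (C j))⁻¹ * K₁ z (C j)) • (K₂ z).restrict (C i) := by
    intro i
    rw [mul_smul, ← hk i j, smul_smul, ENNReal.inv_mul_cancel hb (hz'.2 j), one_smul]
  refine (Measure.ext_iff_of_iUnion_eq_univ hCu).2 fun i => ?_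
  rw [hres i, Measure.restrict_smul]

end MeasureFamilies

section Disintegrations

variable {L X : Type*} [Group L] [TopologicalSpace L] [IsTopologicalGroup L] [PolishSpace L]
  [MeasurableSpace L] [BorelSpace L]
  [MeasurableSpace X] [StandardBorelSpace X] [MulAction L X] [MeasurableSMul₂ L X]

namespace IsSectionDisintegration

variable {S : Set X} {lam : Measure X} {nu : Measure X} {kappa : Kernel X L}

theorem isFiniteMeasure (h : IsSectionDisintegration lam S nu kappa) : IsFiniteMeasure nu := by
  obtain ⟨⟨m, hm, -, -, rfl⟩, -, -⟩ := h
  infer_instance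

theorem isSFiniteKernel (h : IsSectionDisintegration lam S nu kappa) : IsSFiniteKernel kappa := h.2.1

theorem lintegral_eq (Φ : FiberSystem L S) (h : IsSectionDisintegration lam S nu kappa)
    {F : L × X → ℝ≥0∞} (hF : Measurable F) :
    ∫⁻ x, ∫⁻ p, F p ∂(Φ.fiber x) ∂lam = ∫⁻ x', ∫⁻ g, F (g, x') ∂(kappa x') ∂nu := by
  have := h.isFiniteMeasure
  have := h.isSFiniteKernel
  rw [← Φ.lintegral_sectionLift lam hF, h.2.2, lintegral_map hF measurable_swap,
    Measure.lintegral_compProd (f := fun q : X × L => F q.swap) (hF.comp measurable_swap)]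
  rfl

theorem ae_sectionLift_of_ae (h : IsSectionDisintegration lam S nu kappa) {P : X → Prop}
    (hP : ∀ᵐ x' ∂nu, P x') : ∀ᵐ p ∂(sectionLift L lam S), P p.2 := by
  obtain ⟨⟨m, hm, -, hac, rfl⟩, -, -⟩ := h
  exact hac.ae_le (ae_of_ae_map measurable_snd.aemeasurable hP)

theorem ae_of_ae_sectionLift (h : IsSectionDisintegration lam S nu kappa) {P : L × X → Prop}
    (hP : ∀ᵐ p ∂(sectionLift L lam S), P p) : ∀ᵐ x' ∂nu, ∀ᵐ g ∂(kappa x'), P (g, x') := by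
  have := h.isFiniteMeasure
  have := h.isSFiniteKernel
  rw [h.2.2] at hP
  have h1 := ae_of_ae_map measurable_swap.aemeasurable hP
  exact Measure.ae_ae_of_ae_compProd h1

theorem ae_mem (Φ : FiberSystem L S) (h : IsSectionDisintegration lam S nu kappa) :
    ∀ᵐ x' ∂nu, x' ∈ S := by
  obtain ⟨⟨m, hm, hac, -, rfl⟩, -, -⟩ := h
  have hS := Φ.measurableSet
  refine (ae_map_iff measurable_snd.aemeasurable hS).2 (hac.ae_le ?_)
  have hSm : MeasurableSet (Prod.snd ⁻¹' Sᶜ : Set (L × X)) := measurable_snd hS.compl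
  change sectionLift L lam S (Prod.snd ⁻¹' Sᶜ) = 0
  rw [Φ.sectionLift_eq, Measure.bind_apply hSm Φ.fiber.aemeasurable]
  refine (lintegral_congr fun x => ?_).trans lintegral_zero
  exact measure_eq_zero_iff_ae_notMem.2 ((Φ.ae_fiber_iff x).2 fun p hp _ => by simpa using hp)

theorem ae_compact_ne_top [IsFiniteMeasure lam] (Φ : FiberSystem L S)
    (h : IsSectionDisintegration lam S nu kappa) {C : Set L} (hC : IsCompact C) :
    ∀ᵐ x' ∂nu, kappa x' C ≠ ∞ := by
  have hF : Measurable ((C ×ˢ (Set.univ : Set X)).indicator (1 : L × X → ℝ≥0∞)) :=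
    measurable_one.indicator (hC.measurableSet.prod MeasurableSet.univ)
  have h1 := h.lintegral_eq Φ hF
  obtain ⟨n, hn⟩ := Φ.compact_bound C hC
  have h2 : ∀ x', ∫⁻ g, (C ×ˢ (Set.univ : Set X)).indicator (1 : L × X → ℝ≥0∞) (g, x')
      ∂(kappa x') = kappa x' C := by
    intro x'
    rw [← lintegral_indicator_one hC.measurableSet]
    exact lintegral_congr fun g => by by_cases hg : g ∈ C <;> simp [hg]
  simp only [h2] at h1
  have h3 : ∫⁻ x', kappa x' C ∂nu ≠ ∞ := by
    rw [← h1]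
    refine ne_top_of_le_ne_top (ENNReal.mul_ne_top (ENNReal.natCast_ne_top n)
      (measure_ne_top lam Set.univ)) ?_
    rw [← lintegral_const]
    refine lintegral_mono fun x => ?_
    rw [lintegral_indicator_one (hC.measurableSet.prod MeasurableSet.univ)]
    exact hn x
  filter_upwards [ae_lt_top (kappa.measurable_coe hC.measurableSet) h3] with x hx using hx.ne

theorem ae_ne_zero (h : IsSectionDisintegration lam S nu kappa) : ∀ᵐ x' ∂nu, kappa x' ≠ 0 := by
  have := h.isFiniteMeasure
  have := h.isSFiniteKernel
  set N : Set X := {x' | kappa x' Set.univ = 0} with hN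
  have hNm : MeasurableSet N := (kappa.measurable_coe MeasurableSet.univ) (measurableSet_singleton 0)
  have hlift : sectionLift L lam S (Prod.snd ⁻¹' N) = 0 := by
    rw [h.2.2, Measure.map_apply measurable_swap (measurable_snd hNm),
      Measure.compProd_apply (measurable_swap (measurable_snd hNm))]
    refine (lintegral_congr fun x => ?_).trans lintegral_zero
    by_cases hx : kappa x Set.univ = 0
    · exact measure_mono_null (Set.subset_univ _) hx
    · have : Prod.mk x ⁻¹' (Prod.swap ⁻¹' (Prod.snd ⁻¹' N : Set (L × X))) = ∅ := by
        ext g; simpa [hN] using hx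
      rw [this, measure_empty]
  have h0 : nu N = 0 := by
    obtain ⟨⟨m, hm, hac, -, rfl⟩, -, -⟩ := h
    rw [Measure.map_apply measurable_snd hNm]
    exact hac hlift
  filter_upwards [measure_eq_zero_iff_ae_notMem.1 h0] with x hx hx0
  exact hx (by simp [hN, hx0])

end IsSectionDisintegration

/-- The lift of `lam` to a complete lacunary section can be disintegrated. -/
theorem exists_isSectionDisintegration {S : Set X} (Φ : FiberSystem L S) (lam : Measure X)
    [IsFiniteMeasure lam] :
    ∃ (nu : Measure X) (kappa : Kernel X L), IsSectionDisintegration lam S nu kappa := by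
  have hwm : Measurable fun p : L × X => Φ.weight p.1 := Φ.measurable_weight.comp measurable_fst
  -- the weight makes the lift finite; its conditional measures are then divided by the weight
  set m := (sectionLift L lam S).withDensity fun p => Φ.weight p.1 with hm
  have hfin : IsFiniteMeasure m := by
    refine isFiniteMeasure_withDensity ?_
    rw [Φ.lintegral_sectionLift lam hwm]
    refine ne_top_of_le_ne_top (ENNReal.mul_ne_top (a := 2) (by simp)
      (measure_ne_top lam Set.univ)) ?_
    rw [← lintegral_const]
    exact lintegral_mono fun x => Φ.lintegral_weight_le x
  let m' : Measure (X × L) := m.map Prod.swap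
  have hfst : m'.fst = m.map Prod.snd := by
    rw [Measure.fst, Measure.map_map measurable_fst measurable_swap]; rfl
  have hdis : m'.fst ⊗ₘ m'.condKernel = m' := m'.disintegrate m'.condKernel
  let ω : X → L → ℝ≥0∞ := fun _ g => (Φ.weight g)⁻¹
  have hωm : Measurable (Function.uncurry ω) := (Φ.measurable_weight.comp measurable_snd).inv
  have hω : ∀ x g, ω x g ≠ ∞ := fun x g => ENNReal.inv_ne_top.2 (Φ.weight_pos g).1
  have hsf : IsSFiniteKernel (m'.condKernel.withDensity ω) :=
    Kernel.IsSFiniteKernel.withDensity _ hω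
  refine ⟨m'.fst, m'.condKernel.withDensity ω, ⟨m, hfin, withDensity_absolutelyContinuous _ _,
    withDensity_absolutelyContinuous' hwm.aemeasurable
      (Eventually.of_forall fun p => (Φ.weight_pos p.1).1), hfst⟩, hsf, ?_⟩
  refine Measure.ext_of_lintegral _ fun F hF => ?_
  rw [lintegral_map hF measurable_swap, Measure.lintegral_compProd (f := fun q : X × L => F q.swap)
    (hF.comp measurable_swap)]
  have e1 : ∀ x, ∫⁻ g, F (Prod.swap (x, g)) ∂(m'.condKernel.withDensity ω x) =
      ∫⁻ g, ω x g * F (g, x) ∂(m'.condKernel x) := fun x =>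
    Kernel.lintegral_withDensity _ hωm x (hF.comp measurable_prodMk_right)
  have hG : Measurable fun q : X × L => ω q.1 q.2 * F (q.2, q.1) :=
    hωm.mul (hF.comp measurable_swap)
  simp only [e1]
  rw [← Measure.lintegral_compProd (f := fun q : X × L => ω q.1 q.2 * F (q.2, q.1)) hG, hdis,
    lintegral_map hG measurable_swap, hm]
  simp only [Prod.fst_swap, Prod.snd_swap, Prod.mk.eta, ω]
  have hG' : Measurable fun p : L × X => (Φ.weight p.1)⁻¹ * F p := hwm.inv.mul hF
  rw [lintegral_withDensity_eq_lintegral_mul _ hwm hG']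
  refine lintegral_congr fun p => ?_
  simp only [Pi.mul_apply]
  rw [← mul_assoc, ENNReal.mul_inv_cancel (Φ.weight_pos _).1 (Φ.weight_pos _).2, one_mul]

end Disintegrations

section MeasureFamilies

theorem measurable_kernel_map {Z Y Y' : Type*} [MeasurableSpace Z] [MeasurableSpace Y]
    [MeasurableSpace Y'] (κ : Kernel Z Y) [IsSFiniteKernel κ] {f : Z → Y → Y'}
    (hf : Measurable (Function.uncurry f)) : Measurable fun z => (κ z).map (f z) := by
  refine Measure.measurable_of_measurable_coe _ fun E hE => ?_
  have e : ∀ z, (κ z).map (f z) E = κ z (Prod.mk z ⁻¹' (Function.uncurry f ⁻¹' E)) := fun z =>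
    Measure.map_apply (hf.comp measurable_prodMk_left) hE
  simp only [e]
  exact Kernel.measurable_kernel_prodMk_left (hf hE)

theorem ae_compProd_of_ae_fst {Z Y : Type*} [MeasurableSpace Z] [MeasurableSpace Y] {μ : Measure Z}
    [SFinite μ] (κ : Kernel Z Y) [IsSFiniteKernel κ] {P : Z → Prop} (h : ∀ᵐ z ∂μ, P z) :
    ∀ᵐ p ∂(μ ⊗ₘ κ), P p.1 := by
  obtain ⟨N, hN, hNm, hN0⟩ := exists_measurable_superset_of_null (ae_iff.1 h)
  rw [ae_iff]
  refine measure_mono_null (t := Prod.fst ⁻¹' N) (fun p hp => hN hp) ?_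
  rw [Measure.compProd_apply (measurable_fst hNm)]
  refine lintegral_eq_zero_of_ae_eq_zero ?_
  filter_upwards [measure_eq_zero_iff_ae_notMem.1 hN0] with z hz
  have : Prod.mk z ⁻¹' (Prod.fst ⁻¹' N : Set (Z × Y)) = ∅ := by ext y; simpa using hz
  rw [this, measure_empty]
  rfl

end MeasureFamilies

section Disintegrations

variable {L X : Type*} [Group L] [TopologicalSpace L] [IsTopologicalGroup L] [PolishSpace L]
  [MeasurableSpace L] [BorelSpace L]
  [MeasurableSpace X] [StandardBorelSpace X] [MulAction L X] [MeasurableSMul₂ L X]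
  {lam : Measure X} [IsFiniteMeasure lam]

/-- A nonzero measure that is finite on compact sets. -/
def IsRegularNonzero (μ : Measure L) : Prop := μ ≠ 0 ∧ ∀ C : Set L, IsCompact C → μ C ≠ ∞

theorem IsRegularNonzero.map_mul_right {μ : Measure L} (h : IsRegularNonzero μ) (g : L) :
    IsRegularNonzero (μ.map fun k => k * g) := by
  refine ⟨fun h0 => h.1 ?_, fun C hC => ?_⟩
  · rwa [Measure.map_eq_zero_iff (measurable_mul_const g).aemeasurable] at h0
  · rw [Measure.map_apply (measurable_mul_const g) hC.measurableSet]
    exact h.2 _ ((Homeomorph.mulRight g).isCompact_preimage.2 hC)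

variable [LocallyCompactSpace L]

theorem isRegularNonzero_iff (μ : Measure L) :
    IsRegularNonzero μ ↔ μ ≠ 0 ∧ ∀ i, μ ((default : CompactExhaustion L) i) ≠ ∞ := by
  refine and_congr_right fun _ => ⟨fun h i => h _ (CompactExhaustion.isCompact _ i), fun h C hC => ?_⟩
  obtain ⟨n, hn⟩ := (default : CompactExhaustion L).exists_superset_of_isCompact hC
  exact ne_top_of_le_ne_top (h n) (measure_mono hn)

theorem IsRegularNonzero.isLocallyFiniteMeasure {μ : Measure L} (h : IsRegularNonzero μ) :
    IsLocallyFiniteMeasure μ := by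
  refine ⟨fun x => ?_⟩
  obtain ⟨C, hC, hCn⟩ := exists_compact_mem_nhds x
  exact ⟨C, hCn, (h.2 C hC).lt_top⟩

theorem isRegularNonzero_of_isLocallyFiniteMeasure {μ : Measure L} [IsLocallyFiniteMeasure μ]
    (h : μ ≠ 0) : IsRegularNonzero μ := ⟨h, fun _ hC => hC.measure_lt_top.ne⟩

theorem IsSectionDisintegration.ae_isRegularNonzero {S : Set X} {nu : Measure X}
    {kappa : Kernel X L} (Φ : FiberSystem L S) (h : IsSectionDisintegration lam S nu kappa) :
    ∀ᵐ x' ∂nu, IsRegularNonzero (kappa x') := by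
  have : ∀ᵐ x' ∂nu, ∀ i, kappa x' ((default : CompactExhaustion L) i) ≠ ∞ :=
    ae_all_iff.2 fun i => h.ae_compact_ne_top Φ (CompactExhaustion.isCompact _ i)
  filter_upwards [this, h.ae_ne_zero] with x' h1 h2
  exact (isRegularNonzero_iff _).2 ⟨h2, h1⟩

/-- Integration over the pairs of points of the fibers of two sections. -/
theorem IsSectionDisintegration.lintegral_fiber_fiber {S₁ S₂ : Set X} (Φ₁ : FiberSystem L S₁)
    (Φ₂ : FiberSystem L S₂) {nu : Measure X} {kappa : Kernel X L}
    (h : IsSectionDisintegration lam S₁ nu kappa) {R : (L × X) × (L × X) → ℝ≥0∞}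
    (hR : Measurable R) :
    ∫⁻ x, ∫⁻ p, ∫⁻ p', R (p, p') ∂(Φ₂.fiber x) ∂(Φ₁.fiber x) ∂lam =
      ∫⁻ x', ∫⁻ q, ∫⁻ g, R ((g, x'), (g * q.1, q.2)) ∂(kappa x') ∂(Φ₂.fiber x') ∂nu := by
  have := h.isFiniteMeasure
  have := h.isSFiniteKernel
  have hH : Measurable fun p : L × X => ∫⁻ q, R (p, (p.1 * q.1, q.2)) ∂(Φ₂.fiber p.2) := by
    let κ' : Kernel (L × X) (L × X) := Φ₂.fiber.comap Prod.snd measurable_snd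
    exact Measurable.lintegral_kernel_prod_right' (κ := κ')
      (f := fun z : (L × X) × (L × X) => R (z.1, (z.1.1 * z.2.1, z.2.2)))
      (hR.comp (by fun_prop))
  have e1 : ∫⁻ x, ∫⁻ p, ∫⁻ p', R (p, p') ∂(Φ₂.fiber x) ∂(Φ₁.fiber x) ∂lam =
      ∫⁻ x, ∫⁻ p, ∫⁻ q, R (p, (p.1 * q.1, q.2)) ∂(Φ₂.fiber p.2) ∂(Φ₁.fiber x) ∂lam := by
    refine lintegral_congr fun x => lintegral_congr_ae ((Φ₁.ae_fiber_iff x).2 fun p _ hp => ?_)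
    subst hp
    exact Φ₂.lintegral_fiber_smul (f := fun p' => R (p, p')) _ _ (hR.comp measurable_prodMk_left)
  rw [e1, h.lintegral_eq Φ₁ hH]
  refine lintegral_congr fun x' => ?_
  rw [lintegral_lintegral_swap]
  exact (hR.comp (by fun_prop)).aemeasurable

/-- The conditional measures on two sections are proportional, up to the right translations that
identify the points of these sections lying on the same orbit. -/
theorem IsSectionDisintegration.ae_sameClass {S₁ S₂ : Set X} (Φ₁ : FiberSystem L S₁)
    (Φ₂ : FiberSystem L S₂) {nu₁ nu₂ : Measure X} {kappa₁ kappa₂ : Kernel X L}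
    (h₁ : IsSectionDisintegration lam S₁ nu₁ kappa₁)
    (h₂ : IsSectionDisintegration lam S₂ nu₂ kappa₂) :
    ∀ᵐ x₁ ∂nu₁, ∀ p : L × X, p.2 ∈ S₂ → p.1 • p.2 = x₁ →
      SameClass (kappa₁ x₁) ((kappa₂ p.2).map fun g => g * p.1⁻¹) := by
  have := h₁.isFiniteMeasure
  have := h₁.isSFiniteKernel
  have := h₂.isFiniteMeasure
  have := h₂.isSFiniteKernel
  -- the weight makes the measures on the pairs of points of the two sections finite
  let w : X × (L × X) → ℝ≥0∞ := fun z => Φ₂.weight z.2.1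
  have hw : Measurable w := Φ₂.measurable_weight.comp (measurable_fst.comp measurable_snd)
  -- A point `x₁` of `S₁` and a point `(g, x₂)` of the fiber of `S₂` over `x₁` are exchanged.
  let τ : X × (L × X) ≃ᵐ X × (L × X) :=
    { toFun := fun z => (z.2.2, (z.2.1⁻¹, z.1))
      invFun := fun z => (z.2.2, (z.2.1⁻¹, z.1))
      left_inv := fun z => by simp
      right_inv := fun z => by simp
      measurable_toFun := by simp only [Equiv.coe_fn_mk]; fun_prop
      measurable_invFun := by simp only [Equiv.coe_fn_symm_mk]; fun_prop }
  have hτ : ∀ z, τ z = (z.2.2, (z.2.1⁻¹, z.1)) := fun z => rfl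
  set β₁ := (nu₁ ⊗ₘ Φ₂.fiber).withDensity w with hβ₁
  set β₂ := ((nu₂ ⊗ₘ Φ₁.fiber).map τ).withDensity w with hβ₂
  have hfin : IsFiniteMeasure β₁ := by
    refine isFiniteMeasure_withDensity ?_
    rw [Measure.lintegral_compProd hw]
    refine ne_top_of_le_ne_top (ENNReal.mul_ne_top (a := 2) (by simp)
      (measure_ne_top nu₁ Set.univ)) ?_
    rw [← lintegral_const]
    exact lintegral_mono fun x => Φ₂.lintegral_weight_le x
  let K₁ : Kernel (X × (L × X)) L := kappa₁.comap Prod.fst measurable_fst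
  let κ₂ : Kernel (X × (L × X)) L := kappa₂.comap (fun z => z.2.2) (by fun_prop)
  let K₂ : Kernel (X × (L × X)) L := ⟨fun z => (κ₂ z).map fun g => g * z.2.1⁻¹,
    measurable_kernel_map κ₂ (f := fun z g => g * z.2.1⁻¹)
      (by simp only [Function.uncurry_def]; fun_prop)⟩
  have hK₁ : ∀ z, K₁ z = kappa₁ z.1 := fun z => rfl
  have hK₂ : ∀ z, K₂ z = (kappa₂ z.2.2).map fun g => g * z.2.1⁻¹ := fun z => rfl
  -- `K₁` and `K₂` disintegrate the same measure, the distribution of `x` seen from both sections: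
  -- `l1` and `l2` express its integrals by pairs of points of the fibers over `x`.
  have main : ∀ᵐ z ∂β₁, SameClass (K₁ z) (K₂ z) := by
    refine ae_sameClass_of_lintegral_eq (β₂ := β₂) (C := (default : CompactExhaustion L))
      (fun i => (CompactExhaustion.isCompact _ i).measurableSet)
      (fun i j hij => CompactExhaustion.subset _ hij)
      (CompactExhaustion.iUnion_eq _) ?_ ?_ ?_
    · intro F hF
      have hFz : ∀ z, Measurable fun g => F (z, g) := fun z => hF.comp measurable_prodMk_left
      let R : (L × X) × (L × X) → ℝ≥0∞ := fun r =>
        w (r.1.2, (r.1.1⁻¹ * r.2.1, r.2.2)) * F ((r.1.2, (r.1.1⁻¹ * r.2.1, r.2.2)), r.1.1)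
      have hR : Measurable R :=
        (hw.comp (by fun_prop)).mul (hF.comp (by fun_prop))
      have hG₁ : Measurable fun z => ∫⁻ g, F (z, g) ∂(K₁ z) := hF.lintegral_kernel_prod_right'
      have hK₂s : Measurable fun z => ∫⁻ g, F (z, g) ∂(K₂ z) := by
        have e : ∀ z : X × (L × X), ∫⁻ g, F (z, g) ∂(K₂ z) = ∫⁻ g, F (z, g * z.2.1⁻¹) ∂(κ₂ z) :=
          fun z => lintegral_map (hFz z) (measurable_mul_const _)
        simp only [e]
        exact Measurable.lintegral_kernel_prod_right'
          (f := fun q : (X × (L × X)) × L => F (q.1, q.2 * q.1.2.1⁻¹)) (hF.comp (by fun_prop))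
      rw [hβ₁, lintegral_withDensity_eq_lintegral_mul _ hw hG₁,
        Measure.lintegral_compProd (hw.mul hG₁), hβ₂,
        lintegral_withDensity_eq_lintegral_mul _ hw hK₂s, lintegral_map_equiv,
        Measure.lintegral_compProd (f := fun a => (w * fun z => ∫⁻ g, F (z, g) ∂(K₂ z)) (τ a))
          ((hw.mul hK₂s).comp τ.measurable)]
      have l1 : ∫⁻ x', ∫⁻ q, (w * fun z => ∫⁻ g, F (z, g) ∂(K₁ z)) (x', q) ∂(Φ₂.fiber x') ∂nu₁ =
          ∫⁻ x, ∫⁻ p, ∫⁻ p', R (p, p') ∂(Φ₂.fiber x) ∂(Φ₁.fiber x) ∂lam := by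
        rw [h₁.lintegral_fiber_fiber Φ₁ Φ₂ hR]
        refine lintegral_congr fun x' => lintegral_congr fun q => ?_
        simp only [Pi.mul_apply, R, inv_mul_cancel_left, hK₁]
        rw [lintegral_const_mul _ (hFz _)]
      have l2 : ∫⁻ x', ∫⁻ q, ((w * fun z => ∫⁻ g, F (z, g) ∂(K₂ z)) ∘ τ) (x', q)
            ∂(Φ₁.fiber x') ∂nu₂ =
          ∫⁻ x, ∫⁻ p', ∫⁻ p, R (p, p') ∂(Φ₁.fiber x) ∂(Φ₂.fiber x) ∂lam := by
        rw [h₂.lintegral_fiber_fiber Φ₂ Φ₁ (R := fun r => R (r.2, r.1)) (hR.comp measurable_swap)]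
        refine lintegral_congr fun x' => lintegral_congr fun q => ?_
        simp only [Function.comp_apply, Pi.mul_apply, R, hτ, hK₂]
        rw [lintegral_map (hFz _) (measurable_mul_const _)]
        simp only [inv_inv, mul_inv_rev, inv_mul_cancel_right]
        exact (lintegral_const_mul _ ((hFz (q.2, (q.1⁻¹, x'))).comp (measurable_mul_const q.1))).symm
      change ∫⁻ x', ∫⁻ q, (w * fun z => ∫⁻ g, F (z, g) ∂(K₁ z)) (x', q) ∂(Φ₂.fiber x') ∂nu₁ =
        ∫⁻ x', ∫⁻ q, ((w * fun z => ∫⁻ g, F (z, g) ∂(K₂ z)) ∘ τ) (x', q) ∂(Φ₁.fiber x') ∂nu₂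
      rw [l1, l2]
      refine lintegral_congr fun x => ?_
      exact lintegral_lintegral_swap hR.aemeasurable
    · refine (withDensity_absolutelyContinuous _ _).ae_le ?_
      filter_upwards [ae_compProd_of_ae_fst Φ₂.fiber (h₁.ae_isRegularNonzero Φ₁)] with z hz
      exact (isRegularNonzero_iff _).1 hz
    · refine (withDensity_absolutelyContinuous _ _).ae_le ?_
      refine τ.measurableEmbedding.ae_map_iff.2 ?_
      filter_upwards [ae_compProd_of_ae_fst Φ₁.fiber (h₂.ae_isRegularNonzero Φ₂)] with z hz
      rw [hK₂]
      exact (isRegularNonzero_iff _).1 (hz.map_mul_right _)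
  have main' : ∀ᵐ z ∂(nu₁ ⊗ₘ Φ₂.fiber), SameClass (K₁ z) (K₂ z) :=
    (withDensity_absolutelyContinuous' hw.aemeasurable
      (Eventually.of_forall fun z => (Φ₂.weight_pos z.2.1).1)).ae_le main
  filter_upwards [Measure.ae_ae_of_ae_compProd main'] with x₁ hx₁
  exact (Φ₂.ae_fiber_iff x₁).1 hx₁

/-- There is a Borel choice of a point in each fiber. -/
theorem FiberSystem.exists_measurable_selection {S : Set X} (Φ : FiberSystem L S) :
    ∃ s : X → L × X, Measurable s ∧ ∀ x, (s x).2 ∈ S ∧ (s x).1 • (s x).2 = x := by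
  let a : L × X → X := fun p => p.1 • p.2
  have ha : Measurable a := measurable_fst.smul measurable_snd
  let D : ℕ → Set (L × X) := fun i => Φ.P i ×ˢ S
  have hD : ∀ i, MeasurableSet (D i) := fun i => (Φ.measurable_P i).prod Φ.measurableSet
  have hainj : ∀ i, Set.InjOn a (D i) := fun i p hp q hq heq =>
    Φ.injOn i p q hp.1 hq.1 hp.2 hq.2 heq
  have haD : ∀ i, MeasurableSet (a '' D i) := fun i =>
    (hD i).image_of_measurable_injOn ha (hainj i)
  -- the points of the fibers lying in the first piece that meets their fiber
  let E : Set (L × X) := ⋃ i, D i ∩ a ⁻¹' (disjointed (fun j => a '' D j) i)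
  have hE : MeasurableSet E := MeasurableSet.iUnion fun i =>
    (hD i).inter (ha (MeasurableSet.disjointed haD i))
  have hEinj : Set.InjOn a E := by
    intro p hp q hq heq
    obtain ⟨i, hi, hi'⟩ := Set.mem_iUnion.1 hp
    obtain ⟨j, hj, hj'⟩ := Set.mem_iUnion.1 hq
    have hij : i = j := by
      by_contra hne
      refine Set.disjoint_left.1 (disjoint_disjointed (fun j => a '' D j) hne) hi' ?_
      rw [heq]; exact hj'
    subst hij
    exact hainj i hi hj heq
  have hsurj : ∀ x, ∃ p ∈ E, a p = x := by
    intro x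
    have : x ∈ ⋃ i, disjointed (fun j => a '' D j) i := by
      rw [iUnion_disjointed]
      obtain ⟨p, hp, hpx⟩ := Φ.complete x
      have : p.1 ∈ ⋃ i, Φ.P i := by rw [Φ.iUnion_P]; trivial
      obtain ⟨i, hi⟩ := Set.mem_iUnion.1 this
      exact Set.mem_iUnion.2 ⟨i, p, ⟨hi, hp⟩, hpx⟩
    obtain ⟨i, hi⟩ := Set.mem_iUnion.1 this
    obtain ⟨p, hp, hpx⟩ := disjointed_subset _ i hi
    refine ⟨p, Set.mem_iUnion.2 ⟨i, hp, ?_⟩, hpx⟩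
    exact Set.mem_preimage.2 (by rwa [hpx])
  choose s hsE hs using hsurj
  refine ⟨s, fun t ht => ?_, fun x => ⟨?_, hs x⟩⟩
  · have : s ⁻¹' t = a '' (E ∩ t) := by
      ext x
      constructor
      · intro hx
        exact ⟨s x, ⟨hsE x, hx⟩, hs x⟩
      · rintro ⟨p, ⟨hp, hpt⟩, hpx⟩
        have : s x = p := hEinj (hsE x) hp ((hs x).trans hpx.symm)
        change s x ∈ t
        rwa [this]
    rw [this]
    exact (hE.inter ht).image_of_measurable_injOn ha (hEinj.mono Set.inter_subset_left)
  · obtain ⟨i, hi, -⟩ := Set.mem_iUnion.1 (hsE x)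
    exact hi.2

/-- A finite measure admits a disintegration along a group acting with uniformly discrete
stabilizers. -/
theorem exists_isDisintegration (hdisc : HasUniformlyDiscreteStabilizers L X) (lam : Measure X)
    [IsFiniteMeasure lam] : ∃ σ : X → Measure L, IsDisintegration lam σ := by
  classical
  obtain ⟨S₀, hS₀⟩ := exists_isCompleteLacunarySection hdisc
  obtain ⟨Φ₀⟩ := exists_fiberSystem hdisc hS₀
  obtain ⟨nu₀, kappa₀, h₀⟩ := exists_isSectionDisintegration Φ₀ lam
  have := h₀.isSFiniteKernel
  obtain ⟨s, hsm, hs⟩ := Φ₀.exists_measurable_selection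
  let A : Set X := {x | IsRegularNonzero (kappa₀ (s x).2)}
  have hB : MeasurableSet {x' | IsRegularNonzero (kappa₀ x')} := by
    have : {x' | IsRegularNonzero (kappa₀ x')} = {x' | kappa₀ x' Set.univ = 0}ᶜ ∩
        ⋂ i, {x' | kappa₀ x' ((default : CompactExhaustion L) i) = ∞}ᶜ := by
      ext x'
      simp [isRegularNonzero_iff, Measure.measure_univ_eq_zero]
    rw [this]
    exact ((kappa₀.measurable_coe MeasurableSet.univ) (measurableSet_singleton 0)).compl.inter
      (MeasurableSet.iInter fun i => ((kappa₀.measurable_coe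
        (CompactExhaustion.isCompact _ i).measurableSet) (measurableSet_singleton ∞)).compl)
  have hA : MeasurableSet A := (measurable_snd.comp hsm) hB
  -- The conditional measure of the selected point of the section, translated to `x`. The Dirac mass,
  -- used on a null set, only serves to have a nonzero Radon measure at every point.
  let τ : X → Measure L := fun x => (kappa₀ (s x).2).map fun g => g * (s x).1⁻¹
  have hτ : Measurable τ := by
    have : IsSFiniteKernel (kappa₀.comap (fun x => (s x).2) (measurable_snd.comp hsm)) :=
      inferInstance
    refine measurable_kernel_map (kappa₀.comap (fun x => (s x).2) (measurable_snd.comp hsm))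
      (f := fun x g => g * (s x).1⁻¹) ?_
    exact measurable_snd.mul (measurable_fst.comp (hsm.comp measurable_fst)).inv
  let σ : X → Measure L := fun x => if x ∈ A then τ x else Measure.dirac 1
  have hreg : ∀ x, IsRegularNonzero (σ x) := by
    intro x
    by_cases hx : x ∈ A
    · simp only [σ, if_pos hx]
      exact IsRegularNonzero.map_mul_right hx _
    · simp only [σ, if_neg hx]
      exact ⟨NeZero.ne _, fun C hC => measure_ne_top _ _⟩
  refine ⟨σ, hτ.ite hA measurable_const, fun x => (hreg x).isLocallyFiniteMeasure,
    fun x => (hreg x).1, ?_⟩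
  intro S hS nu kappa h
  obtain ⟨Φ⟩ := exists_fiberSystem hdisc hS
  have h1 := Φ₀.ae_of_ae_sectionLift (h₀.ae_sectionLift_of_ae (h₀.ae_sameClass Φ₀ Φ h))
  have h2 := Φ₀.ae_of_ae_sectionLift (h₀.ae_sectionLift_of_ae (h₀.ae_isRegularNonzero Φ₀))
  refine ⟨{x | (∀ p : L × X, p.2 ∈ S₀ → p.1 • p.2 = x → ∀ q : L × X, q.2 ∈ S → q.1 • q.2 = p.2 →
    SameClass (kappa₀ p.2) ((kappa q.2).map fun g => g * q.1⁻¹)) ∧ x ∈ A}, ?_, ?_⟩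
  · filter_upwards [h1, h2] with x hx1 hx2
    exact ⟨hx1, hx2 (s x) (hs x).1 (hs x).2⟩
  · filter_upwards [h.ae_mem Φ] with x' hx' g hg
    obtain ⟨hg1, hg2⟩ := hg
    simp only [σ, if_pos hg2]
    have hsx := hs (g • x')
    have h3 := hg1 (s (g • x')) hsx.1 hsx.2 ((s (g • x')).1⁻¹ * g, x') hx'
      (by rw [mul_smul, inv_smul_eq_iff]; exact hsx.2.symm)
    have h4 := h3.map fun k => k * (s (g • x')).1⁻¹
    rw [Measure.map_map (measurable_mul_const _) (measurable_mul_const _)] at h4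
    convert h4 using 2
    funext k
    simp [mul_assoc]

end Disintegrations

/-! ### The mass transport formula -/

theorem exists_measurable_core {X : Type*} [MeasurableSpace X] {lam : Measure X} {P : X → Prop}
    (h : ∀ᵐ x ∂lam, P x) : ∃ A, MeasurableSet A ∧ (∀ᵐ x ∂lam, x ∈ A) ∧ ∀ x ∈ A, P x := by
  obtain ⟨N, hN, hNm, hN0⟩ := exists_measurable_superset_of_null (ae_iff.1 h)
  refine ⟨Nᶜ, hNm.compl, measure_eq_zero_iff_ae_notMem.1 hN0, fun x hx => ?_⟩
  by_contra hP
  exact hx (hN hP)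

section

variable {L X : Type*} [Group L] [TopologicalSpace L] [IsTopologicalGroup L] [PolishSpace L]
  [MeasurableSpace L] [BorelSpace L] [LocallyCompactSpace L]
  [MeasurableSpace X] [StandardBorelSpace X] [MulAction L X] [MeasurableSMul₂ L X]
  {lam : Measure X} [IsFiniteMeasure lam]

/-- A kernel of Radon measures is a countable sum of finite kernels. -/
theorem isSFiniteKernel_of_isRegularNonzero (κ : Kernel X L) (h : ∀ x, IsRegularNonzero (κ x)) :
    IsSFiniteKernel κ := by
  let C : ℕ → Set L := fun i => (default : CompactExhaustion L) i
  have hCm : ∀ i, MeasurableSet (C i) := fun i => (CompactExhaustion.isCompact _ i).measurableSet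
  have hlev : ∀ i n, MeasurableSet ((fun x => ⌊(κ x (C i)).toNNReal⌋₊) ⁻¹' {n}) := fun i n =>
    (Nat.measurable_floor.comp (κ.measurable_coe (hCm i)).ennreal_toNNReal)
      (measurableSet_singleton n)
  have hdm : ∀ i, MeasurableSet (disjointed C i) := MeasurableSet.disjointed hCm
  classical
  -- cut along a compact exhaustion and along the level sets of the masses of its compact sets
  let ρ : ℕ × ℕ → Kernel X L := fun p =>
    Kernel.piecewise (hlev p.1 p.2) (κ.restrict (hdm p.1)) 0
  have hρ : ∀ p x E, MeasurableSet E → ρ p x E =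
      if ⌊(κ x (C p.1)).toNNReal⌋₊ = p.2 then κ x (E ∩ disjointed C p.1) else 0 := by
    intro p x E hE
    simp only [ρ, Kernel.piecewise_apply']
    split_ifs with h1 h2 h2
    · rw [Kernel.restrict_apply' _ _ _ hE]
    · exact absurd h1 h2
    · exact absurd h2 h1
    · rfl
  have hfin : ∀ p, IsFiniteKernel (ρ p) := fun p => ⟨p.2 + 1, by simp, fun x => by
    rw [hρ _ _ _ MeasurableSet.univ]
    split_ifs with h1
    · have h2 : κ x (C p.1) ≠ ∞ := (h x).2 _ (CompactExhaustion.isCompact _ _)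
      calc κ x (Set.univ ∩ disjointed C p.1) ≤ κ x (C p.1) :=
            measure_mono (Set.inter_subset_right.trans (disjointed_subset _ _))
        _ = ((κ x (C p.1)).toNNReal : ℝ≥0∞) := (ENNReal.coe_toNNReal h2).symm
        _ ≤ p.2 + 1 := by
            have := (Nat.lt_floor_add_one (κ x (C p.1)).toNNReal).le
            rw [h1] at this
            exact_mod_cast this
    · exact zero_le⟩
  have hsum : κ = Kernel.sum ρ := by
    ext x E hE
    rw [Kernel.sum_apply' _ _ hE, ENNReal.tsum_prod']
    have : ∀ i, ∑' n, ρ (i, n) x E = κ x (E ∩ disjointed C i) := by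
      intro i
      rw [tsum_eq_single ⌊(κ x (C i)).toNNReal⌋₊]
      · rw [hρ _ _ _ hE, if_pos rfl]
      · intro n hn
        rw [hρ _ _ _ hE, if_neg hn.symm]
    simp only [this]
    rw [← measure_iUnion]
    · rw [← Set.inter_iUnion, iUnion_disjointed, CompactExhaustion.iUnion_eq, Set.inter_univ]
    · exact fun i j hij => (disjoint_disjointed C hij).mono Set.inter_subset_right
        Set.inter_subset_right
    · exact fun i => hE.inter (hdm i)
  rw [hsum]
  infer_instance

/-- The disintegration as a kernel. -/
noncomputable def IsDisintegration.kernel {σ : X → Measure L} (hσ : IsDisintegration lam σ) :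
    Kernel X L := ⟨σ, hσ.measurable⟩

namespace IsDisintegration

variable {σ : X → Measure L} (hσ : IsDisintegration lam σ)

theorem isRegularNonzero (hσ : IsDisintegration lam σ) (x : X) : IsRegularNonzero (σ x) :=
  have := hσ.locallyFinite x
  isRegularNonzero_of_isLocallyFiniteMeasure (hσ.ne_zero x)

instance : IsSFiniteKernel hσ.kernel :=
  isSFiniteKernel_of_isRegularNonzero _ hσ.isRegularNonzero

theorem ae_sameClass_section (hσ : IsDisintegration lam σ) {S : Set X}
    (hS : IsCompleteLacunarySection L S) (Φ : FiberSystem L S) {nu : Measure X} {kappa : Kernel X L}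
    (h : IsSectionDisintegration lam S nu kappa) :
    ∀ᵐ x ∂lam, ∀ p : L × X, p.2 ∈ S → p.1 • p.2 = x →
      SameClass (σ x) ((kappa p.2).map fun g => g * p.1⁻¹) := by
  obtain ⟨X', hX', hc⟩ := hσ.compat S hS nu kappa h
  filter_upwards [hX', Φ.ae_of_ae_sectionLift (h.ae_sectionLift_of_ae hc)] with x hx hx' p hp hpx
  have := hx' p hp hpx p.1 (by rwa [hpx])
  rwa [hpx] at this

/-- Two disintegrations of the same measure are almost surely proportional. -/
theorem ae_sameClass (hdisc : HasUniformlyDiscreteStabilizers L X) {σ' : X → Measure L}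
    (hσ : IsDisintegration lam σ) (hσ' : IsDisintegration lam σ') :
    ∀ᵐ x ∂lam, SameClass (σ x) (σ' x) := by
  obtain ⟨S, hS⟩ := exists_isCompleteLacunarySection hdisc
  obtain ⟨Φ⟩ := exists_fiberSystem hdisc hS
  obtain ⟨nu, kappa, h⟩ := exists_isSectionDisintegration Φ lam
  filter_upwards [hσ.ae_sameClass_section hS Φ h, hσ'.ae_sameClass_section hS Φ h] with x h1 h2
  obtain ⟨p, hp, hpx⟩ := Φ.complete x
  exact (h1 p hp hpx).trans (h2 p hp hpx).symm

end IsDisintegration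

/-- A kernel from `X` to the group with the properties of a disintegration that are used below:
on the orbits inside a conull set `core`, the measures are translates of one another up to the
factors `cocycle`, their support contains the identity, and the mass transport formula holds. -/
structure MassTransport (lam : Measure X) (κ : Kernel X L) where
  /-- the conull set of good points -/
  core : Set X
  /-- the proportionality factor between the measure of `l • x` and a translate of that of `x` -/
  cocycle : L → X → ℝ≥0∞
  measurableSet_core : MeasurableSet core
  ae_mem_core : ∀ᵐ x ∂lam, x ∈ core
  measurable_cocycle : Measurable (Function.uncurry cocycle)
  regular : ∀ x, IsRegularNonzero (κ x)
  nhds_pos : ∀ x ∈ core, ∀ U ∈ 𝓝 (1 : L), κ x U ≠ 0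
  cocycle_ne : ∀ x ∈ core, ∀ l, l • x ∈ core → cocycle l x ≠ 0 ∧ cocycle l x ≠ ∞
  transl : ∀ x ∈ core, ∀ l, l • x ∈ core → κ (l • x) = cocycle l x • (κ x).map fun k => k * l⁻¹
  lintegral_eq : ∀ u : X × L → ℝ≥0∞, Measurable u →
    ∫⁻ x, ∫⁻ l, u (x, l) ∂(κ x) ∂lam = ∫⁻ y, ∫⁻ l, u (l • y, l⁻¹) * cocycle l y ∂(κ y) ∂lam

/-- Almost every point lies in the support of its conditional measure: after the translation to
`p.1 • p.2`, the support contains the identity. -/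
theorem IsSectionDisintegration.ae_nhds_pos {S : Set X} {nu : Measure X} {kappa : Kernel X L}
    (Φ : FiberSystem L S) (h : IsSectionDisintegration lam S nu kappa) :
    ∀ᵐ x ∂lam, ∀ p : L × X, p.2 ∈ S → p.1 • p.2 = x →
      ∀ U ∈ 𝓝 (1 : L), (kappa p.2).map (fun g => g * p.1⁻¹) U ≠ 0 := by
  obtain ⟨b, hb⟩ := (𝓝 (1 : L)).exists_antitone_basis
  choose V hVb hVo h1V using fun i => mem_nhds_iff.1 (hb.1.mem_of_mem (i := i) trivial)
  have key : ∀ᵐ p ∂(sectionLift L lam S), ∀ i, kappa p.2 ((fun g => g * p.1⁻¹) ⁻¹' V i) ≠ 0 := by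
    have := h.isFiniteMeasure
    have := h.isSFiniteKernel
    have hm : MeasurableSet {q : X × L | ∀ i, kappa q.1 ((fun g => g * q.2⁻¹) ⁻¹' V i) ≠ 0} := by
      have : {q : X × L | ∀ i, kappa q.1 ((fun g => g * q.2⁻¹) ⁻¹' V i) ≠ 0} =
          ⋂ i, {q : X × L | kappa q.1 ((fun g => g * q.2⁻¹) ⁻¹' V i) = 0}ᶜ := by ext q; simp
      rw [this]
      refine MeasurableSet.iInter fun i => MeasurableSet.compl ?_
      let κ' : Kernel (X × L) L := kappa.comap Prod.fst measurable_fst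
      have hE : MeasurableSet {z : (X × L) × L | z.2 * z.1.2⁻¹ ∈ V i} :=
        (show Measurable fun z : (X × L) × L => z.2 * z.1.2⁻¹ by fun_prop) (hVo i).measurableSet
      exact (Kernel.measurable_kernel_prodMk_left (κ := κ') hE) (measurableSet_singleton 0)
    rw [h.2.2]
    refine (ae_map_iff measurable_swap.aemeasurable (measurable_swap hm)).2
      ((Measure.ae_compProd_iff hm).2 ?_)
    refine Eventually.of_forall fun x' => ?_
    filter_upwards [(kappa x').support_mem_ae] with g hg i
    have : (fun k => k * g⁻¹) ⁻¹' V i ∈ 𝓝 g :=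
      (continuous_mul_const g⁻¹).continuousAt.preimage_mem_nhds
        (by rw [mul_inv_cancel]; exact (hVo i).mem_nhds (h1V i))
    exact (Measure.mem_support_iff_forall g).1 hg _ this |>.ne'
  filter_upwards [Φ.ae_of_ae_sectionLift key] with x hx p hp hpx U hU
  obtain ⟨i, -, hi⟩ := hb.1.mem_iff.1 hU
  refine fun h0 => hx p hp hpx i ?_
  rw [← Measure.map_apply (measurable_mul_const _) (hVo i).measurableSet]
  exact measure_mono_null ((hVb i).trans hi) h0

/-- A disintegration satisfies the mass transport formula. Its proof expresses both sides through
the conditional measures on a complete lacunary section, the point of the section being chosen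
randomly on the fiber of `l • x` on the left hand side and on the fiber of `y` on the right. -/
theorem IsDisintegration.nonempty_massTransport (hdisc : HasUniformlyDiscreteStabilizers L X)
    {σ : X → Measure L} (hσ : IsDisintegration lam σ) :
    Nonempty (MassTransport lam hσ.kernel) := by
  obtain ⟨S, hS⟩ := exists_isCompleteLacunarySection hdisc
  obtain ⟨Φ⟩ := exists_fiberSystem hdisc hS
  obtain ⟨nu, kappa, h⟩ := exists_isSectionDisintegration Φ lam
  have := h.isFiniteMeasure
  have := h.isSFiniteKernel
  obtain ⟨K, hK, hK1⟩ := exists_compact_mem_nhds (1 : L)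
  have hKm := hK.measurableSet
  obtain ⟨A, hAm, hA, hAP⟩ := exists_measurable_core
    ((hσ.ae_sameClass_section hS Φ h).and (h.ae_nhds_pos Φ))
  set κ := hσ.kernel with hκ
  have hreg : ∀ x, IsRegularNonzero (κ x) := hσ.isRegularNonzero
  have hcl : ∀ x ∈ A, ∀ p : L × X, p.2 ∈ S → p.1 • p.2 = x →
    SameClass (κ x) ((kappa p.2).map fun g => g * p.1⁻¹) := fun x hx => (hAP x hx).1
  have hnhds : ∀ x ∈ A, ∀ U ∈ 𝓝 (1 : L), κ x U ≠ 0 := by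
    intro x hx U hU
    obtain ⟨p, hp, hpx⟩ := Φ.complete x
    obtain ⟨c, hc, -, hcx⟩ := hcl x hx p hp hpx
    rw [hcx, Measure.smul_apply, smul_eq_mul]
    exact mul_ne_zero hc ((hAP x hx).2 p hp hpx U hU)
  have hKpos : ∀ x ∈ A, κ x K ≠ 0 := fun x hx => hnhds x hx K hK1
  have hKfin : ∀ x, κ x K ≠ ∞ := fun x => (hreg x).2 K hK
  -- the factors are computed from the masses of a compact neighbourhood `K` of the identity
  let c : L → X → ℝ≥0∞ := fun l x => κ (l • x) K / κ x ((fun k => k * l⁻¹) ⁻¹' K)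
  let b : L → X → ℝ≥0∞ := fun g x' => κ (g • x') K / kappa x' ((fun k => k * g⁻¹) ⁻¹' K)
  have hquot : ∀ (κ' : Kernel X L) [IsSFiniteKernel κ'], Measurable (Function.uncurry fun l x =>
      κ (l • x) K / κ' x ((fun k => k * l⁻¹) ⁻¹' K)) := by
    intro κ' _
    have h1 : Measurable fun q : L × X => κ (q.1 • q.2) K :=
      (κ.measurable_coe hKm).comp (measurable_fst.smul measurable_snd)
    let κ'' : Kernel (L × X) L := κ'.comap Prod.snd measurable_snd
    have hE : MeasurableSet {z : (L × X) × L | z.2 * z.1.1⁻¹ ∈ K} :=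
      (show Measurable fun z : (L × X) × L => z.2 * z.1.1⁻¹ by fun_prop) hKm
    exact h1.div (Kernel.measurable_kernel_prodMk_left (κ := κ'') hE)
  have hcm : Measurable (Function.uncurry c) := hquot κ
  have hbm : Measurable (Function.uncurry b) := hquot kappa
  -- evaluating proportional measures at `K` gives the factor
  have hfactor : ∀ (μ ν : Measure L), SameClass μ ν → μ K ≠ 0 → μ K ≠ ∞ →
      ν K ≠ 0 ∧ ν K ≠ ∞ ∧ μ = (μ K / ν K) • ν := by
    rintro μ ν ⟨a, ha0, hat, rfl⟩ h0 ht
    rw [Measure.smul_apply, smul_eq_mul] at h0 ht ⊢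
    have h1 : ν K ≠ 0 := right_ne_zero_of_mul h0
    have h2 : ν K ≠ ∞ := fun h => by rw [h, ENNReal.mul_top ha0] at ht; exact ht rfl
    refine ⟨h1, h2, ?_⟩
    rw [mul_div_assoc, ENNReal.div_self h1 h2, mul_one]
  have hcl2 : ∀ x ∈ A, ∀ l, l • x ∈ A → SameClass (κ (l • x)) ((κ x).map fun k => k * l⁻¹) := by
    intro x hx l hlx
    obtain ⟨p, hp, hpx⟩ := Φ.complete x
    have h1 := hcl x hx p hp hpx
    have h2 := hcl (l • x) hlx (l * p.1, p.2) hp (by rw [mul_smul, hpx])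
    have h3 := h1.map fun k => k * l⁻¹
    rw [Measure.map_map (measurable_mul_const _) (measurable_mul_const _)] at h3
    refine h2.trans (SameClass.symm ?_)
    convert h3 using 2
    funext k
    simp [mul_assoc]
  have hmapK : ∀ (μ : Measure L) (l : L),
      μ.map (fun k => k * l⁻¹) K = μ ((fun k => k * l⁻¹) ⁻¹' K) := fun μ l =>
    Measure.map_apply (measurable_mul_const _) hKm
  have hc : ∀ x ∈ A, ∀ l, l • x ∈ A → (c l x ≠ 0 ∧ c l x ≠ ∞) ∧
      κ (l • x) = c l x • (κ x).map fun k => k * l⁻¹ := by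
    intro x hx l hlx
    obtain ⟨h1, h2, h3⟩ := hfactor _ _ (hcl2 x hx l hlx) (hKpos _ hlx) (hKfin _)
    rw [hmapK] at h1 h2 h3
    exact ⟨⟨ENNReal.div_ne_zero.2 ⟨hKpos _ hlx, h2⟩, ENNReal.div_ne_top (hKfin _) h1⟩, h3⟩
  have hb : ∀ g x', x' ∈ S → g • x' ∈ A → kappa x' ((fun k => k * g⁻¹) ⁻¹' K) ≠ 0 ∧
      kappa x' ((fun k => k * g⁻¹) ⁻¹' K) ≠ ∞ ∧
      κ (g • x') = b g x' • (kappa x').map fun k => k * g⁻¹ := by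
    intro g x' hx' hg
    have := hfactor _ _ (hcl _ hg (g, x') hx' rfl) (hKpos _ hg) (hKfin _)
    rw [hmapK] at this
    exact this
  have hbc : ∀ g k x', x' ∈ S → g • x' ∈ A → k • x' ∈ A →
      b k x' * c (g * k⁻¹) (k • x') = b g x' := by
    intro g k x' hx' hg hk
    have e : (g * k⁻¹) • k • x' = g • x' := by rw [mul_smul, inv_smul_smul]
    simp only [c, e]
    obtain ⟨h1, h2, h3⟩ := hb k x' hx' hk
    obtain ⟨h4, h5, -⟩ := hb g x' hx' hg
    have hb0 : b k x' ≠ 0 := ENNReal.div_ne_zero.2 ⟨hKpos _ hk, h2⟩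
    have hbt : b k x' ≠ ∞ := ENNReal.div_ne_top (hKfin _) h1
    have e2 : κ (k • x') ((fun l => l * (g * k⁻¹)⁻¹) ⁻¹' K) =
        b k x' * kappa x' ((fun l => l * g⁻¹) ⁻¹' K) := by
      rw [h3, Measure.smul_apply, smul_eq_mul, Measure.map_apply (measurable_mul_const _)
        (measurable_mul_const _ hKm), ← Set.preimage_comp]
      congr 3
      funext l
      simp [mul_assoc]
    rw [e2]
    change _ = κ (g • x') K / _
    rw [ENNReal.div_eq_inv_mul, ENNReal.mul_inv (Or.inl hb0) (Or.inl hbt), ← mul_assoc,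
      ← mul_assoc, ENNReal.mul_inv_cancel hb0 hbt, one_mul, ENNReal.div_eq_inv_mul]
  have hnuA : ∀ᵐ x' ∂nu, ∀ᵐ g ∂(kappa x'), g • x' ∈ A :=
    h.ae_of_ae_sectionLift (Φ.ae_sectionLift_of_ae hA)
  -- both sides of the formula are of the following form
  have main : ∀ v : (L × X) × L → ℝ≥0∞, Measurable v →
      ∫⁻ x, ∫⁻ l, ∫⁻ p, v (p, l) ∂(Φ.fiber x) ∂(κ x) ∂lam =
      ∫⁻ x', ∫⁻ g, ∫⁻ k, b g x' * v ((g, x'), k * g⁻¹) ∂(kappa x') ∂(kappa x') ∂nu := by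
    intro v hv
    let κ' : Kernel (L × X) L := κ.comap (fun p => p.1 • p.2) (measurable_fst.smul measurable_snd)
    have hF : Measurable fun p : L × X => ∫⁻ l, v (p, l) ∂(κ (p.1 • p.2)) :=
      Measurable.lintegral_kernel_prod_right' (κ := κ') hv
    have e1 : ∀ x, ∫⁻ l, ∫⁻ p, v (p, l) ∂(Φ.fiber x) ∂(κ x) =
        ∫⁻ p, ∫⁻ l, v (p, l) ∂(κ (p.1 • p.2)) ∂(Φ.fiber x) := by
      intro x
      rw [lintegral_lintegral_swap (f := fun l p => v (p, l)) (hv.comp measurable_swap).aemeasurable]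
      refine lintegral_congr_ae ((Φ.ae_fiber_iff x).2 fun p _ hp => ?_)
      simp only [hp]
    simp only [e1]
    rw [h.lintegral_eq Φ hF]
    refine lintegral_congr_ae ?_
    filter_upwards [hnuA, h.ae_mem Φ] with x' hx' hxS
    refine lintegral_congr_ae ?_
    filter_upwards [hx'] with g hg
    have hvg : Measurable fun l => v ((g, x'), l) := hv.comp measurable_prodMk_left
    rw [(hb g x' hxS hg).2.2, lintegral_smul_measure, lintegral_map hvg (measurable_mul_const _),
      smul_eq_mul]
    exact (lintegral_const_mul _ (hvg.comp (measurable_mul_const _))).symm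
  -- `P` is a probability distribution on each fiber
  let Q : X → ℝ≥0∞ := fun x => ∫⁻ p, Φ.weight p.1 ∂(Φ.fiber x)
  have hQm : Measurable Q :=
    Measurable.lintegral_kernel (Φ.measurable_weight.comp measurable_fst)
  have hQ0 : ∀ x, Q x ≠ 0 := Φ.lintegral_weight_ne_zero
  have hQt : ∀ x, Q x ≠ ∞ := fun x => ne_top_of_le_ne_top (by simp) (Φ.lintegral_weight_le x)
  let P : L × X → ℝ≥0∞ := fun p => Φ.weight p.1 / Q (p.1 • p.2)
  have hPm : Measurable P := (Φ.measurable_weight.comp measurable_fst).div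
    (hQm.comp (measurable_fst.smul measurable_snd))
  have hP : ∀ x, ∫⁻ p, P p ∂(Φ.fiber x) = 1 := by
    intro x
    have : ∫⁻ p, P p ∂(Φ.fiber x) = ∫⁻ p, (Q x)⁻¹ * Φ.weight p.1 ∂(Φ.fiber x) := by
      refine lintegral_congr_ae ((Φ.ae_fiber_iff x).2 fun p _ hp => ?_)
      simp only [P, hp, ENNReal.div_eq_inv_mul]
    rw [this, lintegral_const_mul (f := fun p : L × X => Φ.weight p.1) _
      (Φ.measurable_weight.comp measurable_fst)]
    exact ENNReal.inv_mul_cancel (hQ0 x) (hQt x)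
  refine ⟨⟨A, c, hAm, hA, hcm, hreg, hnhds, fun x hx l hl => (hc x hx l hl).1,
    fun x hx l hl => (hc x hx l hl).2, fun u hu => ?_⟩⟩
  have l1 : ∫⁻ x, ∫⁻ l, u (x, l) ∂(κ x) ∂lam = ∫⁻ x, ∫⁻ l, ∫⁻ p,
      u (p.1 • p.2, l) * P (l * p.1, p.2) ∂(Φ.fiber x) ∂(κ x) ∂lam := by
    refine lintegral_congr fun x => lintegral_congr fun l => ?_
    have e : ∫⁻ p, u (p.1 • p.2, l) * P (l * p.1, p.2) ∂(Φ.fiber x) =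
        ∫⁻ p, u (x, l) * P (l * p.1, p.2) ∂(Φ.fiber x) := by
      refine lintegral_congr_ae ((Φ.ae_fiber_iff x).2 fun p _ hp => ?_)
      simp only [hp]
    rw [e, lintegral_const_mul (f := fun p : L × X => P (l * p.1, p.2)) _
      (hPm.comp (by fun_prop)), ← Φ.lintegral_fiber_smul l x hPm, hP, mul_one]
  have l2 : ∫⁻ y, ∫⁻ l, u (l • y, l⁻¹) * c l y ∂(κ y) ∂lam = ∫⁻ y, ∫⁻ l, ∫⁻ p,
      u (l • p.1 • p.2, l⁻¹) * c l (p.1 • p.2) * P p ∂(Φ.fiber y) ∂(κ y) ∂lam := by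
    refine lintegral_congr fun y => lintegral_congr fun l => ?_
    have e : ∫⁻ p, u (l • p.1 • p.2, l⁻¹) * c l (p.1 • p.2) * P p ∂(Φ.fiber y) =
        ∫⁻ p, u (l • y, l⁻¹) * c l y * P p ∂(Φ.fiber y) := by
      refine lintegral_congr_ae ((Φ.ae_fiber_iff y).2 fun p _ hp => ?_)
      simp only [hp]
    rw [e, lintegral_const_mul _ hPm, hP, mul_one]
  have ha : Measurable fun z : (L × X) × L => z.1.1 • z.1.2 :=
    (measurable_fst.comp measurable_fst).smul (measurable_snd.comp measurable_fst)
  have ha2 : Measurable fun z : (L × X) × L => z.2 • z.1.1 • z.1.2 := measurable_snd.smul ha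
  rw [l1, main (fun z => u (z.1.1 • z.1.2, z.2) * P (z.2 * z.1.1, z.1.2))
    ((hu.comp (ha.prodMk measurable_snd)).mul (hPm.comp (by fun_prop))), l2,
    main (fun z => u (z.2 • z.1.1 • z.1.2, z.2⁻¹) * c z.2 (z.1.1 • z.1.2) * P z.1)
    (((hu.comp (ha2.prodMk measurable_snd.inv)).mul (hcm.comp (measurable_snd.prodMk ha))).mul
      (hPm.comp measurable_fst))]
  refine lintegral_congr_ae ?_
  filter_upwards [hnuA, h.ae_mem Φ] with x' hx' hxS
  have hsw : ∫⁻ g, ∫⁻ k, b g x' * (u ((k * g⁻¹) • g • x', (k * g⁻¹)⁻¹) * c (k * g⁻¹) (g • x') *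
      P (g, x')) ∂(kappa x') ∂(kappa x') =
      ∫⁻ k, ∫⁻ g, b g x' * (u ((k * g⁻¹) • g • x', (k * g⁻¹)⁻¹) * c (k * g⁻¹) (g • x') *
      P (g, x')) ∂(kappa x') ∂(kappa x') := by
    refine lintegral_lintegral_swap (Measurable.aemeasurable ?_)
    have m1 : Measurable fun z : L × L => z.1 • x' := measurable_fst.smul_const x'
    have m2 : Measurable fun z : L × L => z.2 * z.1⁻¹ := by fun_prop
    refine (hbm.comp (measurable_fst.prodMk measurable_const)).mul
      (((hu.comp ((m2.smul m1).prodMk m2.inv)).mul (hcm.comp (m2.prodMk m1))).mul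
        (hPm.comp (measurable_fst.prodMk measurable_const)))
  rw [hsw]
  refine lintegral_congr_ae ?_
  filter_upwards [hx'] with g hg
  refine lintegral_congr_ae ?_
  filter_upwards [hx'] with k hk
  have e : (g * k⁻¹) • k • x' = g • x' := by rw [mul_smul, inv_smul_smul]
  rw [e, ← hbc g k x' hxS hg hk]
  simp only [inv_mul_cancel_right, mul_inv_rev, inv_inv]
  ring

end

section

variable {L X : Type*} [Group L] [TopologicalSpace L] [IsTopologicalGroup L] [PolishSpace L]
  [MeasurableSpace L] [BorelSpace L] [LocallyCompactSpace L]
  [MeasurableSpace X] [StandardBorelSpace X] [MulAction L X] [MeasurableSMul₂ L X]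
  {lam : Measure X} [IsFiniteMeasure lam]

namespace MassTransport

variable {κ : Kernel X L} [IsSFiniteKernel κ] (M : MassTransport lam κ)

/-- Almost every translate of almost every point is generic. -/
theorem ae_ae_smul (M : MassTransport lam κ) {P : X → Prop} (h : ∀ᵐ x ∂lam, P x) :
    ∀ᵐ x ∂lam, ∀ᵐ l ∂(κ x), P (l • x) := by
  obtain ⟨A, hAm, hA, hAP⟩ := exists_measurable_core h
  have hm : Measurable fun q : X × L => Aᶜ.indicator (1 : X → ℝ≥0∞) (q.2 • q.1) :=
    (measurable_one.indicator hAm.compl).comp (measurable_snd.smul measurable_fst)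
  have h1 := M.lintegral_eq _ hm
  have h2 : ∫⁻ y, ∫⁻ l, Aᶜ.indicator (1 : X → ℝ≥0∞) (l⁻¹ • l • y) * M.cocycle l y ∂(κ y) ∂lam
      = 0 := by
    refine lintegral_eq_zero_of_ae_eq_zero ?_
    filter_upwards [hA] with y hy
    simp [hy]
  rw [h2, lintegral_eq_zero_iff hm.lintegral_kernel_prod_right'] at h1
  filter_upwards [h1] with x hx
  have hx' : ∫⁻ l, Aᶜ.indicator (1 : X → ℝ≥0∞) (l • x) ∂(κ x) = 0 := hx
  rw [lintegral_eq_zero_iff (f := fun l => Aᶜ.indicator (1 : X → ℝ≥0∞) (l • x))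
    (hm.comp measurable_prodMk_left)] at hx'
  filter_upwards [hx'] with l hl
  refine hAP _ ?_
  by_contra hcon
  simp [hcon] at hl

theorem lintegral_smul (M : MassTransport lam κ) {x : X} (hx : x ∈ M.core) {l : L}
    (hl : l • x ∈ M.core) {f : L → ℝ≥0∞} (hf : Measurable f) :
    ∫⁻ k, f k ∂(κ (l • x)) = M.cocycle l x * ∫⁻ k, f (k * l⁻¹) ∂(κ x) := by
  rw [M.transl x hx l hl, lintegral_smul_measure, lintegral_map hf (measurable_mul_const _),
    smul_eq_mul]

end MassTransport

variable (αX : X ≃ᵐ X) (αL : L ≃ₜ* L)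

theorem IsCompleteLacunarySection.image (hequiv : ∀ (l : L) (x : X), αX (l • x) = αL l • αX x)
    {S : Set X} (hS : IsCompleteLacunarySection L S) :
    IsCompleteLacunarySection L (αX.symm ⁻¹' S) := by
  obtain ⟨hm, U, hUc, hUn, hUi, h1, h2⟩ := hS
  refine ⟨αX.symm.measurable hm, αL '' U, hUc.image αL.continuous, ?_, ?_, ?_, ?_⟩
  · have := αL.toHomeomorph.isOpenMap.image_mem_nhds hUn
    rwa [show αL.toHomeomorph 1 = 1 from map_one αL] at this
  · rw [← Set.image_inv αL, hUi]
  · rintro x hx _ ⟨g, hg, rfl⟩ hgx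
    obtain ⟨x, rfl⟩ := αX.surjective x
    rw [← hequiv] at hgx ⊢
    simp only [Set.mem_preimage, MeasurableEquiv.symm_apply_apply] at hx hgx
    rw [h1 x hx g hg hgx]
  · intro y
    obtain ⟨g, ⟨g1, hg1, g2, hg2, rfl⟩, x, hx, hy⟩ := h2 (αX.symm y)
    refine ⟨αL (g1 * g2), ?_, αX x, by simpa using hx, ?_⟩
    · rw [map_mul]
      exact Set.mul_mem_mul ⟨g1, hg1, rfl⟩ ⟨g2, hg2, rfl⟩
    · rw [← hequiv]
      simp only [] at hy
      rw [hy, αX.apply_symm_apply]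

/-- The automorphism maps the fibers of a section to those of its image. -/
theorem fiberMeasure_image (hequiv : ∀ (l : L) (x : X), αX (l • x) = αL l • αX x)
    (S : Set X) (x : X) :
    fiberMeasure L (αX.symm ⁻¹' S) (αX x) =
      (fiberMeasure L S x).map fun p => (αL p.1, αX p.2) := by
  let e : L × X ≃ᵐ L × X := MeasurableEquiv.prodCongr αL.toHomeomorph.toMeasurableEquiv αX
  have he : (fun p : L × X => (αL p.1, αX p.2)) = e := rfl
  rw [he, fiberMeasure, fiberMeasure]
  have h1 : (Measure.count : Measure (L × X)).map e = Measure.count := by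
    ext s hs
    rw [e.map_apply, Measure.count_apply hs, Measure.count_apply (e.measurable hs)]
    congr 1
    exact Set.encard_preimage_of_bijective e.bijective s
  have h2 : {p : L × X | p.2 ∈ S ∧ p.1 • p.2 = x} =
      e ⁻¹' {p | p.2 ∈ αX.symm ⁻¹' S ∧ p.1 • p.2 = αX x} := by
    ext p
    have : e p = (αL p.1, αX p.2) := rfl
    simp [this, ← hequiv]
  rw [h2]
  conv_lhs => rw [← h1]
  exact e.restrict_map _ _

/-- The automorphism maps the conditional measures on a section to those on its image. -/
theorem IsSectionDisintegration.image (hdisc : HasUniformlyDiscreteStabilizers L X)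
    (hequiv : ∀ (l : L) (x : X), αX (l • x) = αL l • αX x) (hlam : MeasurePreserving αX lam lam)
    {S : Set X} (hS : IsCompleteLacunarySection L S) {nu : Measure X} {kappa : Kernel X L}
    (h : IsSectionDisintegration lam S nu kappa) :
    IsSectionDisintegration lam (αX.symm ⁻¹' S) (nu.map αX)
      ((kappa.comap αX.symm αX.symm.measurable).map αL) := by
  obtain ⟨Φ⟩ := exists_fiberSystem hdisc hS
  obtain ⟨Φ'⟩ := exists_fiberSystem hdisc (hS.image αX αL hequiv)
  have hnu := h.isFiniteMeasure
  have hsf := h.isSFiniteKernel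
  have hαL : Measurable αL := αL.continuous.measurable
  let e : L × X → L × X := fun p => (αL p.1, αX p.2)
  have he : Measurable e := by fun_prop
  have hlift : sectionLift L lam (αX.symm ⁻¹' S) = (sectionLift L lam S).map e := by
    refine Measure.ext_of_lintegral _ fun f hf => ?_
    rw [lintegral_map hf he, Φ'.lintegral_sectionLift lam hf,
      Φ.lintegral_sectionLift (f := fun p => f (e p)) lam (hf.comp he)]
    conv_lhs => rw [← hlam.map_eq]
    rw [lintegral_map_equiv]
    refine lintegral_congr fun x => ?_
    rw [Φ'.fiber_apply, fiberMeasure_image αX αL hequiv, lintegral_map hf he]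
    rfl
  obtain ⟨⟨m, hm, h1, h2, rfl⟩, -, h3⟩ := h
  refine ⟨⟨m.map e, inferInstance, ?_, ?_, ?_⟩, inferInstance, ?_⟩
  · rw [hlift]; exact h1.map he
  · rw [hlift]; exact h2.map he
  · rw [Measure.map_map measurable_snd he, Measure.map_map αX.measurable measurable_snd]
    rfl
  · refine Measure.ext_of_lintegral _ fun f hf => ?_
    rw [hlift, h3, lintegral_map hf he, lintegral_map (f := fun p => f (e p)) (hf.comp he)
      measurable_swap, lintegral_map hf measurable_swap,
      Measure.lintegral_compProd (f := fun q : X × L => f (e q.swap))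
        ((hf.comp he).comp measurable_swap),
      Measure.lintegral_compProd (f := fun q : X × L => f q.swap) (hf.comp measurable_swap),
      lintegral_map_equiv]
    refine lintegral_congr fun x' => ?_
    rw [Kernel.map_apply _ hαL, Kernel.comap_apply, αX.symm_apply_apply,
      lintegral_map (f := fun b => f (Prod.swap (αX x', b))) (hf.comp measurable_prodMk_right) hαL]
    rfl

/-- Equivariance of a disintegration under an automorphism of the action. -/
theorem IsDisintegration.ae_sameClass_map (hdisc : HasUniformlyDiscreteStabilizers L X)
    (hequiv : ∀ (l : L) (x : X), αX (l • x) = αL l • αX x) (hlam : MeasurePreserving αX lam lam)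
    {σ : X → Measure L} (hσ : IsDisintegration lam σ) :
    ∀ᵐ x ∂lam, SameClass (σ (αX x)) ((σ x).map αL) := by
  obtain ⟨S, hS⟩ := exists_isCompleteLacunarySection hdisc
  obtain ⟨Φ⟩ := exists_fiberSystem hdisc hS
  obtain ⟨Φ'⟩ := exists_fiberSystem hdisc (hS.image αX αL hequiv)
  obtain ⟨nu, kappa, h⟩ := exists_isSectionDisintegration Φ lam
  have hαL : Measurable αL := αL.continuous.measurable
  filter_upwards [hσ.ae_sameClass_section hS Φ h, hlam.quasiMeasurePreserving.ae
    (hσ.ae_sameClass_section (hS.image αX αL hequiv) Φ' (h.image αX αL hdisc hequiv hlam hS))]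
    with x h1 h2
  obtain ⟨p, hp, hpx⟩ := Φ.complete x
  have h3 := h2 (αL p.1, αX p.2) (by simpa using hp) (by rw [← hequiv, hpx])
  have h4 := (h1 p hp hpx).map αL
  refine h3.trans (SameClass.symm ?_)
  rw [Kernel.map_apply _ hαL, Kernel.comap_apply, αX.symm_apply_apply,
    Measure.map_map (measurable_mul_const _) hαL]
  rw [Measure.map_map hαL (measurable_mul_const _)] at h4
  convert h4 using 2
  funext k
  simp

end

/-! ### Conditioning a disintegration on the cosets of a normal subgroup -/

section Factor

/-- A Borel function that is constant on the fibers of a continuous map `p`, on a Borel set, is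
there a Borel function of `p`: the images of its level sets are separated by Borel sets. -/
theorem exists_measurable_factor {Y Z : Type*} [TopologicalSpace Y] [PolishSpace Y]
    [MeasurableSpace Y] [BorelSpace Y] [TopologicalSpace Z] [T2Space Z] [MeasurableSpace Z]
    [OpensMeasurableSpace Z] {p : Y → Z} (hp : Continuous p) {Ω : Set Y} (hΩ : MeasurableSet Ω)
    {r : Y → ℝ≥0∞} (hr : Measurable r)
    (hinv : ∀ y ∈ Ω, ∀ y' ∈ Ω, p y = p y' → r y = r y') :
    ∃ r' : Z → ℝ≥0∞, Measurable r' ∧ ∀ y ∈ Ω, r' (p y) = r y := by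
  have hsep : ∀ q : ℚ, ∃ C : Set Z, MeasurableSet C ∧
      ∀ y ∈ Ω, p y ∈ C ↔ r y < ENNReal.ofReal q := by
    intro q
    have h1 : AnalyticSet (p '' (Ω ∩ {y | r y < ENNReal.ofReal q})) :=
      ((hΩ.inter (hr measurableSet_Iio)).analyticSet).image_of_continuous hp
    have h2 : AnalyticSet (p '' (Ω ∩ {y | ENNReal.ofReal q ≤ r y})) :=
      ((hΩ.inter (hr measurableSet_Ici)).analyticSet).image_of_continuous hp
    obtain ⟨C, hC1, hC2, hCm⟩ := h1.measurablySeparable h2 (by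
      rw [Set.disjoint_left]
      rintro _ ⟨y, ⟨hy, hyq⟩, rfl⟩ ⟨y', ⟨hy', hyq'⟩, he⟩
      have := hinv y hy y' hy' he.symm
      have h3 : r y < ENNReal.ofReal q := hyq
      have h4 : ENNReal.ofReal q ≤ r y' := hyq'
      exact absurd h4 (by rw [← this]; exact not_le.2 h3))
    refine ⟨C, hCm, fun y hy => ⟨fun hyC => ?_, fun hlt => hC1 ⟨y, ⟨hy, hlt⟩, rfl⟩⟩⟩
    by_contra hcon
    exact Set.disjoint_left.1 hC2 ⟨y, ⟨hy, not_lt.1 hcon⟩, rfl⟩ hyC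
  choose C hCm hC using hsep
  classical
  refine ⟨fun z => ⨅ q : ℚ, if z ∈ C q then ENNReal.ofReal q else ∞,
    Measurable.iInf fun q => Measurable.ite (hCm q) measurable_const measurable_const,
    fun y hy => le_antisymm ?_ ?_⟩
  · refine le_of_forall_gt fun t ht => ?_
    obtain ⟨q, -, hq1, hq2⟩ := ENNReal.lt_iff_exists_rat_btwn.1 ht
    refine lt_of_le_of_lt (iInf_le _ q) ?_
    rw [if_pos ((hC q y hy).2 hq1)]
    exact hq2
  · refine le_iInf fun q => ?_
    split_ifs with h
    · exact ((hC q y hy).1 h).le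
    · exact le_top

end Factor

section Instances

variable {G X : Type*} [Group G] [TopologicalSpace G] [MeasurableSpace G]
  [MeasurableSpace X] [MulAction G X] [MeasurableSMul₂ G X] (H : Subgroup G)

instance polishSpace_subgroup [PolishSpace G] [hH : IsClosed (H : Set G)] : PolishSpace H :=
  hH.isClosedEmbedding_subtypeVal.polishSpace

instance locallyCompactSpace_subgroup [LocallyCompactSpace G] [hH : IsClosed (H : Set G)] :
    LocallyCompactSpace H :=
  hH.isClosedEmbedding_subtypeVal.locallyCompactSpace

instance measurableSMul₂_subgroup : MeasurableSMul₂ H X :=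
  ⟨(measurable_subtype_coe.comp measurable_fst).smul measurable_snd⟩

end Instances

namespace MassTransport

section Cocycle

variable {L X : Type*} [Group L] [TopologicalSpace L] [IsTopologicalGroup L] [PolishSpace L]
  [MeasurableSpace L] [BorelSpace L] [LocallyCompactSpace L]
  [MeasurableSpace X] [StandardBorelSpace X] [MulAction L X] [MeasurableSMul₂ L X]
  {lam : Measure X} {κ : Kernel X L} (M : MassTransport lam κ)

/-- The cocycle identity of the proportionality factors. -/
theorem cocycle_mul (M : MassTransport lam κ) {x : X} {k l : L} (hx : x ∈ M.core)
    (hl : l • x ∈ M.core) (hk : k • x ∈ M.core) :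
    M.cocycle (k * l⁻¹) (l • x) * M.cocycle l x = M.cocycle k x := by
  obtain ⟨K, hK, hK1⟩ := exists_compact_mem_nhds (1 : L)
  have e : (k * l⁻¹) • l • x = k • x := by rw [mul_smul, inv_smul_smul]
  have h1 := M.transl _ hl (k * l⁻¹) (by rwa [e])
  rw [e, M.transl x hx l hl, M.transl x hx k hk, Measure.map_smul, smul_smul,
    Measure.map_map (measurable_mul_const _) (measurable_mul_const _)] at h1
  have e2 : (fun j : L => j * (k * l⁻¹)⁻¹) ∘ (fun j => j * l⁻¹) = fun j => j * k⁻¹ := by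
    funext j; simp [mul_assoc]
  rw [e2] at h1
  have h2 := congrArg (fun μ : Measure L => μ K) h1
  simp only [Measure.smul_apply, smul_eq_mul] at h2
  have h0 : (κ x).map (fun j => j * k⁻¹) K ≠ 0 := by
    have := M.nhds_pos _ hk K hK1
    rw [M.transl x hx k hk, Measure.smul_apply, smul_eq_mul] at this
    exact right_ne_zero_of_mul this
  have ht : (κ x).map (fun j => j * k⁻¹) K ≠ ∞ :=
    ((M.regular x).map_mul_right k⁻¹).2 K hK
  exact ((ENNReal.mul_left_inj h0 ht).1 h2).symm

end Cocycle

section Coset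

variable {G X : Type*} [Group G] [TopologicalSpace G] [IsTopologicalGroup G] [PolishSpace G]
  [LocallyCompactSpace G] [MeasurableSpace G] [BorelSpace G]
  [MeasurableSpace X] [StandardBorelSpace X] [MulAction G X] [MeasurableSMul₂ G X]
  {lam : Measure X} [IsFiniteMeasure lam] {H : Subgroup G} [hH : IsClosed (H : Set G)]
  {κ : Kernel X G} [IsSFiniteKernel κ] {η : Kernel X H} [IsSFiniteKernel η]
  (M : MassTransport lam κ) (M' : MassTransport lam η)

/-- The joint distribution of two points on the same coset, the second one being chosen with the
disintegration along `H`, is symmetric up to the cocycle of `H`. -/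
theorem lintegral_coset_swap (M : MassTransport lam κ) (M' : MassTransport lam η)
    {F : (X × G) × G → ℝ≥0∞} (hF : Measurable F) :
    ∫⁻ x, ∫⁻ g, ∫⁻ h : H, F ((x, g), h * g) ∂(η (g • x)) ∂(κ x) ∂lam =
      ∫⁻ x, ∫⁻ g, ∫⁻ h : H, F ((x, h * g), g) * M'.cocycle h (g • x)
        ∂(η (g • x)) ∂(κ x) ∂lam := by
  have hc := M.measurable_cocycle
  have hc' := M'.measurable_cocycle
  let η' : Kernel (X × G) H := η.comap (fun p => p.2 • p.1) (measurable_snd.smul measurable_fst)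
  have hval : Measurable (Subtype.val : H → G) := measurable_subtype_coe
  -- measurability of the elementary maps
  have a1 : Measurable fun z : (X × G) × H => ((z.2 : G)) := hval.comp measurable_snd
  have a2 : Measurable fun z : (X × G) × H => z.1.2 • z.1.1 :=
    (measurable_snd.comp measurable_fst).smul (measurable_fst.comp measurable_fst)
  have hu1 : Measurable fun p : X × G => ∫⁻ h : H, F (p, h * p.2) ∂(η (p.2 • p.1)) :=
    Measurable.lintegral_kernel_prod_right' (κ := η')
      (f := fun z : (X × G) × H => F (z.1, z.2 * z.1.2))
      (hF.comp (measurable_fst.prodMk (a1.mul (measurable_snd.comp measurable_fst))))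
  have hu3 : Measurable fun p : X × G =>
      ∫⁻ h : H, F ((p.1, h * p.2), p.2) * M'.cocycle h (p.2 • p.1) ∂(η (p.2 • p.1)) :=
    Measurable.lintegral_kernel_prod_right' (κ := η')
      (f := fun z : (X × G) × H => F ((z.1.1, z.2 * z.1.2), z.1.2) *
        M'.cocycle z.2 (z.1.2 • z.1.1))
      ((hF.comp (((measurable_fst.comp measurable_fst).prodMk
        (a1.mul (measurable_snd.comp measurable_fst))).prodMk
          (measurable_snd.comp measurable_fst))).mul
        (hc'.comp (measurable_snd.prodMk a2)))
  have b1 : Measurable fun z : (X × H) × G => z.2 • z.1.1 :=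
    measurable_snd.smul (measurable_fst.comp measurable_fst)
  have b2 : Measurable fun z : (X × H) × G => (z.1.2 : G) * z.2⁻¹ :=
    (hval.comp (measurable_snd.comp measurable_fst)).mul measurable_snd.inv
  have b3 : Measurable fun z : (X × H) × G => M.cocycle z.2 z.1.1 :=
    hc.comp (measurable_snd.prodMk (measurable_fst.comp measurable_fst))
  have hf2 : Measurable fun z : (X × H) × G =>
      F ((z.2 • z.1.1, z.2⁻¹), z.1.2 * z.2⁻¹) * M.cocycle z.2 z.1.1 :=
    (hF.comp ((b1.prodMk measurable_snd.inv).prodMk b2)).mul b3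
  have hf4 : Measurable fun z : (X × H) × G => F ((z.2 • z.1.1, z.1.2 * z.2⁻¹), z.2⁻¹) *
      M'.cocycle z.1.2 z.1.1 * M.cocycle z.2 z.1.1 :=
    ((hF.comp ((b1.prodMk b2).prodMk measurable_snd.inv)).mul (hc'.comp
      ((measurable_snd.comp measurable_fst).prodMk (measurable_fst.comp measurable_fst)))).mul b3
  let κ' : Kernel (X × H) G := κ.comap Prod.fst measurable_fst
  have hu2 : Measurable fun p : X × H => ∫⁻ g, F ((g • p.1, g⁻¹), p.2 * g⁻¹) *
      M.cocycle g p.1 ∂(κ p.1) :=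
    Measurable.lintegral_kernel_prod_right' (κ := κ') hf2
  -- Move the base point to `y = g • x` by mass transport for `κ`, replace `h` by its inverse by mass
  -- transport for `η`, move `y` along `H` in the integral for `κ`, and return.
  calc ∫⁻ x, ∫⁻ g, ∫⁻ h : H, F ((x, g), h * g) ∂(η (g • x)) ∂(κ x) ∂lam
      = ∫⁻ y, ∫⁻ g, ∫⁻ h : H, F ((g • y, g⁻¹), h * g⁻¹) * M.cocycle g y
          ∂(η y) ∂(κ y) ∂lam := by
        rw [M.lintegral_eq _ hu1]
        refine lintegral_congr fun y => lintegral_congr fun g => ?_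
        simp only [inv_smul_smul]
        refine (lintegral_mul_const _ ?_).symm
        exact hF.comp (measurable_const.prodMk (hval.mul_const _))
    _ = ∫⁻ y, ∫⁻ h : H, ∫⁻ g, F ((g • y, g⁻¹), h * g⁻¹) * M.cocycle g y
          ∂(κ y) ∂(η y) ∂lam := by
        refine lintegral_congr fun y => lintegral_lintegral_swap (Measurable.aemeasurable ?_)
        exact hf2.comp ((measurable_const.prodMk measurable_snd).prodMk measurable_fst)
    _ = ∫⁻ z, ∫⁻ h : H, (∫⁻ g, F ((g • h • z, g⁻¹), ((h⁻¹ : H) : G) * g⁻¹) *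
          M.cocycle g (h • z) ∂(κ (h • z))) * M'.cocycle h z ∂(η z) ∂lam :=
        M'.lintegral_eq _ hu2
    _ = ∫⁻ z, ∫⁻ h : H, ∫⁻ g, F ((g • z, h * g⁻¹), g⁻¹) * M'.cocycle h z * M.cocycle g z
          ∂(κ z) ∂(η z) ∂lam := by
        refine lintegral_congr_ae ?_
        filter_upwards [M.ae_mem_core, M'.ae_ae_smul M.ae_mem_core, M.ae_ae_smul M.ae_mem_core]
          with z hz hz' hz''
        refine lintegral_congr_ae ?_
        filter_upwards [hz'] with h hh
        have hh' : (h : G) • z ∈ M.core := hh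
        have m1 : Measurable fun g : G => F ((g • h • z, g⁻¹), ((h⁻¹ : H) : G) * g⁻¹) *
            M.cocycle g (h • z) := hf2.comp (measurable_prodMk_left (x := (h • z, h⁻¹)))
        have e1 := M.lintegral_smul hz hh' m1
        have m2 : Measurable fun g : G => F ((g • z, h * g⁻¹), g⁻¹) * M'.cocycle h z *
            M.cocycle g z := hf4.comp (measurable_prodMk_left (x := (z, h)))
        change (∫⁻ g, F ((g • h • z, g⁻¹), ((h⁻¹ : H) : G) * g⁻¹) *
            M.cocycle g (h • z) ∂(κ ((h : G) • z))) * M'.cocycle h z = _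
        have m3 : Measurable fun k : G => F (((k * (h : G)⁻¹) • h • z,
          (k * (h : G)⁻¹)⁻¹), ((h⁻¹ : H) : G) * (k * (h : G)⁻¹)⁻¹) *
            M.cocycle (k * (h : G)⁻¹) (h • z) := m1.comp (measurable_mul_const (h : G)⁻¹)
        rw [e1, ← lintegral_const_mul _ m3, ← lintegral_mul_const _ (m3.const_mul _)]
        refine lintegral_congr_ae ?_
        filter_upwards [hz''] with g hg
        have e2 : (g * (h : G)⁻¹) • h • z = g • z := by
          rw [mul_smul]
          change g • (h : G)⁻¹ • (h : G) • z = _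
          rw [inv_smul_smul]
        have e3 := M.cocycle_mul hz hh' hg
        rw [e2]
        have e4 : ((h⁻¹ : H) : G) * (g * (h : G)⁻¹)⁻¹ = g⁻¹ := by simp
        have e5 : (g * (h : G)⁻¹)⁻¹ = h * g⁻¹ := by simp
        rw [e4, e5, ← e3]
        change M.cocycle h z * (F ((g • z, h * g⁻¹), g⁻¹) * M.cocycle (g * (h : G)⁻¹) ((h : G) • z))
          * M'.cocycle h z = _
        ring
    _ = ∫⁻ z, ∫⁻ g, ∫⁻ h : H, F ((g • z, h * g⁻¹), g⁻¹) * M'.cocycle h z * M.cocycle g z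
          ∂(η z) ∂(κ z) ∂lam := by
        refine lintegral_congr fun y => lintegral_lintegral_swap (Measurable.aemeasurable ?_)
        exact hf4.comp ((measurable_const.prodMk measurable_fst).prodMk measurable_snd)
    _ = ∫⁻ x, ∫⁻ g, ∫⁻ h : H, F ((x, h * g), g) * M'.cocycle h (g • x)
          ∂(η (g • x)) ∂(κ x) ∂lam := by
        rw [M.lintegral_eq _ hu3]
        refine lintegral_congr fun y => lintegral_congr fun g => ?_
        simp only [inv_smul_smul]
        refine lintegral_mul_const _ ?_
        refine (hF.comp ((measurable_const.prodMk (hval.mul_const _)).prodMk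
          measurable_const)).mul (hc'.comp (measurable_id.prodMk measurable_const))

/-- The integral of `f` on the coset of `g` with respect to the disintegration along `H`. -/
noncomputable def cosetIntegral (η : Kernel X H) (f : G → ℝ≥0∞) (x : X) (g : G) : ℝ≥0∞ :=
  ∫⁻ h : H, f (h * g) ∂(η (g • x))

theorem measurable_cosetIntegral {f : G → ℝ≥0∞} (hf : Measurable f) :
    Measurable (Function.uncurry (cosetIntegral η f)) := by
  let η' : Kernel (X × G) H := η.comap (fun p => p.2 • p.1) (measurable_snd.smul measurable_fst)
  exact Measurable.lintegral_kernel_prod_right' (κ := η')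
    (f := fun z : (X × G) × H => f (z.2 * z.1.2))
    (hf.comp ((measurable_subtype_coe.comp measurable_snd).mul
      (measurable_snd.comp measurable_fst)))

theorem cosetIntegral_mul (M' : MassTransport lam η) {f : G → ℝ≥0∞} (hf : Measurable f) {x : X}
    {g : G} {h : H} (hg : g • x ∈ M'.core) (hh : (h * g : G) • x ∈ M'.core) :
    cosetIntegral η f x (h * g) = M'.cocycle h (g • x) * cosetIntegral η f x g := by
  have e : (h * g : G) • x = h • g • x := mul_smul (h : G) g x
  rw [e] at hh
  rw [cosetIntegral, e, M'.lintegral_smul hg hh (f := fun k : H => f (k * (h * g)))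
    (hf.comp (measurable_subtype_coe.mul_const _)), cosetIntegral]
  simp [mul_assoc]

theorem cosetIntegral_indicator_ne (M' : MassTransport lam η) {K : Set G} (hK : IsCompact K)
    {x : X} {g : G} (hg : g • x ∈ M'.core) (hgK : g ∈ interior K) :
    cosetIntegral η (K.indicator 1) x g ≠ 0 ∧ cosetIntegral η (K.indicator 1) x g ≠ ∞ := by
  have hcont : Continuous fun h : H => (h : G) * g := continuous_subtype_val.mul_const g
  have e : cosetIntegral η (K.indicator 1) x g = η (g • x) ((fun h : H => (h : G) * g) ⁻¹' K) := by
    rw [← lintegral_indicator_one (hcont.measurable hK.measurableSet)]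
    rfl
  rw [e]
  refine ⟨M'.nhds_pos _ hg _ (hcont.continuousAt.preimage_mem_nhds ?_), (M'.regular _).2 _ ?_⟩
  · simpa using mem_interior_iff_mem_nhds.1 hgK
  · have : IsClosedEmbedding fun h : H => (h : G) * g :=
      (Homeomorph.mulRight g).isClosedEmbedding.comp hH.isClosedEmbedding_subtypeVal
    exact this.isCompact_preimage hK

variable [H.Normal]

/-- The image in `G ⧸ H` of the measure `f σ_x` is that of the measure `σ_x` restricted to `K`, with
as density the average of `f` over the cosets. -/
theorem ae_map_withDensity_eq (M : MassTransport lam κ) (M' : MassTransport lam η) {K : Set G}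
    (hK : IsCompact K) {f : G → ℝ≥0∞} (hf : Measurable f) (hf1 : ∀ g, f g ≤ 1)
    (hfK : ∀ g, f g ≠ 0 → g ∈ interior K) :
    ∀ᵐ x ∂lam, ((κ x).withDensity f).map (QuotientGroup.mk : G → G ⧸ H) =
      ((κ x).withDensity fun g => K.indicator 1 g *
        (cosetIntegral η f x g / cosetIntegral η (K.indicator 1) x g)).map QuotientGroup.mk := by
  set D : X → G → ℝ≥0∞ := cosetIntegral η (K.indicator 1) with hD
  have hKm : Measurable (K.indicator (1 : G → ℝ≥0∞)) := measurable_one.indicator hK.measurableSet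
  have hDm : Measurable (Function.uncurry D) := measurable_cosetIntegral hKm
  have hNm : Measurable (Function.uncurry (cosetIntegral η f)) := measurable_cosetIntegral hf
  have hmk : Measurable (QuotientGroup.mk : G → G ⧸ H) :=
    (QuotientGroup.continuous_mk (N := H)).measurable
  have hfin : ∀ x, ∫⁻ g, f g ∂(κ x) ≠ ∞ := by
    intro x
    refine ne_top_of_le_ne_top ((M.regular x).2 K hK) ?_
    rw [← lintegral_indicator_one hK.measurableSet]
    refine lintegral_mono fun g => ?_
    by_cases hg : f g = 0
    · rw [hg]; exact zero_le
    · rw [Set.indicator_of_mem (interior_subset (hfK g hg))]; exact hf1 g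
  refine ae_measure_eq ?_ fun A hA => ?_
  · refine Eventually.of_forall fun x => ?_
    rw [Measure.map_apply hmk MeasurableSet.univ, withDensity_apply _ (hmk MeasurableSet.univ)]
    simpa using hfin x
  · set A' : Set G := QuotientGroup.mk ⁻¹' A with hA'
    have hA'm : MeasurableSet A' := hmk hA
    have hind : Measurable (A'.indicator (1 : G → ℝ≥0∞)) := measurable_one.indicator hA'm
    have e1 : ∀ (x : X) (f' : G → ℝ≥0∞), ((κ x).withDensity f').map QuotientGroup.mk A =
        ∫⁻ g, A'.indicator 1 g * f' g ∂(κ x) := by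
      intro x f'
      rw [Measure.map_apply hmk hA, withDensity_apply _ hA'm, ← lintegral_indicator hA'm]
      refine lintegral_congr fun g => ?_
      by_cases hg : g ∈ A' <;> simp [hg]
    simp only [e1]
    have m1 : Measurable fun x => ∫⁻ g, A'.indicator 1 g * f g ∂(κ x) :=
      Measurable.lintegral_kernel (hind.mul hf)
    have m2' : Measurable fun p : X × G => A'.indicator 1 p.2 * (K.indicator 1 p.2 *
        (cosetIntegral η f p.1 p.2 / D p.1 p.2)) :=
      (hind.comp measurable_snd).mul ((hKm.comp measurable_snd).mul (hNm.div hDm))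
    have m2 : Measurable fun x => ∫⁻ g, A'.indicator 1 g * (K.indicator 1 g *
        (cosetIntegral η f x g / D x g)) ∂(κ x) := m2'.lintegral_kernel_prod_right'
    refine ae_eq_of_forall_setLIntegral_eq_of_sigmaFinite m1 m2 fun E hE _ => ?_
    have hiE : Measurable (E.indicator (1 : X → ℝ≥0∞)) := measurable_one.indicator hE
    rw [← lintegral_indicator hE, ← lintegral_indicator hE]
    -- the function `D` is constant along the cosets up to the cocycle, which cancels the one produced
    -- by the exchange of the two points of a coset
    let F : (X × G) × G → ℝ≥0∞ := fun z => E.indicator 1 z.1.1 * (A'.indicator 1 z.1.2 *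
      (K.indicator 1 z.1.2 * (f z.2 / D z.1.1 z.1.2)))
    have hF : Measurable F := (hiE.comp (measurable_fst.comp measurable_fst)).mul
      ((hind.comp (measurable_snd.comp measurable_fst)).mul
        ((hKm.comp (measurable_snd.comp measurable_fst)).mul
          ((hf.comp measurable_snd).div (hDm.comp measurable_fst))))
    have hswap := M.lintegral_coset_swap M' hF
    have hcore : ∀ᵐ x ∂lam, ∀ᵐ g ∂(κ x), g • x ∈ M'.core ∧ ∀ᵐ h ∂(η (g • x)),
        h • g • x ∈ M'.core :=
      M.ae_ae_smul (M'.ae_mem_core.and (M'.ae_ae_smul M'.ae_mem_core))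
    have hval : Measurable (Subtype.val : H → G) := measurable_subtype_coe
    calc ∫⁻ x, E.indicator (fun x => ∫⁻ g, A'.indicator 1 g * f g ∂(κ x)) x ∂lam
        = ∫⁻ x, ∫⁻ g, ∫⁻ h : H, F ((x, h * g), g) * M'.cocycle h (g • x)
            ∂(η (g • x)) ∂(κ x) ∂lam := by
          refine lintegral_congr_ae ?_
          filter_upwards [hcore] with x hx
          have e2 : E.indicator (fun x => ∫⁻ g, A'.indicator 1 g * f g ∂(κ x)) x =
              ∫⁻ g, E.indicator 1 x * (A'.indicator 1 g * f g) ∂(κ x) := by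
            rw [lintegral_const_mul (f := fun g => A'.indicator 1 g * f g) _ (hind.mul hf)]
            by_cases hxE : x ∈ E <;> simp [hxE]
          rw [e2]
          refine lintegral_congr_ae ?_
          filter_upwards [hx] with g hg
          have e3 : ∫⁻ h : H, F ((x, h * g), g) * M'.cocycle h (g • x) ∂(η (g • x)) =
              ∫⁻ h : H, E.indicator 1 x * (A'.indicator 1 g * (f g / D x g)) *
                K.indicator 1 (h * g : G) ∂(η (g • x)) := by
            refine lintegral_congr_ae ?_
            filter_upwards [hg.2] with h hh
            have hh' : (h * g : G) • x ∈ M'.core := by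
              rw [mul_smul]; exact hh
            obtain ⟨hc0, hct⟩ := M'.cocycle_ne _ hg.1 h hh
            have e4 : A'.indicator (1 : G → ℝ≥0∞) (h * g) = A'.indicator 1 g := by
              have : (h * g : G) ∈ A' ↔ g ∈ A' := by
                simp only [hA', Set.mem_preimage]
                rw [(QuotientGroup.eq (s := H) (a := (h : G) * g) (b := g)).2 (by
                  have := Subgroup.Normal.conj_mem ‹H.Normal› _ (H.inv_mem h.2) g⁻¹
                  simpa [mul_assoc] using this)]
              by_cases hgA : g ∈ A'
              · rw [Set.indicator_of_mem hgA, Set.indicator_of_mem (this.2 hgA)]; rfl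
              · rw [Set.indicator_of_notMem hgA, Set.indicator_of_notMem (fun h => hgA (this.1 h))]
            have e5 : f g / D x (h * g) * M'.cocycle h (g • x) = f g / D x g := by
              rw [hD, cosetIntegral_mul M' hKm hg.1 hh', ENNReal.div_eq_inv_mul,
                ENNReal.mul_inv (Or.inl hc0) (Or.inl hct), ENNReal.div_eq_inv_mul]
              rw [show ∀ a b c d : ℝ≥0∞, a * b * c * d = (a * d) * (b * c) by intros; ring,
                ENNReal.inv_mul_cancel hc0 hct, one_mul]
            simp only [F, e4]
            rw [← e5]
            ring
          rw [e3, lintegral_const_mul (f := fun h : H => K.indicator 1 (h * g : G)) _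
            (hKm.comp (hval.mul_const _))]
          change _ = _ * D x g
          by_cases hfg : f g = 0
          · simp [hfg]
          · obtain ⟨h1, h2⟩ := cosetIntegral_indicator_ne M' hK hg.1 (hfK g hfg)
            rw [mul_assoc, mul_assoc, ENNReal.div_mul_cancel h1 h2]
      _ = ∫⁻ x, ∫⁻ g, ∫⁻ h : H, F ((x, g), h * g) ∂(η (g • x)) ∂(κ x) ∂lam := hswap.symm
      _ = ∫⁻ x, E.indicator (fun x => ∫⁻ g, A'.indicator 1 g * (K.indicator 1 g *
            (cosetIntegral η f x g / D x g)) ∂(κ x)) x ∂lam := by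
          refine lintegral_congr fun x => ?_
          have e2 : E.indicator (fun x => ∫⁻ g, A'.indicator 1 g * (K.indicator 1 g *
            (cosetIntegral η f x g / D x g)) ∂(κ x)) x =
              ∫⁻ g, E.indicator 1 x * (A'.indicator 1 g * (K.indicator 1 g *
            (cosetIntegral η f x g / D x g))) ∂(κ x) := by
            rw [lintegral_const_mul (f := fun g => A'.indicator 1 g * (K.indicator 1 g *
              (cosetIntegral η f x g / D x g))) _ (m2'.comp measurable_prodMk_left)]
            by_cases hxE : x ∈ E <;> simp [hxE]
          rw [e2]
          refine lintegral_congr fun g => ?_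
          have hfh : Measurable fun h : H => f (h * g) := hf.comp (hval.mul_const _)
          simp only [F, ENNReal.div_eq_inv_mul]
          rw [lintegral_const_mul _ ((((hfh.const_mul _)).const_mul _).const_mul _),
            lintegral_const_mul _ ((hfh.const_mul _).const_mul _),
            lintegral_const_mul _ (hfh.const_mul _), lintegral_const_mul _ hfh]
          rfl

/-- The image in `G ⧸ H` of the measure `f σ_x` has a density with respect to the image of `σ_x`
restricted to `K`, namely the ratio of the integrals on the cosets. This ratio is a function on the
quotient since the factor of `cosetIntegral_mul` cancels. -/
theorem ae_exists_density (M : MassTransport lam κ) (M' : MassTransport lam η) {K : Set G}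
    (hK : IsCompact K) {f : G → ℝ≥0∞} (hf : Measurable f) (hf1 : ∀ g, f g ≤ 1)
    (hfK : ∀ g, f g ≠ 0 → g ∈ interior K) :
    ∀ᵐ x ∂lam, ∃ r : G ⧸ H → ℝ≥0∞, Measurable r ∧
      (∀ g : G, g • x ∈ M'.core →
        r g = cosetIntegral η f x g / cosetIntegral η (K.indicator 1) x g) ∧
      ((κ x).withDensity f).map (QuotientGroup.mk : G → G ⧸ H) =
        (((κ x).restrict K).map QuotientGroup.mk).withDensity r := by
  have hKm : Measurable (K.indicator (1 : G → ℝ≥0∞)) := measurable_one.indicator hK.measurableSet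
  have hmk : Measurable (QuotientGroup.mk : G → G ⧸ H) :=
    (QuotientGroup.continuous_mk (N := H)).measurable
  filter_upwards [M.ae_map_withDensity_eq M' hK hf hf1 hfK, M.ae_ae_smul M'.ae_mem_core]
    with x hx hcore
  set R : G → ℝ≥0∞ := fun g => cosetIntegral η f x g / cosetIntegral η (K.indicator 1) x g with hR
  have hRm : Measurable R :=
    ((measurable_cosetIntegral hf).comp measurable_prodMk_left).div
      ((measurable_cosetIntegral hKm).comp measurable_prodMk_left)
  have hΩ : MeasurableSet {g : G | g • x ∈ M'.core} :=
    (measurable_id.smul_const x) M'.measurableSet_core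
  obtain ⟨r, hrm, hr⟩ := exists_measurable_factor (p := (QuotientGroup.mk : G → G ⧸ H))
    QuotientGroup.continuous_mk hΩ hRm (by
      intro g hg g' hg' he
      have hmem : g' * g⁻¹ ∈ H := by
        have := QuotientGroup.eq.1 he
        simpa [mul_assoc] using Subgroup.Normal.conj_mem ‹H.Normal› _ this g
      have e : ((⟨g' * g⁻¹, hmem⟩ : H) : G) * g = g' := by simp
      have h1 := cosetIntegral_mul M' hf (h := ⟨g' * g⁻¹, hmem⟩) hg (by rw [e]; exact hg')
      have h2 := cosetIntegral_mul M' hKm (h := ⟨g' * g⁻¹, hmem⟩) hg (by rw [e]; exact hg')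
      have hne := M'.cocycle_ne _ hg ⟨g' * g⁻¹, hmem⟩ (by
        change (g' * g⁻¹) • g • x ∈ _
        rw [← mul_smul, inv_mul_cancel_right]; exact hg')
      rw [e] at h1 h2
      simp only [hR, h1, h2]
      rw [ENNReal.mul_div_mul_left _ _ hne.1 hne.2])
  refine ⟨r, hrm, hr, ?_⟩
  rw [hx]
  refine Measure.ext_of_lintegral _ fun w hw => ?_
  have m1 : Measurable fun g => K.indicator 1 g * R g := hKm.mul hRm
  rw [lintegral_map hw hmk, lintegral_withDensity_eq_lintegral_mul (g := fun g : G => w g) _ m1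
    (hw.comp hmk),
    lintegral_withDensity_eq_lintegral_mul _ hrm hw, lintegral_map (hrm.mul hw) hmk,
    ← lintegral_indicator hK.measurableSet]
  refine lintegral_congr_ae ?_
  filter_upwards [hcore] with g hg
  have h1 := hr g hg
  by_cases hgK : g ∈ K
  · simp [hgK, h1]
  · simp [hgK]

end Coset

end MassTransport

/-! ### Limits of the averages over the cosets -/

section BumpFunction

variable {L : Type*} [Group L] [PseudoMetricSpace L]

/-- A Lipschitz bump function supported in the ball of radius `s` about the identity. -/
noncomputable def bump (s : ℝ) (k : L) : ℝ≥0∞ := ENNReal.ofReal (1 - dist k 1 / s)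

theorem continuous_bump (s : ℝ) : Continuous (bump s : L → ℝ≥0∞) :=
  ENNReal.continuous_ofReal.comp (by fun_prop)

theorem measurable_bump [MeasurableSpace L] [OpensMeasurableSpace L] (s : ℝ) :
    Measurable (bump s : L → ℝ≥0∞) := (continuous_bump s).measurable

theorem bump_le_one {s : ℝ} (hs : 0 < s) (k : L) : bump s k ≤ 1 := by
  rw [bump, ← ENNReal.ofReal_one]
  exact ENNReal.ofReal_le_ofReal (by have : 0 ≤ dist k 1 / s := by positivity
                                     linarith)

theorem bump_mono {s t : ℝ} (hs : 0 < s) (hst : s ≤ t) (k : L) : bump s k ≤ bump t k :=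
  ENNReal.ofReal_le_ofReal (by gcongr)

theorem bump_ne_zero_iff {s : ℝ} (hs : 0 < s) (k : L) : bump s k ≠ 0 ↔ dist k 1 < s := by
  rw [bump, Ne, ENNReal.ofReal_eq_zero, not_le, sub_pos, div_lt_one hs]

theorem le_bump {s t : ℝ} (hs : 0 < s) {k : L} (hk : dist k 1 ≤ t * s) :
    ENNReal.ofReal (1 - t) ≤ bump s k := by
  refine ENNReal.ofReal_le_ofReal ?_
  have : dist k 1 / s ≤ t := (div_le_iff₀ hs).2 hk
  linarith

theorem dist_mul_inv_one [IsIsometricSMul Lᵐᵒᵖ L] (k g : L) : dist (k * g⁻¹) 1 = dist k g := by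
  rw [← dist_mul_right (k * g⁻¹) 1 g, inv_mul_cancel_right, one_mul]

theorem dist_inv_one [IsIsometricSMul Lᵐᵒᵖ L] (g : L) : dist g⁻¹ 1 = dist g 1 := by
  rw [← dist_mul_right g⁻¹ 1 g, inv_mul_cancel, one_mul, dist_comm]

theorem bump_mul_inv_le [IsIsometricSMul Lᵐᵒᵖ L] {s : ℝ} (hs : 0 < s) (k g p : L) :
    bump s (k * g⁻¹) ≤ bump s (k * p⁻¹) + ENNReal.ofReal (dist g p / s) := by
  rw [bump, bump, dist_mul_inv_one, dist_mul_inv_one]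
  rcases le_total 0 (1 - dist k p / s) with h | h
  · rw [← ENNReal.ofReal_add h (by positivity)]
    refine ENNReal.ofReal_le_ofReal ?_
    have : dist k p / s ≤ dist k g / s + dist g p / s := by
      rw [← add_div]; gcongr; exact dist_triangle _ _ _
    linarith
  · rw [ENNReal.ofReal_of_nonpos h, zero_add]
    refine ENNReal.ofReal_le_ofReal ?_
    have : dist k p / s ≤ dist k g / s + dist g p / s := by
      rw [← add_div]; gcongr; exact dist_triangle _ _ _
    linarith

end BumpFunction

section Subgroups

variable {G : Type*} [Group G] [MetricSpace G] (H : Subgroup G)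

instance properSpace_subgroup [ProperSpace G] [hH : IsClosed (H : Set G)] : ProperSpace H :=
  ProperSpace.of_isClosed hH

instance isIsometricSMul_op_subgroup [IsIsometricSMul Gᵐᵒᵖ G] : IsIsometricSMul Hᵐᵒᵖ H :=
  ⟨fun c => Isometry.of_dist_eq fun a b => dist_mul_right (a : G) b c.unop⟩

end Subgroups

section QuotientMetric

variable {G : Type*} [Group G] [MetricSpace G] [IsIsometricSMul Gᵐᵒᵖ G] {H : Subgroup G}

theorem dist_mk_le (g k : G) : dist (g : G ⧸ H) (k : G ⧸ H) ≤ dist g k := quotDist_le H g k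

theorem exists_of_dist_mk_lt (g k : G) {ε : ℝ} (h : dist (g : G ⧸ H) (k : G ⧸ H) < ε) :
    ∃ k' : G, (k' : G ⧸ H) = k ∧ dist g k' < ε := exists_of_quotDist_lt H g k h

/-- A map of the group that preserves the cosets and multiplies the distances multiplies the
distances in the quotient. -/
theorem dist_mk_map_le {φ : G → G} {a : ℝ} (ha : 0 ≤ a) (hφ : ∀ g k, dist (φ g) (φ k) = a * dist g k)
    (hφH : ∀ g k : G, (g : G ⧸ H) = k → (φ g : G ⧸ H) = φ k) (g k : G) :
    dist (φ g : G ⧸ H) (φ k : G ⧸ H) ≤ a * dist (g : G ⧸ H) (k : G ⧸ H) := by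
  refine le_of_forall_pos_le_add fun ε hε => ?_
  obtain ⟨δ, hδ, hδε⟩ : ∃ δ > 0, a * δ ≤ ε := by
    refine ⟨ε / (a + 1), by positivity, ?_⟩
    rw [mul_div_assoc', div_le_iff₀ (by positivity)]
    nlinarith
  obtain ⟨k', hk', hd⟩ := exists_of_dist_mk_lt g k (lt_add_of_pos_right _ hδ)
  rw [← hφH _ _ hk']
  calc _ ≤ dist (φ g) (φ k') := dist_mk_le _ _
    _ = a * dist g k' := hφ _ _
    _ ≤ a * (dist (g : G ⧸ H) (k : G ⧸ H) + δ) := by gcongr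
    _ ≤ _ := by rw [mul_add]; gcongr

variable [H.Normal]

theorem dist_mk_mul_inv (k g : G) :
    dist ((k * g⁻¹ : G) : G ⧸ H) (1 : G) = dist (k : G ⧸ H) (g : G ⧸ H) := by
  have key : ∀ a b c : G, dist ((a * c : G) : G ⧸ H) (b * c : G) ≤ dist (a : G ⧸ H) b := by
    intro a b c
    have := dist_mk_map_le (H := H) (φ := fun g => g * c) zero_le_one
      (fun g k => by rw [one_mul]; exact dist_mul_right _ _ _)
      (fun g k h => by rw [QuotientGroup.mk_mul, QuotientGroup.mk_mul, h]) a b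
    rwa [one_mul] at this
  have h1 := key k g g⁻¹
  have h2 := key (k * g⁻¹) 1 g
  rw [mul_inv_cancel] at h1
  rw [inv_mul_cancel_right, one_mul] at h2
  exact le_antisymm h1 h2

variable (H) in
/-- The points of the group whose coset is at distance at most `r` from that of `g`. -/
def tube (g : G) (r : ℝ) : Set G := {k | dist (k : G ⧸ H) (g : G ⧸ H) ≤ r}

theorem mem_tube_mul_inv {g k : G} {r : ℝ} : k * g⁻¹ ∈ tube H 1 r ↔ k ∈ tube H g r := by
  rw [tube, tube, Set.mem_ofPred_eq, Set.mem_ofPred_eq, dist_mk_mul_inv]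

theorem isClosed_tube (g : G) (r : ℝ) : IsClosed (tube H g r) :=
  Metric.isClosed_closedBall.preimage (QuotientGroup.continuous_mk (N := H))

theorem ball_subset_tube (g : G) (r : ℝ) : Metric.ball g r ⊆ tube H g r := fun _ hk =>
  (dist_mk_le _ _).trans (Metric.mem_ball.1 hk).le

end QuotientMetric

section Limit

theorem abs_toReal_sub_le {a b c : ℝ≥0∞} {ε : ℝ} (hε : 0 ≤ ε) (ha : a ≠ ∞) (hb : b ≠ ∞)
    (hc : c ≠ ∞) (h1 : a ≤ b + ENNReal.ofReal ε * c) (h2 : b ≤ a + ENNReal.ofReal ε * c) :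
    |a.toReal - b.toReal| ≤ ε * c.toReal := by
  have hm : ENNReal.ofReal ε * c ≠ ∞ := ENNReal.mul_ne_top ENNReal.ofReal_ne_top hc
  have e : (ENNReal.ofReal ε * c).toReal = ε * c.toReal := by
    rw [ENNReal.toReal_mul, ENNReal.toReal_ofReal hε]
  have h3 := ENNReal.toReal_mono (ENNReal.add_ne_top.2 ⟨hb, hm⟩) h1
  have h4 := ENNReal.toReal_mono (ENNReal.add_ne_top.2 ⟨ha, hm⟩) h2
  rw [ENNReal.toReal_add hb hm, e] at h3
  rw [ENNReal.toReal_add ha hm, e] at h4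
  rw [abs_le]
  constructor <;> linarith

variable {G X : Type*} [Group G] [MetricSpace G] [IsTopologicalGroup G] [ProperSpace G]
  [PolishSpace G] [MeasurableSpace G] [BorelSpace G] [IsIsometricSMul Gᵐᵒᵖ G]
  [MeasurableSpace X] [StandardBorelSpace X] [MulAction G X] [MeasurableSMul₂ G X]
  {lam : Measure X} [IsFiniteMeasure lam] {H : Subgroup G} [hH : IsClosed (H : Set G)] [H.Normal]
  {κ : Kernel X G} [IsSFiniteKernel κ] {η : Kernel X H} [IsSFiniteKernel η]

namespace MassTransport

theorem lintegral_bump_ne_top {L : Type*} [Group L] [MetricSpace L] [IsTopologicalGroup L]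
    [ProperSpace L] [PolishSpace L] [MeasurableSpace L] [BorelSpace L]
    [MulAction L X] [MeasurableSMul₂ L X] {κ : Kernel X L} (M : MassTransport lam κ) {s : ℝ}
    (hs : 0 < s) (x : X) : ∫⁻ k, bump s k ∂(κ x) ≠ ∞ := by
  refine ne_top_of_le_ne_top ((M.regular x).2 _ (isCompact_closedBall (1 : L) s)) ?_
  rw [← lintegral_indicator_one Metric.isClosed_closedBall.measurableSet]
  refine lintegral_mono fun k => ?_
  by_cases hk : k ∈ Metric.closedBall (1 : L) s
  · rw [Set.indicator_of_mem hk]; exact bump_le_one hs k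
  · rw [Set.indicator_of_notMem hk]
    have : bump s k = 0 := by
      by_contra h
      exact hk (Metric.mem_closedBall.2 ((bump_ne_zero_iff hs k).1 h).le)
    exact this.le

theorem lintegral_bump_ne_zero {L : Type*} [Group L] [MetricSpace L] [IsTopologicalGroup L]
    [ProperSpace L] [PolishSpace L] [MeasurableSpace L] [BorelSpace L]
    [MulAction L X] [MeasurableSMul₂ L X] {κ : Kernel X L} (M : MassTransport lam κ) {s : ℝ}
    (hs : 0 < s) {x : X} (hx : x ∈ M.core) {T : Set L} (hT : T ∈ 𝓝 (1 : L)) :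
    ∫⁻ k in T, bump s k ∂(κ x) ≠ 0 := by
  have h1 := M.nhds_pos x hx _ (Filter.inter_mem hT (Metric.ball_mem_nhds (1 : L) hs))
  rw [Ne, lintegral_eq_zero_iff (measurable_bump s)]
  intro h
  refine h1 (measure_mono_null (t := T ∩ {k | bump s k ≠ 0}) ?_ ?_)
  · exact fun k hk => ⟨hk.1, (bump_ne_zero_iff hs k).2 hk.2⟩
  · have hm : MeasurableSet {k : L | bump s k ≠ 0} :=
      ((measurable_bump s) (measurableSet_singleton 0)).compl
    rw [Set.inter_comm, ← Measure.restrict_apply hm]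
    exact h

/-- The translated bump functions have limit averages on the small tubes. The differentiation
theorem gives this for the bump functions centred at the points of a countable dense set. -/
theorem ae_tendsto_tube (M : MassTransport lam κ) (M' : MassTransport lam η) {N : ℕ}
    (hN : HasBesicovitchBound (G ⧸ H) N) {s : ℝ} (hs : 0 < s) (hs1 : s ≤ 1) :
    ∀ᵐ x ∂lam, ∀ᵐ g ∂(κ x), g ∈ Metric.ball (1 : G) 1 →
      Tendsto (fun r => (∫⁻ k in tube H g r, bump s (k * g⁻¹) ∂(κ x)).toReal /
        (κ x (Metric.closedBall 1 2 ∩ tube H g r)).toReal) (𝓝[>] 0)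
      (𝓝 ((∫⁻ h, bump s h ∂(η (g • x))).toReal /
        (cosetIntegral η ((Metric.closedBall 1 2).indicator 1) x g).toReal)) := by
  set K : Set G := Metric.closedBall 1 2 with hKdef
  have hK : IsCompact K := isCompact_closedBall _ _
  have hKm : MeasurableSet K := hK.measurableSet
  have hmk : Measurable (QuotientGroup.mk : G → G ⧸ H) :=
    (QuotientGroup.continuous_mk (N := H)).measurable
  have hint : ∀ p ∈ Metric.ball (1 : G) 1, ∀ k, bump s (k * p⁻¹) ≠ 0 → k ∈ interior K := by
    intro p hp k hk
    rw [bump_ne_zero_iff hs, dist_mul_inv_one] at hk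
    refine Metric.ball_subset_interior_closedBall (Metric.mem_ball.2 ?_)
    calc dist k 1 ≤ dist k p + dist p 1 := dist_triangle _ _ _
      _ < 1 + 1 := add_lt_add_of_lt_of_lt (hk.trans_le hs1) (Metric.mem_ball.1 hp)
      _ = 2 := by norm_num
  have hbm : ∀ p : G, Measurable fun k : G => bump s (k * p⁻¹) := fun p =>
    (measurable_bump s).comp (measurable_mul_const _)
  let pt : ℕ → G := TopologicalSpace.denseSeq G
  have hdens : ∀ᵐ x ∂lam, ∀ i, pt i ∈ Metric.ball (1 : G) 1 →
      ∃ r : G ⧸ H → ℝ≥0∞, Measurable r ∧ (∀ g : G, g • x ∈ M'.core →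
        r g = cosetIntegral η (fun k => bump s (k * (pt i)⁻¹)) x g /
          cosetIntegral η (K.indicator 1) x g) ∧
        ((κ x).withDensity fun k => bump s (k * (pt i)⁻¹)).map (QuotientGroup.mk : G → G ⧸ H) =
          (((κ x).restrict K).map QuotientGroup.mk).withDensity r := ae_all_iff.2 fun i =>
    (ae_all_iff (ι := pt i ∈ Metric.ball (1 : G) 1)).2 fun hi =>
      M.ae_exists_density M' hK (hbm (pt i)) (fun g => bump_le_one hs _) (hint _ hi)
  filter_upwards [hdens, M.ae_ae_smul M'.ae_mem_core] with x hx hcore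
  set θ := ((κ x).restrict K).map (QuotientGroup.mk : G → G ⧸ H) with hθ
  have hKfin : κ x K ≠ ∞ := (M.regular x).2 K hK
  have hrfin : IsFiniteMeasure ((κ x).restrict K) := ⟨by
    rw [Measure.restrict_apply_univ]; exact hKfin.lt_top⟩
  have hθfin : IsFiniteMeasure θ := by rw [hθ]; infer_instance
  have hθball : ∀ (g : G) (r : ℝ), θ (Metric.closedBall (g : G ⧸ H) r) = κ x (K ∩ tube H g r) := by
    intro g r
    rw [hθ, Measure.map_apply hmk Metric.isClosed_closedBall.measurableSet,
      Measure.restrict_apply (hmk Metric.isClosed_closedBall.measurableSet), Set.inter_comm]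
    rfl
  choose R hRm hRcore hRden using hx
  -- the integrals of the bump functions on the tubes
  let Θ : G → G → ℝ → ℝ≥0∞ := fun p g r => ∫⁻ k in tube H g r, bump s (k * p⁻¹) ∂(κ x)
  have hΘle : ∀ p ∈ Metric.ball (1 : G) 1, ∀ g r, Θ p g r ≤ κ x K := by
    intro p hp g r
    calc Θ p g r ≤ ∫⁻ k, bump s (k * p⁻¹) ∂(κ x) := setLIntegral_le_lintegral _ _
      _ ≤ ∫⁻ k, K.indicator 1 k ∂(κ x) := by
        refine lintegral_mono fun k => ?_
        by_cases hk : bump s (k * p⁻¹) = 0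
        · rw [hk]; exact zero_le
        · rw [Set.indicator_of_mem (interior_subset (hint p hp k hk))]; exact bump_le_one hs _
      _ = κ x K := lintegral_indicator_one hKm
  have hΘfin : ∀ p ∈ Metric.ball (1 : G) 1, ∀ g r, Θ p g r ≠ ∞ := fun p hp g r =>
    ne_top_of_le_ne_top hKfin (hΘle p hp g r)
  have hRΘ : ∀ i hi (g : G) r, ∫⁻ z in Metric.closedBall (g : G ⧸ H) r, R i hi z ∂θ = Θ (pt i) g r := by
    intro i hi g r
    rw [← withDensity_apply _ Metric.isClosed_closedBall.measurableSet, ← hRden i hi,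
      Measure.map_apply hmk Metric.isClosed_closedBall.measurableSet,
      withDensity_apply _ (hmk Metric.isClosed_closedBall.measurableSet)]
    rfl
  have hRint : ∀ i hi, ∫⁻ z, R i hi z ∂θ ≠ ∞ := by
    intro i hi
    rw [← setLIntegral_univ, ← withDensity_apply _ MeasurableSet.univ, ← hRden i hi,
      Measure.map_apply hmk MeasurableSet.univ, withDensity_apply _ (hmk MeasurableSet.univ)]
    refine ne_top_of_le_ne_top hKfin ((setLIntegral_le_lintegral _ _).trans ?_)
    rw [← lintegral_indicator_one hKm]
    refine lintegral_mono fun k => ?_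
    by_cases hk : bump s (k * (pt i)⁻¹) = 0
    · rw [hk]; exact zero_le
    · rw [Set.indicator_of_mem (interior_subset (hint _ hi k hk))]; exact bump_le_one hs _
  have hdiff : ∀ᵐ q ∂θ, ∀ i (hi : pt i ∈ Metric.ball (1 : G) 1), ∀ ε : ℝ, 0 < ε →
      ∀ᶠ r in 𝓝[>] (0 : ℝ), |∫ z in Metric.closedBall q r, (R i hi z).toReal ∂θ -
        (R i hi q).toReal * θ.real (Metric.closedBall q r)| ≤
          ε * θ.real (Metric.closedBall q r) :=
    ae_all_iff.2 fun i => (ae_all_iff (ι := pt i ∈ Metric.ball (1 : G) 1)).2 fun hi =>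
      hN.ae_differentiation θ
        (integrable_toReal_of_lintegral_ne_top (hRm i hi).aemeasurable (hRint i hi))
  have hgood := ae_of_ae_map hmk.aemeasurable (hdiff.and (ae_measure_closedBall_pos θ))
  rw [ae_restrict_iff' hKm] at hgood
  filter_upwards [hgood, hcore] with g hg hgcore hg1
  have hgK : g ∈ interior K := hint g hg1 g (by
    rw [mul_inv_cancel, bump_ne_zero_iff hs, dist_self]; exact hs)
  obtain ⟨hd, hpos⟩ := hg (interior_subset hgK)
  set C := cosetIntegral η (K.indicator 1) x g with hC
  obtain ⟨hC0, hCt⟩ := cosetIntegral_indicator_ne M' hK hgcore hgK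
  have hCr : 0 < C.toReal := ENNReal.toReal_pos hC0 hCt
  let c : G → ℝ≥0∞ := fun p => cosetIntegral η (fun k => bump s (k * p⁻¹)) x g
  have hcg : c g = ∫⁻ h, bump s h ∂(η (g • x)) := by
    refine lintegral_congr fun h => ?_
    simp only [mul_inv_cancel_right]
    rfl
  have hcle : ∀ p ∈ Metric.ball (1 : G) 1, c p ≤ C := by
    intro p hp
    refine lintegral_mono fun h => ?_
    change bump s (h * g * p⁻¹) ≤ K.indicator 1 (h * g : G)
    by_cases hk : bump s (h * g * p⁻¹) = 0
    · rw [hk]; exact zero_le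
    · rw [Set.indicator_of_mem (interior_subset (hint p hp _ hk))]; exact bump_le_one hs _
  have hcfin : ∀ p ∈ Metric.ball (1 : G) 1, c p ≠ ∞ := fun p hp =>
    ne_top_of_le_ne_top hCt (hcle p hp)
  -- the bump functions, hence their integrals on tubes and cosets, depend on the centre in a
  -- Lipschitz way
  have hlip : ∀ p ∈ Metric.ball (1 : G) 1, ∀ p' ∈ Metric.ball (1 : G) 1, ∀ k,
      bump s (k * p⁻¹) ≤ bump s (k * p'⁻¹) + ENNReal.ofReal (dist p p' / s) * K.indicator 1 k := by
    intro p hp p' hp' k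
    by_cases hk : bump s (k * p⁻¹) = 0
    · rw [hk]; exact zero_le
    · rw [Set.indicator_of_mem (interior_subset (hint p hp _ hk)), Pi.one_apply, mul_one]
      exact bump_mul_inv_le hs _ _ _
  have hKi : Measurable (K.indicator (1 : G → ℝ≥0∞)) := measurable_one.indicator hKm
  have hΘlip : ∀ p ∈ Metric.ball (1 : G) 1, ∀ p' ∈ Metric.ball (1 : G) 1, ∀ r,
      Θ p g r ≤ Θ p' g r + ENNReal.ofReal (dist p p' / s) * κ x (K ∩ tube H g r) := by
    intro p hp p' hp' r
    calc Θ p g r ≤ ∫⁻ k in tube H g r, (bump s (k * p'⁻¹) +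
          ENNReal.ofReal (dist p p' / s) * K.indicator 1 k) ∂(κ x) :=
          lintegral_mono fun k => hlip p hp p' hp' k
      _ = _ := by
          rw [lintegral_add_left (hbm p'), lintegral_const_mul _ hKi, lintegral_indicator_one hKm,
            Measure.restrict_apply hKm]
  have hclip : ∀ p ∈ Metric.ball (1 : G) 1, ∀ p' ∈ Metric.ball (1 : G) 1,
      c p ≤ c p' + ENNReal.ofReal (dist p p' / s) * C := by
    intro p hp p' hp'
    have hval : Measurable fun h : H => (h : G) * g := measurable_subtype_coe.mul_const g
    calc c p ≤ ∫⁻ h : H, (bump s (h * g * p'⁻¹) +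
          ENNReal.ofReal (dist p p' / s) * K.indicator 1 (h * g : G)) ∂(η (g • x)) :=
          lintegral_mono fun h => hlip p hp p' hp' _
      _ = _ := by
          rw [lintegral_add_left (f := fun h : H => bump s (h * g * p'⁻¹)) ((hbm p').comp hval),
            lintegral_const_mul (f := fun h : H => K.indicator 1 (h * g : G)) _ (hKi.comp hval)]
          rfl
  rw [← hcg, Metric.tendsto_nhds]
  intro ε hε
  -- the centre `g` is replaced by a close point of the dense sequence
  obtain ⟨i, hi⟩ : ∃ i, pt i ∈ Metric.ball (1 : G) 1 ∩ Metric.ball g (s * (ε / 4)) :=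
    (TopologicalSpace.denseRange_denseSeq G).exists_mem_open
      (Metric.isOpen_ball.inter Metric.isOpen_ball) ⟨g, hg1, Metric.mem_ball_self (by positivity)⟩
  obtain ⟨hi1, hi2⟩ := hi
  have hdist : dist g (pt i) / s ≤ ε / 4 := by
    rw [div_le_iff₀ hs, mul_comm, dist_comm]; exact (Metric.mem_ball.1 hi2).le
  have hdist' : dist (pt i) g / s ≤ ε / 4 := by rwa [dist_comm]
  have hRi : (R i hi1 g).toReal = (c (pt i)).toReal / C.toReal := by
    rw [hRcore i hi1 g hgcore, ENNReal.toReal_div]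
  have hcdiff : |(c g).toReal - (c (pt i)).toReal| ≤ ε / 4 * C.toReal := by
    refine abs_toReal_sub_le (by positivity) (hcfin g hg1) (hcfin _ hi1) hCt ?_ ?_
    · exact (hclip g hg1 _ hi1).trans (by gcongr)
    · exact (hclip _ hi1 g hg1).trans (by gcongr)
  filter_upwards [hd i hi1 (ε / 4) (by positivity), self_mem_nhdsWithin] with r hr hr0
  have hr0' : (0 : ℝ) < r := hr0
  set t := (κ x (K ∩ tube H g r)).toReal with ht
  have hθr : θ.real (Metric.closedBall (g : G ⧸ H) r) = t := by
    rw [Measure.real, hθball]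
  have htpos : 0 < t := by
    rw [← hθr]
    exact ENNReal.toReal_pos (hpos r hr0').ne' (measure_ne_top _ _)
  have hKr : κ x (K ∩ tube H g r) ≠ ∞ := ne_top_of_le_ne_top hKfin
    (measure_mono Set.inter_subset_left)
  have hΘdiff : |(Θ g g r).toReal - (Θ (pt i) g r).toReal| ≤ ε / 4 * t := by
    refine abs_toReal_sub_le (by positivity) (hΘfin g hg1 _ _) (hΘfin _ hi1 _ _) hKr ?_ ?_
    · exact (hΘlip g hg1 _ hi1 r).trans (by gcongr)
    · exact (hΘlip _ hi1 g hg1 r).trans (by gcongr)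
  have hInt : ∫ z in Metric.closedBall (g : G ⧸ H) r, (R i hi1 z).toReal ∂θ =
      (Θ (pt i) g r).toReal := by
    rw [← hRΘ i hi1 g r, integral_toReal (hRm i hi1).aemeasurable]
    refine ae_lt_top (hRm i hi1) ?_
    exact ne_top_of_le_ne_top (hRint i hi1) (setLIntegral_le_lintegral _ _)
  rw [hInt, hθr, hRi] at hr
  rw [Real.dist_eq]
  have e1 : (Θ g g r).toReal / t - (c g).toReal / C.toReal =
      ((Θ g g r).toReal - (Θ (pt i) g r).toReal) / t +
      ((Θ (pt i) g r).toReal - (c (pt i)).toReal / C.toReal * t) / t -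
      ((c g).toReal - (c (pt i)).toReal) / C.toReal := by
    field_simp
    ring
  have b1 : |((Θ g g r).toReal - (Θ (pt i) g r).toReal) / t| ≤ ε / 4 := by
    rw [abs_div, abs_of_pos htpos, div_le_iff₀ htpos]; exact hΘdiff
  have b2 : |((Θ (pt i) g r).toReal - (c (pt i)).toReal / C.toReal * t) / t| ≤ ε / 4 := by
    rw [abs_div, abs_of_pos htpos, div_le_iff₀ htpos]; exact hr
  have b3 : |((c g).toReal - (c (pt i)).toReal) / C.toReal| ≤ ε / 4 := by
    rw [abs_div, abs_of_pos hCr, div_le_iff₀ hCr]; exact hcdiff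
  change |(Θ g g r).toReal / t - (c g).toReal / C.toReal| < ε
  rw [e1]
  calc _ ≤ |((Θ g g r).toReal - (Θ (pt i) g r).toReal) / t| +
        |((Θ (pt i) g r).toReal - (c (pt i)).toReal / C.toReal * t) / t| +
        |((c g).toReal - (c (pt i)).toReal) / C.toReal| :=
        (abs_sub _ _).trans (add_le_add_left (abs_add_le _ _) _)
    _ ≤ ε / 4 + ε / 4 + ε / 4 := by gcongr
    _ < ε := by linarith

end MassTransport

end Limit

/-! ### The maximal inequality along the orbits -/

namespace MassTransport

section

variable {L X : Type*} [Group L] [TopologicalSpace L] [IsTopologicalGroup L] [PolishSpace L]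
  [MeasurableSpace L] [BorelSpace L] [LocallyCompactSpace L]
  [MeasurableSpace X] [StandardBorelSpace X] [MulAction L X] [MeasurableSMul₂ L X]
  {lam : Measure X} [IsFiniteMeasure lam] {κ : Kernel X L} [IsSFiniteKernel κ]

theorem nhds_smul_pos (M : MassTransport lam κ) {x : X} (hx : x ∈ M.core) {g : L}
    (hg : g • x ∈ M.core) {U : Set L} (hU : U ∈ 𝓝 g) : κ x U ≠ 0 := by
  have h1 := M.nhds_pos _ hg ((fun k => k * g) ⁻¹' U)
    ((continuous_mul_const g).continuousAt.preimage_mem_nhds (by rwa [one_mul]))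
  rw [M.transl x hx g hg, Measure.smul_apply, smul_eq_mul] at h1
  have h2 := right_ne_zero_of_mul h1
  have e : (κ x).map (fun k => k * g⁻¹) ((fun k => k * g) ⁻¹' U) = κ x U := by
    refine ((MeasurableEquiv.mulRight g⁻¹).map_apply _).trans ?_
    change κ x ((fun k => k * g⁻¹) ⁻¹' _) = _
    rw [← Set.preimage_comp]
    congr 1
    ext k
    simp
  rwa [e] at h2

/-- A property that holds at almost every nearby translate of almost every point holds almost
everywhere. -/
theorem ae_of_ae_ae_smul (M : MassTransport lam κ) {P : X → Prop} (hP : MeasurableSet {x | P x})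
    {B : Set L} (hB : B ∈ 𝓝 (1 : L)) (hBm : MeasurableSet B)
    (h : ∀ᵐ x ∂lam, ∀ᵐ g ∂(κ x), g ∈ B → P (g • x)) : ∀ᵐ x ∂lam, P x := by
  let bad : X → ℝ≥0∞ := {x | P x}ᶜ.indicator 1
  have hbad : Measurable bad := measurable_one.indicator hP.compl
  have hBi : Measurable (B.indicator (1 : L → ℝ≥0∞)) := measurable_one.indicator hBm
  have hu : Measurable fun q : X × L => B.indicator 1 q.2 * bad (q.2 • q.1) :=
    (hBi.comp measurable_snd).mul (hbad.comp (measurable_snd.smul measurable_fst))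
  have h1 := M.lintegral_eq _ hu
  have h2 : ∫⁻ x, ∫⁻ l, B.indicator 1 l * bad (l • x) ∂(κ x) ∂lam = 0 := by
    refine lintegral_eq_zero_of_ae_eq_zero ?_
    filter_upwards [h] with x hx
    refine lintegral_eq_zero_of_ae_eq_zero ?_
    filter_upwards [hx] with g hg
    by_cases hgB : g ∈ B
    · have : bad (g • x) = 0 := Set.indicator_of_notMem (Set.notMem_compl_iff.2 (hg hgB)) _
      simp [this]
    · simp [hgB]
  simp only [] at h1
  rw [h2] at h1
  have hu' : Measurable fun q : X × L =>
      B.indicator 1 q.2⁻¹ * bad (q.2⁻¹ • q.2 • q.1) * M.cocycle q.2 q.1 :=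
    ((hBi.comp measurable_snd.inv).mul (hbad.comp (measurable_snd.inv.smul
      (measurable_snd.smul measurable_fst)))).mul (M.measurable_cocycle.comp measurable_swap)
  have h3 := (lintegral_eq_zero_iff hu'.lintegral_kernel_prod_right').1 h1.symm
  -- by mass transport, for almost every `y`, the bad set is null or `B⁻¹` has measure `0`; the latter
  -- is excluded since `B⁻¹` is a neighbourhood of the identity
  filter_upwards [h3, M.ae_mem_core, M.ae_ae_smul M.ae_mem_core] with y hy hy1 hy2
  by_contra hPy
  have hby : bad y = 1 := Set.indicator_of_mem hPy _
  have hy' : ∫⁻ l, B.indicator 1 l⁻¹ * bad (l⁻¹ • l • y) * M.cocycle l y ∂(κ y) = 0 := hy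
  have hum : Measurable fun l => B.indicator 1 l⁻¹ * bad (l⁻¹ • l • y) * M.cocycle l y :=
    hu'.comp (measurable_prodMk_left (x := y))
  have h4 := (lintegral_eq_zero_iff hum).1 hy'
  have hBinv : B⁻¹ ∈ 𝓝 (1 : L) := inv_mem_nhds_one L hB
  refine M.nhds_pos y hy1 _ hBinv (measure_eq_zero_iff_ae_notMem.2 ?_)
  filter_upwards [h4, hy2] with l hl hl2 hmem
  have hmem' : l⁻¹ ∈ B := hmem
  simp only [Pi.zero_apply, inv_smul_smul, hby, Set.indicator_of_mem hmem', Pi.one_apply,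
    one_mul] at hl
  exact (M.cocycle_ne y hy1 l hl2).1 hl

end

section Metric

variable {G X : Type*} [Group G] [MetricSpace G] [IsTopologicalGroup G] [ProperSpace G]
  [PolishSpace G] [MeasurableSpace G] [BorelSpace G] [IsIsometricSMul Gᵐᵒᵖ G]
  [MeasurableSpace X] [StandardBorelSpace X] [MulAction G X] [MeasurableSMul₂ G X]
  {lam : Measure X} [IsFiniteMeasure lam]
  {κ : Kernel X G} [IsSFiniteKernel κ]

theorem measure_smul (M : MassTransport lam κ) {x : X} (hx : x ∈ M.core) {g : G}
    (hg : g • x ∈ M.core) {E : Set G} (hE : MeasurableSet E) :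
    κ (g • x) E = M.cocycle g x * κ x ((fun k => k * g⁻¹) ⁻¹' E) := by
  rw [M.transl x hx g hg, Measure.smul_apply, smul_eq_mul,
    Measure.map_apply (measurable_mul_const _) hE]

theorem preimage_ball_one (g : G) (r : ℝ) :
    (fun k => k * g⁻¹) ⁻¹' Metric.ball 1 r = Metric.ball g r := by
  ext k
  rw [Set.mem_preimage, Metric.mem_ball, dist_mul_inv_one, Metric.mem_ball]

theorem measure_ball_ne_top (M : MassTransport lam κ) (x : X) (g : G) (r : ℝ) :
    κ x (Metric.ball g r) ≠ ∞ :=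
  ne_top_of_le_ne_top ((M.regular x).2 _ (isCompact_closedBall g r))
    (measure_mono Metric.ball_subset_closedBall)

/-- The mass transport formula for the measures of a ball. -/
theorem lintegral_mul_measure_ball (M : MassTransport lam κ) {w : X → ℝ≥0∞} (hw : Measurable w)
    (R : ℝ) : ∫⁻ x, w x * κ x (Metric.ball 1 R) ∂lam =
      ∫⁻ y, ∫⁻ g in Metric.ball 1 R, w (g • y) * M.cocycle g y ∂(κ y) ∂lam := by
  have hbm : MeasurableSet (Metric.ball (1 : G) R) := Metric.isOpen_ball.measurableSet
  have hi : Measurable ((Metric.ball (1 : G) R).indicator (1 : G → ℝ≥0∞)) :=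
    measurable_one.indicator hbm
  have h := M.lintegral_eq (fun q => w q.1 * (Metric.ball (1 : G) R).indicator 1 q.2)
    ((hw.comp measurable_fst).mul (hi.comp measurable_snd))
  calc _ = ∫⁻ x, ∫⁻ l, w x * (Metric.ball (1 : G) R).indicator 1 l ∂(κ x) ∂lam := by
        refine lintegral_congr fun x => ?_
        rw [lintegral_const_mul _ hi, lintegral_indicator_one hbm]
    _ = _ := h
    _ = _ := by
        refine lintegral_congr fun y => ?_
        rw [← lintegral_indicator hbm]
        refine lintegral_congr fun g => ?_
        have hinv : g⁻¹ ∈ Metric.ball (1 : G) R ↔ g ∈ Metric.ball (1 : G) R := by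
          rw [Metric.mem_ball, Metric.mem_ball, dist_inv_one]
        by_cases hg : g ∈ Metric.ball (1 : G) R
        · simp only [Set.indicator_of_mem hg, Set.indicator_of_mem (hinv.2 hg), Pi.one_apply,
            mul_one]
        · simp only [Set.indicator_of_notMem hg,
            Set.indicator_of_notMem (fun h => hg (hinv.1 h)), mul_zero, zero_mul]

theorem exists_finset_cover (R : ℝ) {ε : ℝ} (hε : 0 < ε) :
    ∃ t : Finset G, Metric.ball (1 : G) R ⊆ ⋃ p ∈ t, Metric.ball p ε := by
  obtain ⟨t, -, ht, hcov⟩ := (isCompact_closedBall (1 : G) R).finite_cover_balls hε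
  refine ⟨ht.toFinset, Metric.ball_subset_closedBall.trans ?_⟩
  simpa using hcov

theorem setLIntegral_le_sum {ν : Measure G} {A : Set G} {t : Finset G} {ε : ℝ}
    (hcov : A ⊆ ⋃ p ∈ t, Metric.ball p ε) (f : G → ℝ≥0∞) :
    ∫⁻ g in A, f g ∂ν ≤ ∑ p ∈ t, ∫⁻ g in Metric.ball p ε, f g ∂ν :=
  (lintegral_mono_set hcov).trans (by
    rw [← lintegral_finsetSum_measure]
    refine lintegral_mono' ?_ le_rfl
    rw [← Measure.sum_coe_finset]
    have := Measure.restrict_biUnion_le (μ := ν) (T := t) t.countable_toSet (s := fun p => Metric.ball p ε)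
    simpa using this)

theorem ball_subset_ball_of_mem {p g : G} {ε : ℝ} (hg : g ∈ Metric.ball p (ε / 2)) :
    Metric.ball p (ε / 2) ⊆ Metric.ball g ε := by
  intro k hk
  rw [Metric.mem_ball] at *
  calc dist k g ≤ dist k p + dist p g := dist_triangle _ _ _
    _ < ε / 2 + ε / 2 := add_lt_add hk (by rwa [dist_comm])
    _ = ε := add_halves _

/-- The doubling ratio of the disintegration is integrable: in the mean, the growth of the measure
of a ball is at most the number of balls needed for a covering. -/
theorem lintegral_div_measure_ball_le (M : MassTransport lam κ) (R : ℝ) {ε : ℝ} (hε : 0 < ε) :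
    ∃ n : ℕ, ∫⁻ x, κ x (Metric.ball 1 R) / κ x (Metric.ball 1 ε) ∂lam ≤ n * lam Set.univ := by
  obtain ⟨t, ht⟩ := exists_finset_cover (G := G) R (half_pos hε)
  refine ⟨t.card, ?_⟩
  have hbm : MeasurableSet (Metric.ball (1 : G) ε) := Metric.isOpen_ball.measurableSet
  have hw : Measurable fun x => (κ x (Metric.ball 1 ε))⁻¹ := (κ.measurable_coe hbm).inv
  simp only [ENNReal.div_eq_inv_mul]
  rw [M.lintegral_mul_measure_ball hw, ← lintegral_const]
  refine lintegral_mono_ae ?_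
  filter_upwards [M.ae_mem_core, M.ae_ae_smul M.ae_mem_core] with y hy hy2
  have e : ∫⁻ g in Metric.ball 1 R, (κ (g • y) (Metric.ball 1 ε))⁻¹ * M.cocycle g y ∂(κ y) =
      ∫⁻ g in Metric.ball 1 R, (κ y (Metric.ball g ε))⁻¹ ∂(κ y) := by
    refine setLIntegral_congr_fun_ae Metric.isOpen_ball.measurableSet ?_
    filter_upwards [hy2] with g hg _
    obtain ⟨h0, ht⟩ := M.cocycle_ne y hy g hg
    rw [M.measure_smul hy hg hbm, preimage_ball_one, ENNReal.mul_inv (Or.inl h0) (Or.inl ht),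
      mul_right_comm, ENNReal.inv_mul_cancel h0 ht, one_mul]
  rw [e]
  refine (setLIntegral_le_sum ht _).trans ?_
  have h1 : ∀ p ∈ t, ∫⁻ g in Metric.ball p (ε / 2), (κ y (Metric.ball g ε))⁻¹ ∂(κ y) ≤ 1 := by
    intro p _
    calc ∫⁻ g in Metric.ball p (ε / 2), (κ y (Metric.ball g ε))⁻¹ ∂(κ y)
        ≤ ∫⁻ _ in Metric.ball p (ε / 2), (κ y (Metric.ball p (ε / 2)))⁻¹ ∂(κ y) :=
          setLIntegral_mono measurable_const fun g hg => ENNReal.inv_le_inv.2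
            (measure_mono (ball_subset_ball_of_mem hg))
      _ = (κ y (Metric.ball p (ε / 2)))⁻¹ * κ y (Metric.ball p (ε / 2)) := by
          rw [setLIntegral_const]
      _ ≤ 1 := ENNReal.inv_mul_le_one _
  calc _ ≤ ∑ p ∈ t, (1 : ℝ≥0∞) := Finset.sum_le_sum h1
    _ = t.card := by simp

variable {H : Subgroup G} [hH : IsClosed (H : Set G)] [H.Normal]

variable (κ H) in
/-- The points at which, in some tube of radius `a n`, the ratio of the measures of the balls of
radius `1` and `β` exceeds `t`. -/
def badSet (a : ℕ → ℝ) (β : ℝ) (t : ℝ≥0∞) : Set X :=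
  {x | ∃ n, t * κ x (Metric.ball 1 β ∩ tube H 1 (a n)) < κ x (Metric.ball 1 1 ∩ tube H 1 (a n))}

theorem measurableSet_badSet (a : ℕ → ℝ) (β : ℝ) (t : ℝ≥0∞) :
    MeasurableSet (badSet κ H a β t) := by
  have : badSet κ H a β t = ⋃ n, {x | t * κ x (Metric.ball 1 β ∩ tube H 1 (a n)) <
      κ x (Metric.ball 1 1 ∩ tube H 1 (a n))} := by ext; simp [badSet]
  rw [this]
  refine MeasurableSet.iUnion fun n => measurableSet_lt ?_ ?_
  · exact (κ.measurable_coe (Metric.isOpen_ball.measurableSet.inter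
      (isClosed_tube _ _).measurableSet)).const_mul t
  · exact κ.measurable_coe (Metric.isOpen_ball.measurableSet.inter
      (isClosed_tube _ _).measurableSet)

theorem preimage_ball_inter_tube (g : G) (s r : ℝ) :
    (fun k => k * g⁻¹) ⁻¹' (Metric.ball 1 s ∩ tube H 1 r) = Metric.ball g s ∩ tube H g r := by
  rw [Set.preimage_inter, preimage_ball_one]
  congr 1
  ext k
  exact mem_tube_mul_inv

/-- The maximal inequality in the quotient bounds, on each orbit, the measure of the bad set. -/
theorem measure_badSet_orbit_le (M : MassTransport lam κ) {N : ℕ}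
    (hN : HasBesicovitchBound (G ⧸ H) N) {a : ℕ → ℝ} (ha : ∀ n, 0 < a n) {β : ℝ} {t : ℝ≥0∞}
    (ht0 : t ≠ 0) (htt : t ≠ ∞) {F : Finset G}
    (hF : Metric.ball (1 : G) 1 ⊆ ⋃ p ∈ F, Metric.ball p (β / 2)) {y : X} (hy : y ∈ M.core) :
    κ y {g ∈ Metric.ball (1 : G) 1 | g • y ∈ M.core ∧ g • y ∈ badSet κ H a β t} ≤
      F.card * (t⁻¹ * N * κ y (Metric.ball 1 2)) := by
  set Bad : Set G := {g ∈ Metric.ball (1 : G) 1 | g • y ∈ M.core ∧ g • y ∈ badSet κ H a β t}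
    with hBad
  have hmk : Measurable (QuotientGroup.mk : G → G ⧸ H) :=
    (QuotientGroup.continuous_mk (N := H)).measurable
  have hb : ∀ (p : G) (r : ℝ), MeasurableSet (Metric.ball p r) := fun p r =>
    Metric.isOpen_ball.measurableSet
  have hfin : ∀ (p : G) (r : ℝ), IsFiniteMeasure ((κ y).restrict (Metric.ball p r)) := fun p r =>
    ⟨by rw [Measure.restrict_apply_univ]; exact (M.measure_ball_ne_top y p r).lt_top⟩
  have hcb : ∀ (E : Set G) (g : G) (r : ℝ), (((κ y).restrict E).map QuotientGroup.mk)
      (Metric.closedBall (g : G ⧸ H) r) = κ y (E ∩ tube H g r) := by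
    intro E g r
    rw [Measure.map_apply hmk Metric.isClosed_closedBall.measurableSet,
      Measure.restrict_apply (hmk Metric.isClosed_closedBall.measurableSet), Set.inter_comm]
    rfl
  -- on a piece of radius `β / 2`, the ball of radius `β` around any point contains the whole piece, so
  -- that one and the same measure `θ₁` serves for all points
  have key : ∀ p ∈ F, κ y (Bad ∩ Metric.ball p (β / 2)) ≤ t⁻¹ * N * κ y (Metric.ball 1 2) := by
    intro p _
    have := hfin p (β / 2)
    have := hfin 1 2
    set θ₁ := ((κ y).restrict (Metric.ball p (β / 2))).map (QuotientGroup.mk : G → G ⧸ H) with h1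
    set θ₂ := ((κ y).restrict (Metric.ball 1 2)).map (QuotientGroup.mk : G → G ⧸ H) with h2
    set A : Set (G ⧸ H) := QuotientGroup.mk '' (Bad ∩ Metric.ball p (β / 2)) with hA
    have hθ₂ : IsFiniteMeasure θ₂ := by rw [h2]; infer_instance
    have hAb : Bornology.IsBounded A := by
      refine (Metric.isBounded_iff_subset_closedBall ((1 : G) : G ⧸ H)).2 ⟨1, ?_⟩
      rintro _ ⟨g, ⟨hg, -⟩, rfl⟩
      exact (dist_mk_le _ _).trans (Metric.mem_ball.1 hg.1).le
    have hmax := hN.measure_le θ₁ θ₂ hAb t⁻¹ (by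
      rintro _ ⟨g, ⟨⟨hg1, hgc, n, hn⟩, hgp⟩, rfl⟩
      refine ⟨a n, ha n, ?_⟩
      obtain ⟨hc0, hct⟩ := M.cocycle_ne y hy g hgc
      have hm : ∀ s : ℝ, MeasurableSet (Metric.ball (1 : G) s ∩ tube H 1 (a n)) := fun s =>
        (hb 1 s).inter (isClosed_tube _ _).measurableSet
      rw [M.measure_smul hy hgc (hm β), M.measure_smul hy hgc (hm 1), preimage_ball_inter_tube,
        preimage_ball_inter_tube, mul_left_comm, ENNReal.mul_lt_mul_iff_right hc0 hct] at hn
      rw [h1, h2, hcb, hcb]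
      calc κ y (Metric.ball p (β / 2) ∩ tube H g (a n))
          ≤ κ y (Metric.ball g β ∩ tube H g (a n)) :=
            measure_mono (Set.inter_subset_inter_left _ (ball_subset_ball_of_mem hgp))
        _ = t⁻¹ * (t * κ y (Metric.ball g β ∩ tube H g (a n))) := by
            rw [← mul_assoc, ENNReal.inv_mul_cancel ht0 htt, one_mul]
        _ < t⁻¹ * κ y (Metric.ball g 1 ∩ tube H g (a n)) := by
            rw [ENNReal.mul_lt_mul_iff_right (ENNReal.inv_ne_zero.2 htt)
              (ENNReal.inv_ne_top.2 ht0)]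
            exact hn
        _ ≤ t⁻¹ * κ y (Metric.ball 1 2 ∩ tube H g (a n)) := by
            gcongr
            refine Metric.ball_subset_ball' ?_
            have := Metric.mem_ball.1 hg1
            linarith)
    have huniv : θ₂ Set.univ = κ y (Metric.ball 1 2) := by
      rw [h2, Measure.map_apply hmk MeasurableSet.univ, Set.preimage_univ,
        Measure.restrict_apply_univ]
    rw [huniv] at hmax
    refine le_trans ?_ hmax
    calc κ y (Bad ∩ Metric.ball p (β / 2))
        ≤ ((κ y).restrict (Metric.ball p (β / 2))) (QuotientGroup.mk ⁻¹' A) := by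
          rw [Measure.restrict_apply' (hb _ _)]
          exact measure_mono fun g hg => ⟨⟨g, hg, rfl⟩, hg.2⟩
      _ ≤ θ₁ A := Measure.le_map_apply hmk.aemeasurable A
  calc κ y Bad ≤ κ y (⋃ p ∈ F, Bad ∩ Metric.ball p (β / 2)) := by
        refine measure_mono fun g hg => ?_
        obtain ⟨p, hp, hgp⟩ := Set.mem_iUnion₂.1 (hF hg.1)
        exact Set.mem_iUnion₂.2 ⟨p, hp, hg, hgp⟩
    _ ≤ ∑ p ∈ F, κ y (Bad ∩ Metric.ball p (β / 2)) := measure_biUnion_finset_le _ _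
    _ ≤ ∑ p ∈ F, t⁻¹ * N * κ y (Metric.ball 1 2) := Finset.sum_le_sum key
    _ = _ := by rw [Finset.sum_const, nsmul_eq_mul]

/-- The mean of the previous bound over the orbits, by mass transport. -/
theorem setLIntegral_badSet_le (M : MassTransport lam κ) {N : ℕ}
    (hN : HasBesicovitchBound (G ⧸ H) N) {a : ℕ → ℝ} (ha : ∀ n, 0 < a n) {β : ℝ} (hβ : 0 < β) :
    ∃ n : ℕ, ∀ t : ℝ≥0∞, t ≠ 0 → t ≠ ∞ → ∫⁻ x in badSet κ H a β t,
      κ x (Metric.ball 1 1) / κ x (Metric.ball 1 3) ∂lam ≤ n * t⁻¹ * lam Set.univ := by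
  obtain ⟨F, hF⟩ := exists_finset_cover (G := G) 1 (half_pos hβ)
  refine ⟨F.card * N, fun t ht0 htt => ?_⟩
  have hb : ∀ (p : G) (r : ℝ), MeasurableSet (Metric.ball p r) := fun p r =>
    Metric.isOpen_ball.measurableSet
  set w : X → ℝ≥0∞ := fun x => (badSet κ H a β t).indicator 1 x * (κ x (Metric.ball 1 3))⁻¹
  have hi : Measurable ((badSet κ H a β t).indicator (1 : X → ℝ≥0∞)) :=
    measurable_one.indicator (measurableSet_badSet a β t)
  have hw : Measurable w := hi.mul (κ.measurable_coe (hb 1 3)).inv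
  have e1 : ∫⁻ x in badSet κ H a β t, κ x (Metric.ball 1 1) / κ x (Metric.ball 1 3) ∂lam =
      ∫⁻ x, w x * κ x (Metric.ball 1 1) ∂lam := by
    rw [← lintegral_indicator (measurableSet_badSet a β t)]
    refine lintegral_congr fun x => ?_
    by_cases hx : x ∈ badSet κ H a β t
    · simp only [w, Set.indicator_of_mem hx, Pi.one_apply, one_mul, ENNReal.div_eq_inv_mul]
    · simp only [w, Set.indicator_of_notMem hx, zero_mul]
  rw [e1, M.lintegral_mul_measure_ball hw, ← lintegral_const]
  refine lintegral_mono_ae ?_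
  filter_upwards [M.ae_mem_core, M.ae_ae_smul M.ae_mem_core] with y hy hy2
  have hBadm : MeasurableSet {g : G | g • y ∈ M.core ∧ g • y ∈ badSet κ H a β t} :=
    (measurable_id.smul_const y) (M.measurableSet_core.inter (measurableSet_badSet a β t))
  have hpos : κ y (Metric.ball 1 2) ≠ 0 :=
    M.nhds_pos y hy _ (Metric.ball_mem_nhds _ (by norm_num))
  have hfin := M.measure_ball_ne_top y 1 2
  calc ∫⁻ g in Metric.ball 1 1, w (g • y) * M.cocycle g y ∂(κ y)
      ≤ ∫⁻ g in Metric.ball 1 1, (κ y (Metric.ball 1 2))⁻¹ *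
          {g : G | g • y ∈ M.core ∧ g • y ∈ badSet κ H a β t}.indicator 1 g ∂(κ y) := by
        refine setLIntegral_mono_ae' (hb 1 1) ?_
        filter_upwards [hy2] with g hg hg1
        obtain ⟨hc0, hct⟩ := M.cocycle_ne y hy g hg
        by_cases hgb : g • y ∈ badSet κ H a β t
        · have hmem : g ∈ {g : G | g • y ∈ M.core ∧ g • y ∈ badSet κ H a β t} := ⟨hg, hgb⟩
          simp only [w, Set.indicator_of_mem hgb, Set.indicator_of_mem hmem, Pi.one_apply,
            one_mul, mul_one]
          rw [M.measure_smul hy hg (hb 1 3), preimage_ball_one,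
            ENNReal.mul_inv (Or.inl hc0) (Or.inl hct), mul_right_comm,
            ENNReal.inv_mul_cancel hc0 hct, one_mul]
          refine ENNReal.inv_le_inv.2 (measure_mono (Metric.ball_subset_ball' ?_))
          have := Metric.mem_ball'.1 hg1
          linarith
        · simp only [w, Set.indicator_of_notMem hgb, zero_mul]
          exact zero_le
    _ = (κ y (Metric.ball 1 2))⁻¹ *
          κ y {g ∈ Metric.ball (1 : G) 1 | g • y ∈ M.core ∧ g • y ∈ badSet κ H a β t} := by
        rw [lintegral_const_mul _ (measurable_one.indicator hBadm), lintegral_indicator_one hBadm,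
          Measure.restrict_apply hBadm, Set.inter_comm]
        rfl
    _ ≤ (κ y (Metric.ball 1 2))⁻¹ * (F.card * (t⁻¹ * N * κ y (Metric.ball 1 2))) := by
        gcongr
        exact M.measure_badSet_orbit_le hN ha ht0 htt hF hy
    _ = F.card * (t⁻¹ * N) * ((κ y (Metric.ball 1 2))⁻¹ * κ y (Metric.ball 1 2)) := by ring
    _ = _ := by
        rw [ENNReal.inv_mul_cancel hpos hfin, mul_one]
        push_cast
        ring

/-- The measure of the bad sets decreases fast enough for the logarithms of the ratios to be
dominated by an integrable function. -/
theorem measure_badSet_le (M : MassTransport lam κ) {N : ℕ}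
    (hN : HasBesicovitchBound (G ⧸ H) N) {a : ℕ → ℝ} (ha : ∀ n, 0 < a n) {β : ℝ} (hβ : 0 < β) :
    ∃ C : ℝ≥0∞, C ≠ ∞ ∧ ∀ u : ℝ≥0∞, u ≠ 0 → u ≠ ∞ → lam (badSet κ H a β (u * u)) ≤ C * u⁻¹ := by
  obtain ⟨n, hn⟩ := M.setLIntegral_badSet_le hN ha hβ
  obtain ⟨n', hn'⟩ := M.lintegral_div_measure_ball_le 3 zero_lt_one
  refine ⟨n * lam Set.univ + n' * lam Set.univ, ENNReal.add_ne_top.2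
    ⟨ENNReal.mul_ne_top (by simp) (measure_ne_top _ _),
      ENNReal.mul_ne_top (by simp) (measure_ne_top _ _)⟩, fun u hu0 hut => ?_⟩
  have hb : ∀ (p : G) (r : ℝ), MeasurableSet (Metric.ball p r) := fun p r =>
    Metric.isOpen_ball.measurableSet
  set b := badSet κ H a β (u * u) with hbdef
  have hm1 : Measurable fun x => κ x (Metric.ball 1 1) / κ x (Metric.ball 1 3) :=
    (κ.measurable_coe (hb 1 1)).div (κ.measurable_coe (hb 1 3))
  have hm2 : Measurable fun x => κ x (Metric.ball 1 3) / κ x (Metric.ball 1 1) :=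
    (κ.measurable_coe (hb 1 3)).div (κ.measurable_coe (hb 1 1))
  -- the weights balance the two estimates, as in the inequality of Cauchy and Schwarz
  calc lam b = ∫⁻ _ in b, 1 ∂lam := by rw [setLIntegral_one]
    _ ≤ ∫⁻ x in b, (u * (κ x (Metric.ball 1 1) / κ x (Metric.ball 1 3)) +
          u⁻¹ * (κ x (Metric.ball 1 3) / κ x (Metric.ball 1 1))) ∂lam := by
        refine setLIntegral_mono_ae' (measurableSet_badSet a β _) ?_
        filter_upwards [M.ae_mem_core] with x hx _
        have h1 : κ x (Metric.ball 1 1) ≠ 0 :=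
          M.nhds_pos x hx _ (Metric.ball_mem_nhds _ (by norm_num))
        have h3 : κ x (Metric.ball 1 3) ≠ 0 :=
          M.nhds_pos x hx _ (Metric.ball_mem_nhds _ (by norm_num))
        have h1' := M.measure_ball_ne_top x 1 1
        have h3' := M.measure_ball_ne_top x 1 3
        set p := κ x (Metric.ball 1 1)
        set q := κ x (Metric.ball 1 3)
        have hinv : u⁻¹ * (q / p) = (u * (p / q))⁻¹ := by
          rw [ENNReal.mul_inv (Or.inl hu0) (Or.inl hut),
            ENNReal.inv_div (Or.inl h3') (Or.inl h3)]
        rw [hinv]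
        rcases le_total 1 (u * (p / q)) with h | h
        · exact h.trans le_self_add
        · exact (ENNReal.one_le_inv.2 h).trans le_add_self
    _ = u * ∫⁻ x in b, κ x (Metric.ball 1 1) / κ x (Metric.ball 1 3) ∂lam +
          u⁻¹ * ∫⁻ x in b, κ x (Metric.ball 1 3) / κ x (Metric.ball 1 1) ∂lam := by
        rw [lintegral_add_left (hm1.const_mul u), lintegral_const_mul _ hm1,
          lintegral_const_mul _ hm2]
    _ ≤ u * (n * (u * u)⁻¹ * lam Set.univ) + u⁻¹ * (n' * lam Set.univ) := by
        gcongr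
        · exact hn _ (mul_ne_zero hu0 hu0) (ENNReal.mul_ne_top hut hut)
        · exact (setLIntegral_le_lintegral _ _).trans hn'
    _ = _ := by
        rw [ENNReal.mul_inv (Or.inl hu0) (Or.inl hut), add_mul]
        congr 1
        · rw [show u * (n * (u⁻¹ * u⁻¹) * lam Set.univ) = (u * u⁻¹) * (n * lam Set.univ * u⁻¹) by
            ring, ENNReal.mul_inv_cancel hu0 hut, one_mul]
        · ring

end Metric

end MassTransport

/-! ### The ratios of the tube integrals -/

namespace MassTransport

variable {G X : Type*} [Group G] [MetricSpace G] [IsTopologicalGroup G] [ProperSpace G]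
  [PolishSpace G] [MeasurableSpace G] [BorelSpace G] [IsIsometricSMul Gᵐᵒᵖ G]
  [MeasurableSpace X] [StandardBorelSpace X] [MulAction G X] [MeasurableSMul₂ G X]
  {lam : Measure X} [IsFiniteMeasure lam] {H : Subgroup G} [hH : IsClosed (H : Set G)] [H.Normal]
  {κ : Kernel X G} [IsSFiniteKernel κ] {η : Kernel X H} [IsSFiniteKernel η]

/-- The integral of the bump function of radius `s` on the tube of radius `r` around `H`. -/
noncomputable def tubeIntegral (κ : Kernel X G) (H : Subgroup G) [H.Normal] (s r : ℝ) (x : X) :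
    ℝ≥0∞ := ∫⁻ k in tube H 1 r, bump s k ∂(κ x)

theorem measurable_tubeIntegral (s r : ℝ) : Measurable (tubeIntegral κ H s r) := by
  have hm : Measurable ((tube H 1 r).indicator (bump s : G → ℝ≥0∞)) :=
    (measurable_bump s).indicator (isClosed_tube 1 r).measurableSet
  have : tubeIntegral κ H s r = fun x => ∫⁻ k, (tube H 1 r).indicator (bump s) k ∂(κ x) := by
    funext x
    rw [lintegral_indicator (isClosed_tube 1 r).measurableSet]
    rfl
  rw [this]
  exact Measurable.lintegral_kernel hm

theorem tubeIntegral_smul (M : MassTransport lam κ) {x : X} (hx : x ∈ M.core) {g : G}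
    (hg : g • x ∈ M.core) (s r : ℝ) : tubeIntegral κ H s r (g • x) =
      M.cocycle g x * ∫⁻ k in tube H g r, bump s (k * g⁻¹) ∂(κ x) := by
  have hT : ∀ g : G, MeasurableSet (tube H g r) := fun g => (isClosed_tube g r).measurableSet
  rw [tubeIntegral, ← lintegral_indicator (hT 1), ← lintegral_indicator (hT g),
    M.lintegral_smul hx hg ((measurable_bump s).indicator (hT 1))]
  congr 2
  funext k
  by_cases hk : k ∈ tube H g r
  · rw [Set.indicator_of_mem hk, Set.indicator_of_mem (mem_tube_mul_inv.2 hk)]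
  · rw [Set.indicator_of_notMem hk, Set.indicator_of_notMem (fun h => hk (mem_tube_mul_inv.1 h))]

theorem tubeIntegral_ne_zero (M : MassTransport lam κ) {s r : ℝ} (hs : 0 < s) (hr : 0 < r) {x : X}
    (hx : x ∈ M.core) : tubeIntegral κ H s r x ≠ 0 :=
  M.lintegral_bump_ne_zero hs hx
    (mem_of_superset (Metric.ball_mem_nhds 1 hr) (ball_subset_tube 1 r))

theorem tubeIntegral_ne_top (M : MassTransport lam κ) {s : ℝ} (hs : 0 < s) (r : ℝ) (x : X) :
    tubeIntegral κ H s r x ≠ ∞ :=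
  ne_top_of_le_ne_top (M.lintegral_bump_ne_top hs x) (setLIntegral_le_lintegral _ _)

theorem tubeIntegral_toReal_pos (M : MassTransport lam κ) {s r : ℝ} (hs : 0 < s) (hr : 0 < r)
    {x : X} (hx : x ∈ M.core) : 0 < (tubeIntegral κ H s r x).toReal :=
  ENNReal.toReal_pos (M.tubeIntegral_ne_zero hs hr hx) (M.tubeIntegral_ne_top hs r x)

theorem tubeIntegral_eq_lintegral {s r : ℝ} (hs : 0 < s) (hsr : s ≤ r) (x : X) :
    tubeIntegral κ H s r x = ∫⁻ k, bump s k ∂(κ x) := by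
  rw [tubeIntegral, ← lintegral_indicator (isClosed_tube 1 r).measurableSet]
  refine lintegral_congr fun k => Set.indicator_apply_eq_self.2 fun hk => ?_
  by_contra h
  refine hk (ball_subset_tube 1 r (Metric.mem_ball.2 ?_))
  exact ((bump_ne_zero_iff hs k).1 h).trans_le hsr

/-- The ratio of two tube integrals converges to the ratio given by the disintegration along `H`. -/
theorem ae_tendsto_tubeIntegral_div (M : MassTransport lam κ) (M' : MassTransport lam η) {N : ℕ}
    (hN : HasBesicovitchBound (G ⧸ H) N) {s t : ℝ} (hs : 0 < s) (hs1 : s ≤ 1) (ht : 0 < t)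
    (ht1 : t ≤ 1) {a : ℕ → ℝ} (ha : ∀ n, 0 < a n) (ha0 : Tendsto a atTop (𝓝 0)) :
    ∀ᵐ y ∂lam, Tendsto (fun n => (tubeIntegral κ H s (a n) y).toReal /
      (tubeIntegral κ H t (a n) y).toReal) atTop
      (𝓝 ((∫⁻ h, bump s h ∂(η y)).toReal / (∫⁻ h, bump t h ∂(η y)).toReal)) := by
  have hI : ∀ s, Measurable fun y => (∫⁻ h, bump s h ∂(η y)).toReal := fun s =>
    (Measurable.lintegral_kernel (measurable_bump s)).ennreal_toReal
  have hJ : ∀ s n, Measurable fun y => (tubeIntegral κ H s (a n) y).toReal := fun s n =>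
    (measurable_tubeIntegral s (a n)).ennreal_toReal
  refine M.ae_of_ae_ae_smul (B := Metric.ball 1 1) ?_ (Metric.ball_mem_nhds _ one_pos)
    Metric.isOpen_ball.measurableSet ?_
  · exact measurableSet_tendsto_fun (fun n => (hJ s n).div (hJ t n)) ((hI s).div (hI t))
  filter_upwards [M.ae_tendsto_tube M' hN hs hs1, M.ae_tendsto_tube M' hN ht ht1,
    M.ae_mem_core, M.ae_ae_smul (M.ae_mem_core.and M'.ae_mem_core)] with x hxs hxt hx hcore
  filter_upwards [hxs, hxt, hcore] with g hgs hgt hg hgB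
  have ha' : Tendsto a atTop (𝓝[>] 0) := tendsto_nhdsWithin_iff.2 ⟨ha0, Eventually.of_forall ha⟩
  have hgK : g ∈ interior (Metric.closedBall (1 : G) 2) :=
    Metric.ball_subset_interior_closedBall
      ((Metric.ball_subset_ball (by norm_num)) hgB)
  obtain ⟨hC0, hCt⟩ := cosetIntegral_indicator_ne M' (isCompact_closedBall (1 : G) 2) hg.2 hgK
  have hCr := (ENNReal.toReal_pos hC0 hCt).ne'
  have hIt : (∫⁻ h, bump t h ∂(η (g • x))).toReal ≠ 0 := by
    refine (ENNReal.toReal_pos ?_ (M'.lintegral_bump_ne_top ht _)).ne'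
    rw [← setLIntegral_univ]
    exact M'.lintegral_bump_ne_zero ht hg.2 univ_mem
  have hlim := ((hgs hgB).comp ha').div ((hgt hgB).comp ha') (div_ne_zero hIt hCr)
  rw [div_div_div_cancel_right₀ hCr] at hlim
  refine hlim.congr fun n => ?_
  have hpos : (κ x (Metric.closedBall 1 2 ∩ tube H g (a n))).toReal ≠ 0 := by
    refine (ENNReal.toReal_pos ?_ ?_).ne'
    · refine M.nhds_smul_pos hx hg.1 (Filter.inter_mem (mem_interior_iff_mem_nhds.1 hgK) ?_)
      exact mem_of_superset (Metric.ball_mem_nhds g (ha n)) (ball_subset_tube g _)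
    · exact ne_top_of_le_ne_top ((M.regular x).2 _ (isCompact_closedBall (1 : G) 2))
        (measure_mono Set.inter_subset_left)
  obtain ⟨hc0, hct⟩ := M.cocycle_ne x hx g hg.1
  simp only [Function.comp_apply, Pi.div_apply]
  rw [div_div_div_cancel_right₀ hpos, M.tubeIntegral_smul hx hg.1, M.tubeIntegral_smul hx hg.1,
    ENNReal.toReal_mul, ENNReal.toReal_mul, mul_div_mul_left _ _ (ENNReal.toReal_pos hc0 hct).ne']

theorem tubeIntegral_mono {s t : ℝ} (hs : 0 < s) (hst : s ≤ t) (r : ℝ) (x : X) :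
    tubeIntegral κ H s r x ≤ tubeIntegral κ H t r x :=
  lintegral_mono fun k => bump_mono hs hst k

/-- The logarithms of the ratios of the tube integrals are dominated by an integrable function. -/
theorem exists_integrable_bound (M : MassTransport lam κ) {N : ℕ}
    (hN : HasBesicovitchBound (G ⧸ H) N) {α : ℝ} (hα0 : 0 < α) (hα1 : α < 1) {a : ℕ → ℝ}
    (ha : ∀ n, 0 < a n) : ∃ D : X → ℝ, Integrable D lam ∧ ∀ᵐ y ∂lam, ∀ n,
      |Real.log ((tubeIntegral κ H 1 (a n) y).toReal /
        (tubeIntegral κ H α (a n) y).toReal)| ≤ D y := by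
  obtain ⟨C, hC, hbad⟩ := M.measure_badSet_le hN ha (half_pos hα0)
  let b : ℕ → Set X := fun k => badSet κ H a (α / 2) (2 ^ k * 2 ^ k)
  have hbm : ∀ k, MeasurableSet (b k) := fun k => measurableSet_badSet _ _ _
  let S : X → ℝ≥0∞ := fun x => ∑' k, (b k).indicator 1 x
  have hSm : Measurable S := Measurable.tsum fun k => measurable_one.indicator (hbm k)
  -- the measures of the bad sets form a geometric series
  have hSint : ∫⁻ x, S x ∂lam ≠ ∞ := by
    have : ∫⁻ x, S x ∂lam ≤ C * 2 := by
      simp only [S]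
      rw [lintegral_tsum fun k => (measurable_one.indicator (hbm k)).aemeasurable]
      calc ∑' k, ∫⁻ x, (b k).indicator 1 x ∂lam ≤ ∑' k : ℕ, C * 2⁻¹ ^ k := by
            refine ENNReal.tsum_le_tsum fun k => ?_
            rw [lintegral_indicator_one (hbm k), ENNReal.inv_pow.symm]
            exact hbad _ (pow_ne_zero _ (by simp)) (ENNReal.pow_ne_top (by simp))
        _ = C * 2 := by rw [ENNReal.tsum_mul_left, ENNReal.tsum_geometric]; simp
    exact ne_top_of_le_ne_top (ENNReal.mul_ne_top hC (by simp)) this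
  refine ⟨fun x => Real.log 2 * (1 + 2 * (S x).toReal), ?_, ?_⟩
  · exact (((integrable_const (1 : ℝ)).add ((integrable_toReal_of_lintegral_ne_top
      hSm.aemeasurable hSint).const_mul 2)).const_mul _)
  filter_upwards [M.ae_mem_core, ae_lt_top hSm hSint] with x hx hSx n
  have hJ1 := M.tubeIntegral_toReal_pos (H := H) one_pos (ha n) hx
  have hJα := M.tubeIntegral_toReal_pos (H := H) hα0 (ha n) hx
  have hJαt := M.tubeIntegral_ne_top (H := H) hα0 (a n) x
  have hle : (tubeIntegral κ H α (a n) x).toReal ≤ (tubeIntegral κ H 1 (a n) x).toReal :=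
    ENNReal.toReal_mono (M.tubeIntegral_ne_top one_pos _ _) (tubeIntegral_mono hα0 hα1.le _ _)
  rw [abs_of_nonneg (Real.log_nonneg ((one_le_div hJα).2 hle))]
  -- the number of bad sets containing `x` bounds the first good index
  obtain ⟨k, hk, hkS⟩ : ∃ k : ℕ, x ∉ b k ∧ (k : ℝ≥0∞) ≤ S x := by
    have hex : ∃ k, x ∉ b k := by
      by_contra! hall
      have : S x = ∞ := by
        simp only [S, Set.indicator_of_mem (hall _), Pi.one_apply]
        exact ENNReal.tsum_const_eq_top_of_ne_zero one_ne_zero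
      exact hSx.ne this
    classical
    refine ⟨Nat.find hex, Nat.find_spec hex, ?_⟩
    calc ((Nat.find hex : ℕ) : ℝ≥0∞) = ∑ j ∈ Finset.range (Nat.find hex), (b j).indicator 1 x := by
          rw [Finset.sum_congr rfl fun j hj => Set.indicator_of_mem
            (not_not.1 (Nat.find_min hex (Finset.mem_range.1 hj))) _]
          simp
      _ ≤ S x := ENNReal.sum_le_tsum _
  have h1 : tubeIntegral κ H 1 (a n) x ≤ κ x (Metric.ball 1 1 ∩ tube H 1 (a n)) := by
    have hm : MeasurableSet (Metric.ball (1 : G) 1) := Metric.isOpen_ball.measurableSet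
    rw [← Measure.restrict_apply hm, ← lintegral_indicator_one hm, tubeIntegral]
    refine lintegral_mono fun k => ?_
    by_cases hk : k ∈ Metric.ball (1 : G) 1
    · rw [Set.indicator_of_mem hk]; exact bump_le_one one_pos k
    · rw [Set.indicator_of_notMem hk]
      have : bump 1 k = 0 := by
        by_contra h
        exact hk ((bump_ne_zero_iff one_pos k).1 h)
      exact this.le
  have h2 : κ x (Metric.ball 1 (α / 2) ∩ tube H 1 (a n)) ≤ 2 * tubeIntegral κ H α (a n) x := by
    have hm : MeasurableSet (Metric.ball (1 : G) (α / 2)) := Metric.isOpen_ball.measurableSet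
    rw [← Measure.restrict_apply hm, ← lintegral_indicator_one hm, tubeIntegral,
      ← lintegral_const_mul _ (measurable_bump α)]
    refine lintegral_mono fun k => ?_
    by_cases hk : k ∈ Metric.ball (1 : G) (α / 2)
    · rw [Set.indicator_of_mem hk, Pi.one_apply]
      have h3 := le_bump (t := 1 / 2) hα0 (k := k) (by
        have := Metric.mem_ball.1 hk
        linarith)
      calc (1 : ℝ≥0∞) = 2 * ENNReal.ofReal (1 - 1 / 2) := by
            rw [show (2 : ℝ≥0∞) = ENNReal.ofReal 2 by simp, ← ENNReal.ofReal_mul (by norm_num)]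
            norm_num
        _ ≤ 2 * bump α k := by gcongr
    · rw [Set.indicator_of_notMem hk]; exact zero_le
  have h3 : κ x (Metric.ball 1 1 ∩ tube H 1 (a n)) ≤
      2 ^ k * 2 ^ k * κ x (Metric.ball 1 (α / 2) ∩ tube H 1 (a n)) := by
    by_contra hcon
    exact hk ⟨n, not_le.1 hcon⟩
  -- hence the ratio is at most `2 ^ (1 + 2 k)`
  have h4 : tubeIntegral κ H 1 (a n) x ≤ 2 ^ (1 + 2 * k) * tubeIntegral κ H α (a n) x :=
    calc _ ≤ _ := h1
      _ ≤ _ := h3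
      _ ≤ 2 ^ k * 2 ^ k * (2 * tubeIntegral κ H α (a n) x) := by gcongr
      _ = _ := by ring
  have h5 : (tubeIntegral κ H 1 (a n) x).toReal ≤
      2 ^ (1 + 2 * k) * (tubeIntegral κ H α (a n) x).toReal := by
    have := ENNReal.toReal_mono (ENNReal.mul_ne_top (ENNReal.pow_ne_top (by simp)) hJαt) h4
    simpa [ENNReal.toReal_mul, ENNReal.toReal_pow] using this
  have hkr : (k : ℝ) ≤ (S x).toReal := by
    have := ENNReal.toReal_mono hSx.ne hkS
    simpa using this
  calc Real.log ((tubeIntegral κ H 1 (a n) x).toReal / (tubeIntegral κ H α (a n) x).toReal)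
      ≤ Real.log (2 ^ (1 + 2 * k)) :=
        Real.log_le_log (div_pos hJ1 hJα) ((div_le_iff₀ hJα).2 h5)
    _ = Real.log 2 * (1 + 2 * k) := by rw [Real.log_pow]; push_cast; ring
    _ ≤ _ := by
        have : 0 < Real.log 2 := Real.log_pos (by norm_num)
        gcongr

end MassTransport

/-! ### Exponential rates -/

section Rate

/-- The sequence `u` has the exponential rate `l`, that is, `log (u n) = n (l + o(1))`. -/
def HasRate (u : ℕ → ℝ≥0∞) (l : ℝ) : Prop :=
  (∀ᶠ n in atTop, u n ≠ 0 ∧ u n ≠ ∞) ∧ Tendsto (fun n : ℕ => Real.log (u n).toReal / n) atTop (𝓝 l)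

variable {u v w : ℕ → ℝ≥0∞} {l : ℝ}

theorem tendsto_shift_div (j : ℕ) {x : ℕ → ℝ} :
    Tendsto (fun n : ℕ => x (n + j) / n) atTop (𝓝 l) ↔
      Tendsto (fun n : ℕ => x n / n) atTop (𝓝 l) := by
  rw [← tendsto_add_atTop_iff_nat (f := fun n : ℕ => x n / n) j]
  have h1 : Tendsto (fun n : ℕ => ((n + j : ℕ) : ℝ) / n) atTop (𝓝 1) := by
    have : Tendsto (fun n : ℕ => 1 + (j : ℝ) / n) atTop (𝓝 (1 + 0)) :=
      tendsto_const_nhds.add (tendsto_const_div_atTop_nhds_zero_nat _)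
    rw [add_zero] at this
    refine this.congr' ?_
    filter_upwards [eventually_gt_atTop 0] with n hn
    have : (n : ℝ) ≠ 0 := by positivity
    push_cast
    field_simp
  have h2 : Tendsto (fun n : ℕ => (n : ℝ) / ((n + j : ℕ) : ℝ)) atTop (𝓝 1) := by
    have := h1.inv₀ one_ne_zero
    simpa using this
  constructor
  · intro h
    have := h.mul h2
    rw [mul_one] at this
    refine this.congr' ?_
    filter_upwards [eventually_gt_atTop 0] with n hn
    have : (n : ℝ) ≠ 0 := by positivity
    field_simp
  · intro h
    have := h.mul h1
    rw [mul_one] at this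
    refine this.congr' ?_
    filter_upwards [eventually_gt_atTop 0] with n hn
    have : (n : ℝ) ≠ 0 := by positivity
    have : ((n + j : ℕ) : ℝ) ≠ 0 := by positivity
    field_simp

theorem hasRate_shift_iff (j : ℕ) : HasRate (fun n => u (n + j)) l ↔ HasRate u l := by
  refine and_congr ?_ (tendsto_shift_div j (x := fun n => Real.log (u n).toReal))
  conv_rhs => rw [← map_add_atTop_eq_nat j]
  rw [eventually_map]

/-- Sequences that agree up to constant factors have the same rate. -/
theorem HasRate.squeeze (hu : HasRate u l) (hv : HasRate v l) {c C : ℝ≥0∞} (hc0 : c ≠ 0)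
    (hct : c ≠ ∞) (hC0 : C ≠ 0) (hCt : C ≠ ∞) (h1 : ∀ n, c * u n ≤ w n) (h2 : ∀ n, w n ≤ C * v n) :
    HasRate w l := by
  have hw : ∀ᶠ n in atTop, w n ≠ 0 ∧ w n ≠ ∞ := by
    filter_upwards [hu.1, hv.1] with n hn hn'
    exact ⟨fun h => mul_ne_zero hc0 hn.1 (nonpos_iff_eq_zero.1 (h ▸ h1 n)),
      ne_top_of_le_ne_top (ENNReal.mul_ne_top hCt hn'.2) (h2 n)⟩
  refine ⟨hw, ?_⟩
  have e1 : Tendsto (fun n : ℕ => Real.log c.toReal / n + Real.log (u n).toReal / n) atTop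
      (𝓝 (0 + l)) := (tendsto_const_div_atTop_nhds_zero_nat _).add hu.2
  have e2 : Tendsto (fun n : ℕ => Real.log C.toReal / n + Real.log (v n).toReal / n) atTop
      (𝓝 (0 + l)) := (tendsto_const_div_atTop_nhds_zero_nat _).add hv.2
  rw [zero_add] at e1 e2
  have hcr := (ENNReal.toReal_pos hc0 hct).ne'
  have hCr := (ENNReal.toReal_pos hC0 hCt).ne'
  refine tendsto_of_tendsto_of_tendsto_of_le_of_le' e1 e2 ?_ ?_
  · filter_upwards [hu.1, hw] with n hn hn'
    rw [← add_div, ← Real.log_mul hcr (ENNReal.toReal_pos hn.1 hn.2).ne', ← ENNReal.toReal_mul]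
    gcongr
    · exact ENNReal.toReal_pos (mul_ne_zero hc0 hn.1) (ENNReal.mul_ne_top hct hn.2)
    · exact hn'.2
    · exact h1 n
  · filter_upwards [hv.1, hw] with n hn hn'
    rw [← add_div, ← Real.log_mul hCr (ENNReal.toReal_pos hn.1 hn.2).ne', ← ENNReal.toReal_mul]
    gcongr
    · exact ENNReal.toReal_pos hn'.1 hn'.2
    · exact ENNReal.mul_ne_top hCt hn.2
    · exact h2 n

theorem HasRate.of_const_mul {c : ℝ≥0∞} (hc0 : c ≠ 0) (hct : c ≠ ∞)
    (h : HasRate (fun n => c * u n) l) : HasRate u l := by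
  have e : ∀ n, c⁻¹ * (c * u n) = u n := fun n => by
    rw [← mul_assoc, ENNReal.inv_mul_cancel hc0 hct, one_mul]
  exact h.squeeze h (ENNReal.inv_ne_zero.2 hct) (ENNReal.inv_ne_top.2 hc0)
    (ENNReal.inv_ne_zero.2 hct) (ENNReal.inv_ne_top.2 hc0) (fun n => (e n).le) fun n => (e n).ge

theorem HasRate.const_mul {c : ℝ≥0∞} (hc0 : c ≠ 0) (hct : c ≠ ∞) (h : HasRate u l) :
    HasRate (fun n => c * u n) l :=
  h.squeeze h hc0 hct hc0 hct (fun _ => le_rfl) fun _ => le_rfl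

/-- The rate of a monotone function along a geometric sequence determines the limit of the ratio of
the logarithms. -/
theorem HasRate.tendsto_log_div_log {F : ℝ → ℝ≥0∞} (hF : ∀ r s, 0 < r → r ≤ s → F r ≤ F s) {α : ℝ}
    (hα0 : 0 < α) (hα1 : α < 1) (h : HasRate (fun n => F (α ^ n)) l) :
    Tendsto (fun r => ENNReal.log (F r) / (Real.log r : EReal)) (𝓝[>] 0)
      (𝓝 ((l / Real.log α : ℝ) : EReal)) := by
  have hlα : Real.log α < 0 := Real.log_neg hα0 hα1
  have hlogdiv : Tendsto (fun r => Real.log r / Real.log α) (𝓝[>] 0) atTop := by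
    simp only [div_eq_mul_inv]
    exact Real.tendsto_log_nhdsGT_zero.atBot_mul_const_of_neg (inv_lt_zero.2 hlα)
  -- the radius `r` lies between `α ^ (m r + 1)` and `α ^ (m r)`
  let m : ℝ → ℕ := fun r => ⌊Real.log r / Real.log α⌋₊
  have hm : Tendsto m (𝓝[>] 0) atTop := tendsto_nat_floor_atTop.comp hlogdiv
  have hpos : ∀ᶠ r in 𝓝[>] (0 : ℝ), 0 < r := self_mem_nhdsWithin
  have hbr : ∀ᶠ r in 𝓝[>] (0 : ℝ), 0 < r ∧ α ^ (m r + 1) ≤ r ∧ r ≤ α ^ m r := by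
    filter_upwards [hpos, hlogdiv.eventually_ge_atTop 0] with r hr hr0
    have h1 := Nat.floor_le hr0
    have h2 := Nat.lt_floor_add_one (Real.log r / Real.log α)
    refine ⟨hr, ?_, ?_⟩
    · rw [← Real.log_le_log_iff (by positivity) hr, Real.log_pow]
      rw [div_lt_iff_of_neg hlα] at h2
      push_cast
      exact h2.le
    · rw [← Real.log_le_log_iff hr (by positivity), Real.log_pow]
      rw [le_div_iff_of_neg hlα] at h1
      exact h1
  have hevn : ∀ᶠ n in atTop, F (α ^ (n + 1)) ≠ 0 ∧ F (α ^ n) ≠ ∞ := by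
    filter_upwards [((hasRate_shift_iff 1).2 h).1, h.1] with n hn hn'
    exact ⟨hn.1, hn'.2⟩
  have hev : ∀ᶠ r in 𝓝[>] (0 : ℝ), F (α ^ (m r + 1)) ≠ 0 ∧ F (α ^ m r) ≠ ∞ := hm.eventually hevn
  have hFr : ∀ᶠ r in 𝓝[>] (0 : ℝ), F r ≠ 0 ∧ F r ≠ ∞ := by
    filter_upwards [hbr, hev] with r hr hr'
    refine ⟨fun h0 => hr'.1 (nonpos_iff_eq_zero.1 (h0 ▸ hF _ _ (by positivity) hr.2.1)),
      ne_top_of_le_ne_top hr'.2 (hF _ _ hr.1 hr.2.2)⟩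
  have hlim : Tendsto (fun r => Real.log (F r).toReal / m r) (𝓝[>] 0) (𝓝 l) := by
    refine tendsto_of_tendsto_of_tendsto_of_le_of_le'
      (((hasRate_shift_iff 1).2 h).2.comp hm) (h.2.comp hm) ?_ ?_
    · filter_upwards [hbr, hev, hFr] with r hr hr' hr''
      simp only [Function.comp_apply]
      have hle := hF _ _ (by positivity) hr.2.1
      gcongr
      · exact ENNReal.toReal_pos hr'.1 (ne_top_of_le_ne_top hr''.2 hle)
      · exact hr''.2
    · filter_upwards [hbr, hev, hFr] with r hr hr' hr''
      simp only [Function.comp_apply]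
      have hle := hF _ _ hr.1 hr.2.2
      gcongr
      · exact ENNReal.toReal_pos hr''.1 hr''.2
      · exact hr'.2
  have hfl : Tendsto (fun r => (m r : ℝ) / (Real.log r / Real.log α)) (𝓝[>] 0) (𝓝 1) :=
    (tendsto_nat_floor_div_atTop (R := ℝ)).comp hlogdiv
  have hreal : Tendsto (fun r => Real.log (F r).toReal / Real.log r) (𝓝[>] 0)
      (𝓝 (l / Real.log α)) := by
    have := (hlim.mul hfl).div_const (Real.log α)
    rw [mul_one] at this
    refine this.congr' ?_
    filter_upwards [hm.eventually_gt_atTop 0, hlogdiv.eventually_gt_atTop 0] with r hr hr'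
    have h1 : (m r : ℝ) ≠ 0 := by positivity
    have h2 : Real.log r ≠ 0 := fun h => by simp [h] at hr'
    have h3 := hlα.ne
    field_simp
  have := (continuous_coe_real_ereal.tendsto _).comp hreal
  refine this.congr' ?_
  filter_upwards [hFr] with r hr
  rw [Function.comp_apply, EReal.coe_div, ENNReal.log_pos_real' (ENNReal.toReal_pos hr.1 hr.2)]

end Rate

/-! ### Scaling under the automorphism -/

section Scaling

variable {L X : Type*} [Group L] [MeasurableSpace L] [MeasurableSpace X] {lam : Measure X}
  {S : X → X}

theorem ae_sameClass_iterate {κ : Kernel X L} (hS : MeasurePreserving S lam lam) {φ : L → L}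
    (hφ : Measurable φ) (h : ∀ᵐ x ∂lam, SameClass (κ x) ((κ (S x)).map φ)) :
    ∀ᵐ x ∂lam, ∀ k : ℕ, SameClass (κ x) ((κ (S^[k] x)).map φ^[k]) := by
  have h' : ∀ᵐ x ∂lam, ∀ k : ℕ, SameClass (κ (S^[k] x)) ((κ (S (S^[k] x))).map φ) :=
    ae_all_iff.2 fun k => (hS.iterate k).quasiMeasurePreserving.ae h
  filter_upwards [h'] with x hx k
  induction k with
  | zero =>
    refine ⟨1, one_ne_zero, ENNReal.one_ne_top, ?_⟩
    rw [one_smul, Function.iterate_zero, Function.iterate_zero, Measure.map_id, id]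
  | succ k ih =>
    refine ih.trans ?_
    have := (hx k).map φ^[k]
    rwa [Measure.map_map (hφ.iterate k) hφ, ← Function.iterate_succ,
      ← Function.iterate_succ_apply' S] at this

/-- A map that multiplies the distances to the identity by `a` carries the bump function of radius
`a s` to that of radius `s`. -/
theorem exists_setLIntegral_bump_eq [MetricSpace L] [OpensMeasurableSpace L] {ν ν' : Measure L}
    {φ : L → L} (hφ : Measurable φ) {a : ℝ} (ha : 0 < a) (hdist : ∀ l, dist (φ l) 1 = a * dist l 1)
    (h : SameClass ν' (ν.map φ)) : ∃ c : ℝ≥0∞, c ≠ 0 ∧ c ≠ ∞ ∧ ∀ (s : ℝ) (T : Set L),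
      MeasurableSet T → ∫⁻ k in T, bump (a * s) k ∂ν' = c * ∫⁻ k in φ ⁻¹' T, bump s k ∂ν := by
  obtain ⟨c, hc0, hct, rfl⟩ := h
  refine ⟨c, hc0, hct, fun s T hT => ?_⟩
  rw [Measure.restrict_smul, lintegral_smul_measure, smul_eq_mul,
    setLIntegral_map hT (measurable_bump _) hφ]
  congr 2
  funext l
  rw [bump, bump, hdist, mul_div_mul_left _ _ ha.ne']

theorem dist_iterate_one [MetricSpace L] {φ : L → L} {α : ℝ}
    (hdist : ∀ l, dist (φ l) 1 = α * dist l 1) (k : ℕ) (l : L) :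
    dist (φ^[k] l) 1 = α ^ k * dist l 1 := by
  induction k with
  | zero => simp
  | succ k ih => rw [Function.iterate_succ_apply', hdist, ih, pow_succ']; ring

/-- The integrals of the bump functions scale under the automorphism. -/
theorem ae_lintegral_bump_scale [MetricSpace L] [OpensMeasurableSpace L] {κ : Kernel X L}
    (hS : MeasurePreserving S lam lam) {φ : L → L} (hφ : Measurable φ)
    (h : ∀ᵐ x ∂lam, SameClass (κ x) ((κ (S x)).map φ)) {α : ℝ} (hα0 : 0 < α)
    (hdist : ∀ l, dist (φ l) 1 = α * dist l 1) :
    ∀ᵐ x ∂lam, ∀ k : ℕ, ∃ c : ℝ≥0∞, c ≠ 0 ∧ c ≠ ∞ ∧ ∀ s : ℝ, 0 < s →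
      ∫⁻ l, bump (α ^ k * s) l ∂(κ x) = c * ∫⁻ l, bump s l ∂(κ (S^[k] x)) := by
  filter_upwards [ae_sameClass_iterate hS hφ h] with x hx k
  obtain ⟨c, hc0, hct, hc⟩ := exists_setLIntegral_bump_eq (hφ.iterate k) (pow_pos hα0 k)
    (dist_iterate_one hdist k) (hx k)
  refine ⟨c, hc0, hct, fun s _ => ?_⟩
  simpa using hc s Set.univ MeasurableSet.univ

/-- The tube integrals scale under the automorphism. -/
theorem MassTransport.ae_tubeIntegral_scale {G : Type*} [Group G] [MetricSpace G]
    [IsTopologicalGroup G] [MeasurableSpace G] [BorelSpace G] [IsIsometricSMul Gᵐᵒᵖ G]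
    {H : Subgroup G} [H.Normal] {κ : Kernel X G}
    (hS : MeasurePreserving S lam lam) {φ : G → G} (hφ : Measurable φ)
    (h : ∀ᵐ x ∂lam, SameClass (κ x) ((κ (S x)).map φ)) {α : ℝ} (hα0 : 0 < α)
    (hdist : ∀ l, dist (φ l) 1 = α * dist l 1)
    (htube : ∀ r, φ ⁻¹' tube H 1 (α * r) = tube H 1 r) :
    ∀ᵐ x ∂lam, ∀ k : ℕ, ∃ c : ℝ≥0∞, c ≠ 0 ∧ c ≠ ∞ ∧ ∀ s r : ℝ,
      tubeIntegral κ H (α ^ k * s) (α ^ k * r) x = c * tubeIntegral κ H s r (S^[k] x) := by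
  have htube' : ∀ (k : ℕ) (r : ℝ), φ^[k] ⁻¹' tube H 1 (α ^ k * r) = tube H 1 r := by
    intro k
    induction k with
    | zero => intro r; simp
    | succ k ih =>
      intro r
      rw [Function.iterate_succ', Set.preimage_comp, pow_succ', mul_assoc, htube, ih]
  filter_upwards [ae_sameClass_iterate hS hφ h] with x hx k
  obtain ⟨c, hc0, hct, hc⟩ := exists_setLIntegral_bump_eq (hφ.iterate k) (pow_pos hα0 k)
    (dist_iterate_one hdist k) (hx k)
  refine ⟨c, hc0, hct, fun s r => ?_⟩
  rw [tubeIntegral, hc s _ (isClosed_tube 1 _).measurableSet, htube', tubeIntegral]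

end Scaling

/-! ### The rates of the conditional measures -/

namespace MassTransport

section Ball

variable {L X : Type*} [Group L] [MetricSpace L] [IsTopologicalGroup L] [ProperSpace L]
  [PolishSpace L] [MeasurableSpace L] [BorelSpace L] [IsIsometricSMul Lᵐᵒᵖ L]
  [MeasurableSpace X] [StandardBorelSpace X] [MulAction L X] [MeasurableSMul₂ L X]
  {lam : Measure X} [IsProbabilityMeasure lam] {κ : Kernel X L} [IsSFiniteKernel κ]

/-- The logarithm of the ratio of the integrals of the bump functions at the scales `1` and `α`. Its
Birkhoff sums govern the decay of the conditional measures. -/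
noncomputable def logRatio (κ : Kernel X L) (α : ℝ) (x : X) : ℝ :=
  Real.log ((∫⁻ k, bump 1 k ∂(κ x)).toReal / (∫⁻ k, bump α k ∂(κ x)).toReal)

theorem measurable_logRatio (α : ℝ) : Measurable (logRatio κ α) := by
  have hI : ∀ s, Measurable fun y => (∫⁻ h, bump s h ∂(κ y)).toReal := fun s =>
    (Measurable.lintegral_kernel (measurable_bump s)).ennreal_toReal
  exact ((hI 1).div (hI α)).log

theorem lintegral_bump_toReal_pos (M : MassTransport lam κ) {s : ℝ} (hs : 0 < s) {x : X}
    (hx : x ∈ M.core) : 0 < (∫⁻ k, bump s k ∂(κ x)).toReal := by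
  refine ENNReal.toReal_pos ?_ (M.lintegral_bump_ne_top hs x)
  rw [← setLIntegral_univ]
  exact M.lintegral_bump_ne_zero hs hx univ_mem

theorem log_div_eq_of_mul {a b a' b' c : ℝ≥0∞} (hc0 : c ≠ 0) (hct : c ≠ ∞) (ha : a' = c * a)
    (hb : b' = c * b) :
    Real.log (a'.toReal / b'.toReal) = Real.log (a.toReal / b.toReal) := by
  rw [ha, hb, ENNReal.toReal_mul, ENNReal.toReal_mul,
    mul_div_mul_left _ _ (ENNReal.toReal_pos hc0 hct).ne']

/-- The integral of the bump function decays at the rate given by Birkhoff's theorem. -/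
theorem ae_hasRate_lintegral_bump (M : MassTransport lam κ) {S : X → X} (hS : Ergodic S lam)
    {α : ℝ} (hα0 : 0 < α) (hint : Integrable (logRatio κ α) lam)
    (hscale : ∀ᵐ x ∂lam, ∀ k : ℕ, ∃ c : ℝ≥0∞, c ≠ 0 ∧ c ≠ ∞ ∧ ∀ s : ℝ, 0 < s →
      ∫⁻ l, bump (α ^ k * s) l ∂(κ x) = c * ∫⁻ l, bump s l ∂(κ (S^[k] x))) :
    ∀ᵐ x ∂lam, HasRate (fun n => ∫⁻ k, bump (α ^ n) k ∂(κ x)) (-∫ x, logRatio κ α x ∂lam) := by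
  filter_upwards [hscale, tendsto_birkhoffSum_div hS (measurable_logRatio α) hint, M.ae_mem_core]
    with x hx hlim hcore
  let u : ℕ → ℝ≥0∞ := fun n => ∫⁻ k, bump (α ^ n) k ∂(κ x)
  have hu : ∀ n, 0 < (u n).toReal := fun n => M.lintegral_bump_toReal_pos (pow_pos hα0 n) hcore
  refine ⟨Eventually.of_forall fun n => ?_, ?_⟩
  · exact ⟨fun h => (hu n).ne' (by rw [show u n = 0 from h]; rfl),
      M.lintegral_bump_ne_top (pow_pos hα0 n) x⟩
  have hsum : ∀ n, birkhoffSum S (logRatio κ α) n x =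
      Real.log (u 0).toReal - Real.log (u n).toReal := by
    intro n
    rw [birkhoffSum, ← Finset.sum_range_sub' (fun n => Real.log (u n).toReal)]
    refine Finset.sum_congr rfl fun k _ => ?_
    obtain ⟨c, hc0, hct, hc⟩ := hx k
    rw [← Real.log_div (hu k).ne' (hu _).ne', logRatio]
    refine (log_div_eq_of_mul hc0 hct ?_ ?_).symm
    · simpa using hc 1 one_pos
    · simpa [u, pow_succ] using hc α hα0
  have h1 : Tendsto (fun n : ℕ => Real.log (u 0).toReal / n - birkhoffSum S (logRatio κ α) n x / n)
      atTop (𝓝 (0 - ∫ x, logRatio κ α x ∂lam)) :=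
    (tendsto_const_div_atTop_nhds_zero_nat _).sub hlim
  rw [zero_sub] at h1
  refine h1.congr fun n => ?_
  rw [hsum, ← sub_div, sub_sub_cancel]

/-- Balls are compared with the bump functions of the same radius and of a radius larger by the
factor `α⁻¹`; the centre is moved from the identity to a typical point by translation. -/
theorem ae_ae_hasRate_ball (M : MassTransport lam κ) {α : ℝ} (hα0 : 0 < α) (hα1 : α < 1) {l : ℝ}
    (h : ∀ᵐ x ∂lam, HasRate (fun n => ∫⁻ k, bump (α ^ n) k ∂(κ x)) l) :
    ∀ᵐ x ∂lam, ∀ᵐ g ∂(κ x), HasRate (fun n => κ x (Metric.ball g (α ^ n))) l := by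
  have hb : ∀ᵐ x ∂lam, HasRate (fun n => κ x (Metric.ball 1 (α ^ n))) l := by
    filter_upwards [h] with x hx
    have hm : ∀ r, MeasurableSet (Metric.ball (1 : L) r) := fun r => Metric.isOpen_ball.measurableSet
    have hle : ∀ n, ∫⁻ k, bump (α ^ n) k ∂(κ x) ≤ κ x (Metric.ball 1 (α ^ n)) := by
      intro n
      rw [← lintegral_indicator_one (hm _)]
      refine lintegral_mono fun k => ?_
      by_cases hk : k ∈ Metric.ball (1 : L) (α ^ n)
      · rw [Set.indicator_of_mem hk]; exact bump_le_one (pow_pos hα0 n) k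
      · rw [Set.indicator_of_notMem hk]
        exact (not_not.1 fun h0 => hk ((bump_ne_zero_iff (pow_pos hα0 n) k).1 h0)).le
    have hge : ∀ n, ENNReal.ofReal (1 - α) * κ x (Metric.ball 1 (α ^ (n + 1))) ≤
        ∫⁻ k, bump (α ^ n) k ∂(κ x) := by
      intro n
      rw [← lintegral_indicator_one (hm _), ← lintegral_const_mul _ (measurable_one.indicator (hm _))]
      refine lintegral_mono fun k => ?_
      by_cases hk : k ∈ Metric.ball (1 : L) (α ^ (n + 1))
      · rw [Set.indicator_of_mem hk, Pi.one_apply, mul_one]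
        refine le_bump (pow_pos hα0 n) ?_
        rw [← pow_succ']
        exact (Metric.mem_ball.1 hk).le
      · rw [Set.indicator_of_notMem hk, mul_zero]; exact zero_le
    have hc0 : ENNReal.ofReal (1 - α) ≠ 0 := by simpa using hα1
    have hct : ENNReal.ofReal (1 - α) ≠ ∞ := ENNReal.ofReal_ne_top
    rw [← hasRate_shift_iff 1]
    refine HasRate.squeeze (C := (ENNReal.ofReal (1 - α))⁻¹) ((hasRate_shift_iff 1).2 hx) hx
      one_ne_zero ENNReal.one_ne_top (ENNReal.inv_ne_zero.2 hct) (ENNReal.inv_ne_top.2 hc0)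
      (fun n => ?_) fun n => ?_
    · rw [one_mul]; exact hle _
    · rw [mul_comm, ← div_eq_mul_inv, ENNReal.le_div_iff_mul_le (Or.inl hc0) (Or.inl hct), mul_comm]
      exact hge n
  filter_upwards [M.ae_mem_core, M.ae_ae_smul (M.ae_mem_core.and hb)] with x hx hg
  filter_upwards [hg] with g hg
  obtain ⟨hc0, hct⟩ := M.cocycle_ne x hx g hg.1
  refine HasRate.of_const_mul hc0 hct ?_
  convert hg.2 using 2 with n
  rw [M.measure_smul hx hg.1 Metric.isOpen_ball.measurableSet, preimage_ball_one]

end Ball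

section Tube

variable {G X : Type*} [Group G] [MetricSpace G] [IsTopologicalGroup G] [ProperSpace G]
  [PolishSpace G] [MeasurableSpace G] [BorelSpace G] [IsIsometricSMul Gᵐᵒᵖ G]
  [MeasurableSpace X] [StandardBorelSpace X] [MulAction G X] [MeasurableSMul₂ G X]
  {lam : Measure X} [IsProbabilityMeasure lam] {H : Subgroup G} [hH : IsClosed (H : Set G)]
  [H.Normal] {κ : Kernel X G} [IsSFiniteKernel κ] {η : Kernel X H} [IsSFiniteKernel η]

/-- The function `logRatio` is the case of a tube that contains the support of the bump functions. -/
theorem integrable_logRatio (M : MassTransport lam κ) {N : ℕ}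
    (hN : HasBesicovitchBound (G ⧸ H) N) {α : ℝ} (hα0 : 0 < α) (hα1 : α < 1) :
    Integrable (logRatio κ α) lam := by
  obtain ⟨D, hD, hbound⟩ := M.exists_integrable_bound hN hα0 hα1 (a := fun n => α ^ n)
    fun n => pow_pos hα0 n
  refine hD.mono' (measurable_logRatio α).aestronglyMeasurable ?_
  filter_upwards [hbound] with x hx
  have := hx 0
  rwa [pow_zero, tubeIntegral_eq_lintegral one_pos le_rfl,
    tubeIntegral_eq_lintegral hα0 hα1.le] at this

/-- The integral of the bump function of radius `1` on thin tubes decays at the rate given by the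
difference of the integrals of the functions `logRatio` of `H` and of `G`: the logarithm of the
quotient of this integral by that of the bump function of radius `α ^ n` is a sum along the orbit of
functions which converge to the function `logRatio` of `H`, and Maker's theorem applies. -/
theorem ae_hasRate_tubeIntegral (M : MassTransport lam κ) (M' : MassTransport lam η) {N : ℕ}
    (hN : HasBesicovitchBound (G ⧸ H) N) {S : X → X} (hS : Ergodic S lam) {α : ℝ} (hα0 : 0 < α)
    (hα1 : α < 1)
    (hscale : ∀ᵐ x ∂lam, ∀ k : ℕ, ∃ c : ℝ≥0∞, c ≠ 0 ∧ c ≠ ∞ ∧ ∀ s r : ℝ,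
      tubeIntegral κ H (α ^ k * s) (α ^ k * r) x = c * tubeIntegral κ H s r (S^[k] x)) :
    Integrable (logRatio η α) lam ∧
    ∀ᵐ x ∂lam, HasRate (fun n => tubeIntegral κ H 1 (α ^ n) x)
      (∫ x, logRatio η α x ∂lam - ∫ x, logRatio κ α x ∂lam) := by
  have ha : ∀ n, 0 < α ^ n := fun n => pow_pos hα0 n
  obtain ⟨D, hD, hbound⟩ := M.exists_integrable_bound hN hα0 hα1 ha
  have hJ : ∀ s r, Measurable fun y => (tubeIntegral κ H s r y).toReal := fun s r =>
    (measurable_tubeIntegral s r).ennreal_toReal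
  have hlim : ∀ᵐ x ∂lam, Tendsto (fun m : ℕ => Real.log ((tubeIntegral κ H 1 (α ^ m) x).toReal /
      (tubeIntegral κ H α (α ^ m) x).toReal)) atTop (𝓝 (logRatio η α x)) := by
    filter_upwards [M.ae_tendsto_tubeIntegral_div M' hN one_pos le_rfl hα0 hα1.le ha
      (tendsto_pow_atTop_nhds_zero_of_lt_one hα0.le hα1), M'.ae_mem_core] with x hx hcore
    exact hx.log (div_pos (M'.lintegral_bump_toReal_pos one_pos hcore)
      (M'.lintegral_bump_toReal_pos hα0 hcore)).ne'
  obtain ⟨hint, hsum⟩ := tendsto_sum_maker hS (g := fun m x =>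
    Real.log ((tubeIntegral κ H 1 (α ^ m) x).toReal / (tubeIntegral κ H α (α ^ m) x).toReal))
    (fun m => ((hJ _ _).div (hJ _ _)).log) (measurable_logRatio α) hD hbound hlim
  refine ⟨hint, ?_⟩
  have hscale' : ∀ᵐ x ∂lam, ∀ k : ℕ, ∃ c : ℝ≥0∞, c ≠ 0 ∧ c ≠ ∞ ∧ ∀ s : ℝ, 0 < s →
      ∫⁻ l, bump (α ^ k * s) l ∂(κ x) = c * ∫⁻ l, bump s l ∂(κ (S^[k] x)) := by
    filter_upwards [hscale] with x hx k
    obtain ⟨c, hc0, hct, hc⟩ := hx k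
    refine ⟨c, hc0, hct, fun s hs => ?_⟩
    have := hc s s
    rwa [tubeIntegral_eq_lintegral hs le_rfl,
      tubeIntegral_eq_lintegral (mul_pos (ha k) hs) le_rfl] at this
  filter_upwards [hscale, hsum, M.ae_mem_core, M.ae_hasRate_lintegral_bump hS hα0
    (M.integrable_logRatio hN hα0 hα1) hscale'] with x hx hsx hcore hI
  have hpos : ∀ k n, 0 < (tubeIntegral κ H (α ^ k) (α ^ n) x).toReal := fun k n =>
    M.tubeIntegral_toReal_pos (ha k) (ha n) hcore
  -- the tube of radius `α ^ n` becomes, after `k` rescalings, the tube of radius `α ^ (n - k)`; the bump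
  -- radius goes down from `1` to `α ^ n`, where the tube contains the whole bump
  have htel : ∀ n, ∑ k ∈ Finset.range n, Real.log ((tubeIntegral κ H 1 (α ^ (n - k))
      (S^[k] x)).toReal / (tubeIntegral κ H α (α ^ (n - k)) (S^[k] x)).toReal) =
      Real.log (tubeIntegral κ H 1 (α ^ n) x).toReal -
        Real.log (∫⁻ k, bump (α ^ n) k ∂(κ x)).toReal := by
    intro n
    rw [← tubeIntegral_eq_lintegral (H := H) (ha n) le_rfl,
      show tubeIntegral κ H 1 (α ^ n) x = tubeIntegral κ H (α ^ 0) (α ^ n) x by rw [pow_zero],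
      ← Finset.sum_range_sub' (fun k => Real.log (tubeIntegral κ H (α ^ k) (α ^ n) x).toReal)]
    refine Finset.sum_congr rfl fun k hk => ?_
    obtain ⟨c, hc0, hct, hc⟩ := hx k
    have hkn : α ^ k * α ^ (n - k) = α ^ n := by
      rw [← pow_add, Nat.add_sub_cancel' (Finset.mem_range.1 hk).le]
    rw [← Real.log_div (hpos _ _).ne' (hpos _ _).ne']
    refine (log_div_eq_of_mul hc0 hct ?_ ?_).symm
    · simpa [hkn] using hc 1 (α ^ (n - k))
    · simpa [hkn, pow_succ] using hc α (α ^ (n - k))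
  refine ⟨Eventually.of_forall fun n => ⟨M.tubeIntegral_ne_zero one_pos (ha n) hcore,
    M.tubeIntegral_ne_top one_pos _ x⟩, ?_⟩
  rw [sub_eq_add_neg]
  refine (hsx.add hI.2).congr fun n => ?_
  rw [htel, ← add_div, sub_add_cancel]

end Tube

end MassTransport

/-! ### The transverse measures -/

section Rate

theorem measurable_measure_closedBall {Y : Type*} [PseudoMetricSpace Y] [SecondCountableTopology Y]
    [MeasurableSpace Y] [BorelSpace Y] (θ : Measure Y) [SFinite θ] (r : ℝ) :
    Measurable fun y => θ (Metric.closedBall y r) := by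
  have hm : MeasurableSet {p : Y × Y | dist p.2 p.1 ≤ r} :=
    (isClosed_le (by fun_prop) continuous_const).measurableSet
  exact measurable_measure_prodMk_left hm

theorem measurableSet_hasRate {Y : Type*} [MeasurableSpace Y] {u : ℕ → Y → ℝ≥0∞}
    (hu : ∀ n, Measurable (u n)) (l : ℝ) : MeasurableSet {y | HasRate (fun n => u n y) l} := by
  have h1 : MeasurableSet {y | ∀ᶠ n in atTop, u n y ≠ 0 ∧ u n y ≠ ∞} := by
    have : {y | ∀ᶠ n in atTop, u n y ≠ 0 ∧ u n y ≠ ∞} =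
        ⋃ N : ℕ, ⋂ n : ℕ, ⋂ _ : N ≤ n, u n ⁻¹' ({0}ᶜ ∩ {∞}ᶜ) := by
      ext y
      simp only [Set.mem_ofPred_eq, eventually_atTop, Set.mem_iUnion, Set.mem_iInter]
      rfl
    rw [this]
    exact MeasurableSet.iUnion fun N => MeasurableSet.iInter fun n => MeasurableSet.iInter fun _ =>
      hu n ((measurableSet_singleton _).compl.inter (measurableSet_singleton _).compl)
  exact h1.inter (measurableSet_tendsto (𝓝 l) fun n => (hu n).ennreal_toReal.log.div_const _)

/-- The lower dimension at a point follows from the rate of the closed balls of geometric radii. -/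
theorem HasRate.lowerPointwiseDim_eq {Y : Type*} [PseudoMetricSpace Y] [MeasurableSpace Y]
    {θ : Measure Y} {y : Y} {α l : ℝ} (hα0 : 0 < α) (hα1 : α < 1)
    (h : HasRate (fun n => θ (Metric.closedBall y (α ^ n))) l) :
    lowerPointwiseDim θ y = ((l / Real.log α : ℝ) : EReal) := by
  have hb : HasRate (fun n => θ (Metric.ball y (α ^ n))) l := by
    refine HasRate.squeeze ((hasRate_shift_iff 1).2 h) h one_ne_zero ENNReal.one_ne_top one_ne_zero
      ENNReal.one_ne_top (fun n => ?_) fun n => ?_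
    · rw [one_mul]
      refine measure_mono (Metric.closedBall_subset_ball ?_)
      rw [pow_succ]
      exact mul_lt_of_lt_one_right (pow_pos hα0 n) hα1
    · rw [one_mul]
      exact measure_mono Metric.ball_subset_closedBall
  exact (hb.tendsto_log_div_log (F := fun r => θ (Metric.ball y r))
    (fun r s _ hrs => measure_mono (Metric.ball_subset_ball hrs)) hα0 hα1).liminf_eq

end Rate

namespace MassTransport

variable {G X : Type*} [Group G] [MetricSpace G] [IsTopologicalGroup G] [ProperSpace G]
  [PolishSpace G] [MeasurableSpace G] [BorelSpace G] [IsIsometricSMul Gᵐᵒᵖ G]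
  [MeasurableSpace X] [StandardBorelSpace X] [MulAction G X] [MeasurableSMul₂ G X]
  {lam : Measure X} [IsProbabilityMeasure lam] {H : Subgroup G} [hH : IsClosed (H : Set G)]
  [H.Normal] {κ : Kernel X G} [IsSFiniteKernel κ]

/-- The rate does not depend on the radius of the bump function: the radius `(α ^ j)⁻¹` is reduced
to `1` by `j` rescalings, which only shift the sequence. -/
theorem ae_hasRate_tubeIntegral_inv {S : X ≃ᵐ X} (hS : MeasurePreserving S lam lam) {α l : ℝ}
    (hα0 : 0 < α)
    (hscale : ∀ᵐ x ∂lam, ∀ k : ℕ, ∃ c : ℝ≥0∞, c ≠ 0 ∧ c ≠ ∞ ∧ ∀ s r : ℝ,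
      tubeIntegral κ H (α ^ k * s) (α ^ k * r) x = c * tubeIntegral κ H s r (S^[k] x))
    (h : ∀ᵐ x ∂lam, HasRate (fun n => tubeIntegral κ H 1 (α ^ n) x) l) :
    ∀ᵐ x ∂lam, ∀ j : ℕ, HasRate (fun n => tubeIntegral κ H (α ^ j)⁻¹ (α ^ n) x) l := by
  refine ae_all_iff.2 fun j => ?_
  have h2 := ((hS.symm S).iterate j).quasiMeasurePreserving.ae (hscale.and h)
  filter_upwards [h2] with x hx
  obtain ⟨c, hc0, hct, hc⟩ := hx.1 j
  have hinv : S^[j] (S.symm^[j] x) = x := (Function.LeftInverse.iterate S.apply_symm_apply j) x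
  rw [hinv] at hc
  refine HasRate.of_const_mul hc0 hct ?_
  convert (hasRate_shift_iff j).2 hx.2 using 2 with n
  rw [← hc, mul_inv_cancel₀ (pow_pos hα0 j).ne', ← pow_add, add_comm j]

/-- The measure of a thin tube in a compact set, around a typical point, is comparable with the tube
integrals at the corresponding point of the orbit: the lower bound comes from the comparison of two
measures in a space with the Besicovitch property. -/
theorem ae_ae_hasRate_transverse (M : MassTransport lam κ) {N : ℕ}
    (hN : HasBesicovitchBound (G ⧸ H) N) {α l : ℝ} (hα0 : 0 < α) (hα1 : α < 1)
    (h : ∀ᵐ x ∂lam, ∀ j : ℕ, HasRate (fun n => tubeIntegral κ H (α ^ j)⁻¹ (α ^ n) x) l) {B : Set G}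
    (hB : IsCompact B) (hB1 : B ∈ 𝓝 1) :
    ∀ᵐ x ∂lam, ∀ᵐ q ∂(transverseMeasure H B (κ x)),
      HasRate (fun n => transverseMeasure H B (κ x) (Metric.closedBall q (α ^ n))) l := by
  have hmk : Measurable (QuotientGroup.mk : G → G ⧸ H) :=
    (QuotientGroup.continuous_mk (N := H)).measurable
  obtain ⟨R, hR0, hBR⟩ : ∃ R : ℝ, 0 < R ∧ B ⊆ Metric.closedBall 1 R := by
    obtain ⟨R, hR⟩ := hB.isBounded.subset_closedBall (1 : G)
    exact ⟨max R 1, by positivity, hR.trans (Metric.closedBall_subset_closedBall (le_max_left _ _))⟩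
  -- the bump function of radius `(α ^ j)⁻¹` around a point of `B` is at least `1 / 2` on `B`
  obtain ⟨j, hj⟩ : ∃ j : ℕ, 4 * R ≤ (α ^ j)⁻¹ := by
    obtain ⟨j, hj⟩ := exists_pow_lt_of_lt_one (inv_pos.2 (show 0 < 4 * R by positivity)) hα1
    exact ⟨j, (le_inv_comm₀ (by positivity) (pow_pos hα0 j)).2 hj.le⟩
  filter_upwards [M.ae_mem_core, M.ae_ae_smul (M.ae_mem_core.and h)] with x hx hgood
  -- `K` contains the ball of radius `1` around every point of `B`
  set K : Set G := Metric.closedBall 1 (R + 1)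
  have hKt : κ x K ≠ ∞ := (M.regular x).2 _ (isCompact_closedBall _ _)
  have hBt : κ x B ≠ ∞ := (M.regular x).2 _ hB
  have hB0 : κ x B ≠ 0 := M.nhds_pos x hx B hB1
  have hBf : IsFiniteMeasure ((κ x).restrict B) :=
    ⟨by rw [Measure.restrict_apply_univ]; exact hBt.lt_top⟩
  have hKf : IsFiniteMeasure ((κ x).restrict K) :=
    ⟨by rw [Measure.restrict_apply_univ]; exact hKt.lt_top⟩
  set θ : Measure (G ⧸ H) := ((κ x).restrict B).map QuotientGroup.mk with hθ
  set θK : Measure (G ⧸ H) := ((κ x).restrict K).map QuotientGroup.mk with hθK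
  have htr : transverseMeasure H B (κ x) = (κ x B)⁻¹ • θ := by
    rw [transverseMeasure, ProbabilityTheory.cond, Measure.map_smul]
  have hcb : ∀ (E : Set G) (g : G) (r : ℝ), ((κ x).restrict E).map (QuotientGroup.mk : G → G ⧸ H)
      (Metric.closedBall (g : G ⧸ H) r) = κ x (E ∩ tube H g r) := by
    intro E g r
    rw [Measure.map_apply hmk Metric.isClosed_closedBall.measurableSet,
      Measure.restrict_apply (hmk Metric.isClosed_closedBall.measurableSet), Set.inter_comm]
    rfl
  have hmain : ∀ᵐ g : G ∂((κ x).restrict B),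
      HasRate (fun n => θ (Metric.closedBall (g : G ⧸ H) (α ^ n))) l := by
    filter_upwards [ae_of_ae_map hmk.aemeasurable (hN.ae_exists_le θ θK),
      ae_restrict_mem hB.measurableSet, ae_restrict_of_ae hgood] with g ⟨c, hc0, hct, hc⟩ hgB hg
    obtain ⟨hd0, hdt⟩ := M.cocycle_ne x hx g hg.1
    have hsm := M.tubeIntegral_smul (H := H) hx hg.1
    refine HasRate.of_const_mul hd0 hdt ?_
    -- lower bound: `θ` is comparable with `θK`, which dominates the bump function of radius `1` around
    -- `g`; upper bound: `B` is dominated by twice the bump function of radius `(α ^ j)⁻¹`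
    refine HasRate.squeeze (c := c) (C := 2) (hg.2 0) (hg.2 j) hc0 hct two_ne_zero
      ENNReal.ofNat_ne_top (fun n => ?_) fun n => ?_
    · rw [pow_zero, inv_one, hsm, mul_left_comm]
      gcongr
      refine le_trans ?_ (hc _ (pow_pos hα0 n))
      gcongr
      rw [hθK, hcb, ← Measure.restrict_apply Metric.isClosed_closedBall.measurableSet,
        ← lintegral_indicator_one Metric.isClosed_closedBall.measurableSet]
      refine lintegral_mono fun k => ?_
      by_cases hk : k ∈ K
      · rw [Set.indicator_of_mem hk]; exact bump_le_one one_pos _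
      · rw [Set.indicator_of_notMem hk]
        suffices hb : ¬ bump 1 (k * g⁻¹) ≠ 0 from (not_not.1 hb).le
        intro h0
        refine hk ?_
        rw [bump_ne_zero_iff one_pos, dist_mul_inv_one] at h0
        refine Metric.mem_closedBall.2 ((dist_triangle k g 1).trans ?_)
        have := Metric.mem_closedBall.1 (hBR hgB)
        linarith
    · rw [hsm, mul_left_comm]
      gcongr
      rw [hθ, hcb, ← Measure.restrict_apply hB.measurableSet,
        ← lintegral_indicator_one hB.measurableSet, ← lintegral_const_mul
          (f := fun k => bump (α ^ j)⁻¹ (k * g⁻¹)) _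
          ((measurable_bump _).comp (measurable_mul_const _))]
      refine lintegral_mono fun k => ?_
      by_cases hk : k ∈ B
      · rw [Set.indicator_of_mem hk, Pi.one_apply]
        have h3 := le_bump (t := 1 / 2) (inv_pos.2 (pow_pos hα0 j)) (k := k * g⁻¹) (by
          rw [dist_mul_inv_one]
          have h4 := Metric.mem_closedBall.1 (hBR hgB)
          have h5 := Metric.mem_closedBall.1 (hBR hk)
          have h6 := dist_triangle_right k g 1
          linarith)
        calc (1 : ℝ≥0∞) = 2 * ENNReal.ofReal (1 - 1 / 2) := by
              rw [show (2 : ℝ≥0∞) = ENNReal.ofReal 2 by simp, ← ENNReal.ofReal_mul (by norm_num)]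
              norm_num
          _ ≤ 2 * bump (α ^ j)⁻¹ (k * g⁻¹) := by gcongr
      · rw [Set.indicator_of_notMem hk]; exact zero_le
  have hmain' : ∀ᵐ q ∂θ, HasRate (fun n => θ (Metric.closedBall q (α ^ n))) l :=
    (ae_map_iff hmk.aemeasurable
      (measurableSet_hasRate (fun n => measurable_measure_closedBall θ _) l)).2 hmain
  rw [htr]
  filter_upwards [Measure.ae_smul_measure hmain' (κ x B)⁻¹] with q hq
  exact hq.const_mul (ENNReal.inv_ne_zero.2 hBt) (ENNReal.inv_ne_top.2 hB0)

end MassTransport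

/-! ### Dimensions from rates -/

section Dimensions

theorem hasDimAlong_of_ae_hasRate {L X : Type*} [Group L] [MetricSpace L] [IsTopologicalGroup L]
    [PolishSpace L] [MeasurableSpace L] [BorelSpace L] [LocallyCompactSpace L]
    [MeasurableSpace X] [StandardBorelSpace X] [MulAction L X] [MeasurableSMul₂ L X]
    {lam : Measure X} [IsFiniteMeasure lam] (hdisc : HasUniformlyDiscreteStabilizers L X)
    {σ : X → Measure L} (hσ : IsDisintegration lam σ) {α l : ℝ} (hα0 : 0 < α) (hα1 : α < 1)
    (h : ∀ᵐ x ∂lam, ∀ᵐ g ∂(σ x), HasRate (fun n => σ x (Metric.ball g (α ^ n))) l) :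
    HasDimAlong L lam (l / Real.log α) := by
  refine ⟨⟨σ, hσ⟩, fun σ' hσ' => ?_⟩
  filter_upwards [h, IsDisintegration.ae_sameClass hdisc hσ' hσ] with x hx ⟨c, hc0, hct, hc⟩
  rw [hc]
  filter_upwards [Measure.ae_smul_measure hx c] with g hg
  exact HasRate.tendsto_log_div_log (F := fun r => (c • σ x) (Metric.ball g r))
    (fun r s _ hrs => measure_mono (Metric.ball_subset_ball hrs)) hα0 hα1 (hg.const_mul hc0 hct)

theorem SameClass.transverseMeasure_eq {G : Type*} [Group G] [MeasurableSpace G] {H : Subgroup G}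
    {B : Set G} {μ ν : Measure G} (h : SameClass μ ν) :
    transverseMeasure H B μ = transverseMeasure H B ν := by
  obtain ⟨c, hc0, hct, rfl⟩ := h
  rw [transverseMeasure, transverseMeasure, ProbabilityTheory.cond, ProbabilityTheory.cond,
    Measure.restrict_smul, smul_smul, Measure.smul_apply, smul_eq_mul,
    ENNReal.mul_inv (Or.inl hc0) (Or.inl hct), mul_right_comm, ENNReal.inv_mul_cancel hc0 hct,
    one_mul]

theorem hasTransverseDim_of_ae_hasRate {G X : Type*} [Group G] [MetricSpace G]
    [IsTopologicalGroup G] [PolishSpace G] [MeasurableSpace G] [BorelSpace G]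
    [LocallyCompactSpace G] [IsIsometricSMul Gᵐᵒᵖ G] [MeasurableSpace X] [StandardBorelSpace X]
    [MulAction G X] [MeasurableSMul₂ G X] {lam : Measure X} [IsFiniteMeasure lam]
    (hdisc : HasUniformlyDiscreteStabilizers G X) {H : Subgroup G} {σ : X → Measure G}
    (hσ : IsDisintegration lam σ) {α l : ℝ} (hα0 : 0 < α) (hα1 : α < 1)
    (h : ∀ B : Set G, IsCompact B → B ∈ 𝓝 1 → ∀ᵐ x ∂lam, ∀ᵐ q ∂(transverseMeasure H B (σ x)),
      HasRate (fun n => transverseMeasure H B (σ x) (Metric.closedBall q (α ^ n))) l) :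
    HasTransverseDim H lam (l / Real.log α) := by
  refine ⟨⟨σ, hσ⟩, fun σ' hσ' B hB hB1 => ?_⟩
  filter_upwards [h B hB hB1, IsDisintegration.ae_sameClass hdisc hσ' hσ] with x hx hc
  rw [hc.transverseMeasure_eq]
  filter_upwards [hx] with q hq
  exact hq.lowerPointwiseDim_eq hα0 hα1

end Dimensions

/-! ### Groups with a contracting similitude -/

section Similitude

variable {G : Type*} [Group G] [MetricSpace G] {αG : G ≃* G} {α : ℝ}

theorem dist_symm_of_similitude (hα0 : 0 < α) (hsim : ∀ g h : G, dist (αG g) (αG h) = α * dist g h)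
    (g h : G) : dist (αG.symm g) (αG.symm h) = α⁻¹ * dist g h := by
  rw [eq_inv_mul_iff_mul_eq₀ hα0.ne', ← hsim, MulEquiv.apply_symm_apply, MulEquiv.apply_symm_apply]

theorem continuous_of_dist_eq_mul {φ : G → G} {a : ℝ} (hφ : ∀ g h, dist (φ g) (φ h) = a * dist g h)
    : Continuous φ := by
  refine continuous_iff_continuousAt.2 fun g => tendsto_iff_dist_tendsto_zero.2 ?_
  simp only [hφ]
  have : Tendsto (fun h => a * dist h g) (𝓝 g) (𝓝 (a * dist g g)) :=
    Continuous.tendsto (by fun_prop) g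
  simpa using this

/-- A contracting similitude, seen as an automorphism of topological groups. -/
def continuousMulEquivOfSimilitude (hα0 : 0 < α)
    (hsim : ∀ g h : G, dist (αG g) (αG h) = α * dist g h) : G ≃ₜ* G where
  toMulEquiv := αG
  continuous_toFun := continuous_of_dist_eq_mul hsim
  continuous_invFun := continuous_of_dist_eq_mul (dist_symm_of_similitude hα0 hsim)

/-- The closed balls are compact, since the similitude maps each of them into a small one. -/
theorem properSpace_of_similitude [IsIsometricSMul Gᵐᵒᵖ G] [LocallyCompactSpace G] (hα0 : 0 < α)
    (hα1 : α < 1) (hsim : ∀ g h : G, dist (αG g) (αG h) = α * dist g h) : ProperSpace G := by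
  have hstep : ∀ r : ℝ, IsCompact (Metric.closedBall (1 : G) (α * r)) →
      IsCompact (Metric.closedBall (1 : G) r) := by
    intro r hr
    have : Metric.closedBall (1 : G) r = αG.symm '' Metric.closedBall (1 : G) (α * r) := by
      ext g
      simp only [Set.mem_image, Metric.mem_closedBall]
      constructor
      · intro hg
        refine ⟨αG g, ?_, αG.symm_apply_apply g⟩
        rw [← map_one αG, hsim]
        gcongr
      · rintro ⟨k, hk, rfl⟩
        rw [← map_one αG.symm, dist_symm_of_similitude hα0 hsim, inv_mul_le_iff₀ hα0]
        exact hk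
    rw [this]
    exact hr.image (continuous_of_dist_eq_mul (dist_symm_of_similitude hα0 hsim))
  have hiter : ∀ (n : ℕ) (r : ℝ), IsCompact (Metric.closedBall (1 : G) (α ^ n * r)) →
      IsCompact (Metric.closedBall (1 : G) r) := by
    intro n
    induction n with
    | zero => intro r hr; simpa using hr
    | succ n ih => intro r hr; exact ih r (hstep _ (by rwa [← mul_assoc, ← pow_succ']))
  obtain ⟨K, hK, hK1⟩ := exists_compact_mem_nhds (1 : G)
  obtain ⟨ε, hε, hεK⟩ := Metric.nhds_basis_closedBall.mem_iff.1 hK1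
  have hone : ∀ r : ℝ, IsCompact (Metric.closedBall (1 : G) r) := by
    intro r
    have ht : Tendsto (fun n : ℕ => α ^ n * r) atTop (𝓝 (0 * r)) :=
      (tendsto_pow_atTop_nhds_zero_of_lt_one hα0.le hα1).mul_const r
    rw [zero_mul] at ht
    obtain ⟨n, hn⟩ := (ht.eventually (gt_mem_nhds hε)).exists
    exact hiter n r (hK.of_isClosed_subset Metric.isClosed_closedBall
      ((Metric.closedBall_subset_closedBall hn.le).trans hεK))
  refine ⟨fun g r => ?_⟩
  have hm : Continuous fun k : G => k * g :=
    continuous_of_dist_eq_mul (a := 1) fun k l => by rw [one_mul]; exact dist_mul_right k l g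
  convert (hone r).image hm using 1
  ext k
  simp only [Set.mem_image, Metric.mem_closedBall]
  constructor
  · intro hk
    exact ⟨k * g⁻¹, by rwa [dist_mul_inv_one], by simp⟩
  · rintro ⟨l, hl, rfl⟩
    have := dist_mul_right l 1 g
    rw [one_mul] at this
    rwa [this]

variable {H : Subgroup G}

/-- The restriction of a similitude to an invariant subgroup. -/
noncomputable def restrictSimilitude (hα0 : 0 < α)
    (hsim : ∀ g h : G, dist (αG g) (αG h) = α * dist g h) (hHinv : H.map αG.toMonoidHom = H) :
    H ≃ₜ* H :=
  continuousMulEquivOfSimilitude (αG := (αG.subgroupMap H).trans (MulEquiv.subgroupCongr hHinv)) hα0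
    fun g h => hsim g h

theorem preimage_tube_of_similitude [IsIsometricSMul Gᵐᵒᵖ G] [IsTopologicalGroup G] [H.Normal]
    (hα0 : 0 < α)
    (hsim : ∀ g h : G, dist (αG g) (αG h) = α * dist g h) (hHinv : H.map αG.toMonoidHom = H)
    (r : ℝ) : αG ⁻¹' tube H 1 (α * r) = tube H 1 r := by
  have hmem : ∀ g : G, g ∈ H → αG g ∈ H := fun g hg => by
    rw [← hHinv]; exact Subgroup.mem_map_of_mem _ hg
  have hmem' : ∀ g : G, g ∈ H → αG.symm g ∈ H := fun g hg => by
    rw [← hHinv] at hg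
    obtain ⟨k, hk, rfl⟩ := hg
    simpa using hk
  have h1 : ∀ g k : G, dist (αG g : G ⧸ H) (αG k : G ⧸ H) ≤ α * dist (g : G ⧸ H) (k : G ⧸ H) :=
    dist_mk_map_le hα0.le hsim fun g k hgk => by
      rw [QuotientGroup.eq] at hgk ⊢
      rw [← map_inv, ← map_mul]
      exact hmem _ hgk
  have h2 : ∀ g k : G, dist (αG.symm g : G ⧸ H) (αG.symm k : G ⧸ H) ≤
      α⁻¹ * dist (g : G ⧸ H) (k : G ⧸ H) :=
    dist_mk_map_le (inv_pos.2 hα0).le (dist_symm_of_similitude hα0 hsim) fun g k hgk => by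
      rw [QuotientGroup.eq] at hgk ⊢
      rw [← map_inv, ← map_mul]
      exact hmem' _ hgk
  ext k
  rw [Set.mem_preimage, tube, tube, Set.mem_ofPred_eq, Set.mem_ofPred_eq]
  constructor
  · intro hk
    have := h2 (αG k) 1
    rw [αG.symm_apply_apply, map_one] at this
    refine this.trans ?_
    rwa [inv_mul_le_iff₀ hα0]
  · intro hk
    have := h1 k 1
    rw [map_one] at this
    exact this.trans (by gcongr)

end Similitude

end GroupDisintegration

theorem theorem23 {G : Type*} {X : Type*}
    -- a locally compact second countable group with a compatible right-invariant metric
    [Group G] [MetricSpace G] [IsTopologicalGroup G] [LocallyCompactSpace G]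
    [SecondCountableTopology G] [MeasurableSpace G] [BorelSpace G] [IsIsometricSMul Gᵐᵒᵖ G]
    -- acting in a Borel way on a standard Borel space, with uniformly discrete stabilizers
    [MeasurableSpace X] [StandardBorelSpace X] [MulAction G X] [MeasurableSMul₂ G X]
    (hdisc : GroupDisintegration.HasUniformlyDiscreteStabilizers G X)
    -- a Borel probability measure, invariant and ergodic under an equivariant automorphism
    (lam : Measure X) [IsProbabilityMeasure lam]
    (αX : X ≃ᵐ X) (αG : G ≃* G) (hequiv : ∀ (g : G) (x : X), αX (g • x) = αG g • αX x)
    (herg : Ergodic αX lam)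
    -- which contracts the group by a similitude
    (α : ℝ) (hα0 : 0 < α) (hα1 : α < 1) (hsim : ∀ g h : G, dist (αG g) (αG h) = α * dist g h)
    -- an invariant closed normal subgroup with Besicovitch quotient
    (H : Subgroup G) [H.Normal] (hHclosed : IsClosed (H : Set G))
    (hHinv : H.map αG.toMonoidHom = H)
    (hbes : GroupDisintegration.BesicovitchCoveringProperty (G ⧸ H)) :
    ∃ dG dH dT : ℝ,
      GroupDisintegration.HasDimAlong G lam dG ∧
      GroupDisintegration.HasDimAlong H lam dH ∧
      GroupDisintegration.HasTransverseDim H lam dT ∧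
      dG = dH + dT := by
  have : ProperSpace G := GroupDisintegration.properSpace_of_similitude hα0 hα1 hsim
  have : PolishSpace G := inferInstance
  have hHc : IsClosed (H : Set G) := hHclosed
  obtain ⟨N, hN⟩ := hbes
  -- the action of `H` has uniformly discrete stabilizers too
  have hdiscH : GroupDisintegration.HasUniformlyDiscreteStabilizers H X := by
    obtain ⟨V, hV, hVs⟩ := hdisc
    exact ⟨Subtype.val ⁻¹' V, continuous_subtype_val.continuousAt.preimage_mem_nhds hV,
      fun x g hg hgx => Subtype.ext (hVs x g hg hgx)⟩
  obtain ⟨σ, hσ⟩ := GroupDisintegration.exists_isDisintegration hdisc lam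
  obtain ⟨τ, hτ⟩ := GroupDisintegration.exists_isDisintegration hdiscH lam
  obtain ⟨M⟩ := hσ.nonempty_massTransport hdisc
  obtain ⟨M'⟩ := hτ.nonempty_massTransport hdiscH
  let φ := GroupDisintegration.continuousMulEquivOfSimilitude hα0 hsim
  let ψ := GroupDisintegration.restrictSimilitude hα0 hsim hHinv
  have hinv : MeasurePreserving αX.symm lam lam := herg.toMeasurePreserving.symm αX
  have hφ : ∀ᵐ x ∂lam, GroupDisintegration.SameClass (hσ.kernel x)
      ((hσ.kernel (αX.symm x)).map φ) := by
    filter_upwards [hinv.quasiMeasurePreserving.ae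
      (hσ.ae_sameClass_map αX φ hdisc hequiv herg.toMeasurePreserving)] with x hx
    rwa [αX.apply_symm_apply] at hx
  have hψ : ∀ᵐ x ∂lam, GroupDisintegration.SameClass (hτ.kernel x)
      ((hτ.kernel (αX.symm x)).map ψ) := by
    filter_upwards [hinv.quasiMeasurePreserving.ae
      (hτ.ae_sameClass_map αX ψ hdiscH (fun h x => hequiv h x) herg.toMeasurePreserving)] with x hx
    rwa [αX.apply_symm_apply] at hx
  have hφd : ∀ g, dist (φ g) 1 = α * dist g 1 := fun g => by
    have := hsim g 1
    rwa [map_one] at this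
  have hψd : ∀ g, dist (ψ g) 1 = α * dist g 1 := fun g => by
    have := hsim g 1
    rwa [map_one] at this
  have hφm : Measurable φ := φ.continuous.measurable
  have hψm : Measurable ψ := ψ.continuous.measurable
  have htube := GroupDisintegration.MassTransport.ae_tubeIntegral_scale (H := H) hinv hφm hφ hα0 hφd
    (GroupDisintegration.preimage_tube_of_similitude hα0 hsim hHinv)
  have hint := M.integrable_logRatio hN hα0 hα1
  obtain ⟨hintH, hrateT⟩ := M.ae_hasRate_tubeIntegral M' hN herg.symm hα0 hα1 htube
  have hrateG := M.ae_hasRate_lintegral_bump herg.symm hα0 hint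
    (GroupDisintegration.ae_lintegral_bump_scale hinv hφm hφ hα0 hφd)
  have hrateH := M'.ae_hasRate_lintegral_bump herg.symm hα0 hintH
    (GroupDisintegration.ae_lintegral_bump_scale hinv hψm hψ hα0 hψd)
  have hrateT' := GroupDisintegration.MassTransport.ae_hasRate_tubeIntegral_inv hinv hα0 htube hrateT
  -- the dimensions are the rates divided by `log α`
  refine ⟨_, _, _,
    GroupDisintegration.hasDimAlong_of_ae_hasRate hdisc hσ hα0 hα1
      (M.ae_ae_hasRate_ball hα0 hα1 hrateG),
    GroupDisintegration.hasDimAlong_of_ae_hasRate hdiscH hτ hα0 hα1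
      (M'.ae_ae_hasRate_ball hα0 hα1 hrateH),
    GroupDisintegration.hasTransverseDim_of_ae_hasRate hdisc hσ hα0 hα1
      fun B hB hB1 => M.ae_ae_hasRate_transverse hN hα0 hα1 hrateT' hB hB1, ?_⟩
  rw [← add_div]
  ring
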